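/- Let $I=[a,b]\subset\mathbb R$, $a<b$. A continuous map $f\colon I\to I$ is piecewise monotone if $I$ can be subdivided into finitely many closed intervals on each of which $f$ is strictly monotone; its set $\mathrm{Trn}(f)$ of turning points consists of the local extrema of $f$ in the interior of $I$. For real $x,y$ let $\langle x,y\rangle$ be the convex hull of $\{x,y\}$. A piecewise monotone map $f$ is virtually unimodal with dominant turning point $c\in\mathrm{Trn}(f)$ if (VU1) $\mathrm{Trn}(f)\cap\mathrm{int}\,\langle f^2(c),f(c)\rangle=\{c\}$; (VU2) $f^n(c)\in\langle f^2(c),f(c)\rangle$ for all $n\ge 0$; (VU3) there is $k\ge 0$ with $f^k(\mathrm{Trn}(f))\subset\langle f^2(c),f(c)\rangle$. A periodic point $x$ of $f$ of minimal period $n$ is repelling if there is an open set $U\ni x$ of $I$ such that for every $y\in U\setminus\{x\}$ there is $k\in\mathbb N$ with $f^{nk}(y)\notin U$. A point $y\in I$ is asymptotic to the orbit of $x$ if $\lim_{k\to\infty}f^{kn+m}(y)=x$ for some $m\in\mathbb N$. The Artin–Mazur zeta function of $f$ is the formal power series \[\zeta_f(t)=\exp\Big(\sum_{n\ge1}\frac{N_n(f)}{n}t^n\Big)\in\mathbb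 Q[[t]],\] where $N_n(f)$ is the number of isolated fixed points of $f^n$; it is called rational if it is the power series expansion of an element of $\mathbb Q(t)$. Theorem. Let $f\colon I\to I$ be virtually unimodal with dominant turning point $c$, and suppose that all but finitely many of the periodic points of $f$ are repelling. Then $\zeta_f$ is rational if and only if $c$ is asymptotic to a periodic orbit of $f$. -/

import Mathlib

open Filter Topology Function

namespace IntervalDynamics

variable {a b : ℝ}

/-- A continuous self-map of `[a, b]` is piecewise monotone if `[a, b]` has a finite subdivision
`a = p 0 < p 1 < ⋯ < p (m + 1) = b` such that the map is strictly monotone on each closed piece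
(merging adjacent pieces makes the pieces maximal). -/
structure IsPiecewiseMonotone (f : Set.Icc a b → Set.Icc a b) : Prop where
  continuous : Continuous f
  exists_subdivision : ∃ (m : ℕ) (p : Fin (m + 2) → Set.Icc a b),
    StrictMono p ∧ (p 0 : ℝ) = a ∧ (p (Fin.last (m + 1)) : ℝ) = b ∧
    ∀ i : Fin (m + 1),
      StrictMonoOn f (Set.Icc (p i.castSucc) (p i.succ)) ∨
      StrictAntiOn f (Set.Icc (p i.castSucc) (p i.succ))

/-- The turning points: the local extrema lying in the interior of `[a, b]`. -/
def turningPoints (f : Set.Icc a b → Set.Icc a b) : Set (Set.Icc a b) :=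
  {x | a < (x : ℝ) ∧ (x : ℝ) < b ∧ IsLocalExtr f x}

/-- `f` is virtually unimodal with dominant turning point `c`. Here
`Set.uIcc (f (f c)) (f c)` is the convex hull of `{f (f c), f c}`. -/
structure IsVirtuallyUnimodal (f : Set.Icc a b → Set.Icc a b) (c : Set.Icc a b) : Prop where
  piecewiseMonotone : IsPiecewiseMonotone f
  mem_turningPoints : c ∈ turningPoints f
  turningPoints_inter :
    (Subtype.val '' turningPoints f) ∩ interior (Set.uIcc (f (f c) : ℝ) (f c : ℝ)) = {(c : ℝ)}
  orbit_subset : ∀ n : ℕ, f^[n] c ∈ Set.uIcc (f (f c)) (f c)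
  turningPoints_image : ∃ k : ℕ, f^[k] '' turningPoints f ⊆ Set.uIcc (f (f c)) (f c)

/-- The periodic point `x`, of minimal period `n`, is repelling: some open set `U ∋ x` is left
by every other point of `U` under iteration of `f^n`. -/
def IsRepellingPeriodicPt {X : Type*} [TopologicalSpace X] (f : X → X) (x : X) : Prop :=
  x ∈ periodicPts f ∧ ∃ U : Set X, IsOpen U ∧ x ∈ U ∧
    ∀ y ∈ U, y ≠ x → ∃ k : ℕ, f^[minimalPeriod f x * k] y ∉ U

/-- `y` is asymptotic to a periodic orbit of `f`: there are a periodic point `x`, of minimal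
period `n`, and an `m` with `f^(k n + m) y → x` as `k → ∞`. -/
def IsAsymptoticToPeriodicOrbit {X : Type*} [TopologicalSpace X] (f : X → X) (y : X) : Prop :=
  ∃ x ∈ periodicPts f, ∃ m : ℕ,
    Tendsto (fun k : ℕ => f^[k * minimalPeriod f x + m] y) atTop (𝓝 x)

/-- The isolated fixed points of `f^n`. -/
def isolatedFixedPts {X : Type*} [TopologicalSpace X] (f : X → X) (n : ℕ) : Set X :=
  {x | f^[n] x = x ∧ ∃ U : Set X, IsOpen U ∧ x ∈ U ∧ ∀ y ∈ U, f^[n] y = y → y = x}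

/-- The Artin–Mazur zeta function `exp (∑_{n ≥ 1} N_n(f) t^n / n)`, a formal power series, where
`N_n(f)` is the number of isolated fixed points of `f^n`. -/
noncomputable def artinMazurZeta {X : Type*} [TopologicalSpace X] (f : X → X) : PowerSeries ℚ :=
  (PowerSeries.exp ℚ).subst
    (PowerSeries.mk fun n : ℕ => if n = 0 then 0 else ((isolatedFixedPts f n).ncard : ℚ) / n)

/-- A formal power series is (the expansion of) a rational function. -/
def IsRationalSeries (F : PowerSeries ℚ) : Prop :=
  ∃ p q : Polynomial ℚ, q ≠ 0 ∧ F * (q : PowerSeries ℚ) = (p : PowerSeries ℚ)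

end IntervalDynamics

open Filter Topology Function

namespace IntervalDynamics

/-! ### Rational power series -/

section RationalSeries

open PowerSeries

/-! The proof is Milnor–Thurston kneading theory. Points are replaced by one-sided germs, along
which every iterate has a slope `1` or `-1`. The signed itinerary of a germ records, at each time,
the slope so far and the position relative to each turning point. The jumps of the itinerary series
across the turning points form the matrix `kneading f`, written K, whose constant term is the
identity.

Fixed points are counted by telescoping. Half the product of the slope of f^n and the direction in
which f^n displaces points is constant between consecutive critical or fixed points of f^n. Across
an interior fixed point it jumps by 1 minus the number of attracting sides; across any other
critical point its jump is read off from the germ reached at time n. This gives `ncard_fixedPoints`.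
By the hypothesis on periodic points only finitely many germs are attracting, and only finitely many
periodic orbits meet a turning point or an end point. Both counts come from self-maps of finite sets
and contribute rational factors. Summed over n, the remaining terms are -X tr(K⁻¹K') and end point
corrections. Comparing logarithmic derivatives yields `artinMazurZeta_mul_det`: ζ · det K · F = 1 -
eX with F rational and nonzero. Hence ζ is rational if and only if det K is.

For a virtually unimodal map the hull of f²(c) and f(c) is invariant, contains c as its only
interior turning point, and eventually receives all turning points. Seen from inside, every other
turning point has a constant position. Column operations with rational entries therefore make K
block triangular, with one rational block and a one-by-one block equal, up to a rational factor, to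
the series of the slopes of f^m to the left of c (`IsUnimodalCore.isRationalSeries_det_iff`).

A series with finitely many coefficient values is rational exactly when the coefficients are
eventually periodic. Slopes along the orbit of c record its side of c. If they are eventually
periodic with period P, then f^(M+kP)(c) is constant or strictly monotone in k, unless c is
periodic, so c is asymptotic to a periodic orbit. Conversely, an orbit that converges to a periodic
orbit avoiding c eventually copies its sides; an orbit with a repetition is eventually periodic
anyway. -/

theorem isRationalSeries_coe (p : Polynomial ℚ) : IsRationalSeries (p : ℚ⟦X⟧) :=
  ⟨p, 1, one_ne_zero, by simp⟩

theorem IsRationalSeries.add {F G : ℚ⟦X⟧} (hF : IsRationalSeries F) (hG : IsRationalSeries G) :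
    IsRationalSeries (F + G) := by
  obtain ⟨p, q, hq, h⟩ := hF
  obtain ⟨p', q', hq', h'⟩ := hG
  refine ⟨p * q' + p' * q, q * q', mul_ne_zero hq hq', ?_⟩
  push_cast
  rw [← h, ← h']
  ring

theorem IsRationalSeries.mul {F G : ℚ⟦X⟧} (hF : IsRationalSeries F) (hG : IsRationalSeries G) :
    IsRationalSeries (F * G) := by
  obtain ⟨p, q, hq, h⟩ := hF
  obtain ⟨p', q', hq', h'⟩ := hG
  refine ⟨p * p', q * q', mul_ne_zero hq hq', ?_⟩
  push_cast
  rw [← h, ← h']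
  ring

theorem IsRationalSeries.of_mul_eq {F G H : ℚ⟦X⟧} (hG : IsRationalSeries G)
    (hH : IsRationalSeries H) (hG0 : G ≠ 0) (h : F * G = H) : IsRationalSeries F := by
  obtain ⟨p, q, hq, hp⟩ := hG
  obtain ⟨p', q', hq', hp'⟩ := hH
  have hp0 : p ≠ 0 := by
    rintro rfl
    rw [Polynomial.coe_zero] at hp
    rcases mul_eq_zero.1 hp with h0 | h0
    · exact hG0 h0
    · exact hq (by exact_mod_cast h0)
  refine ⟨p' * q, p * q', mul_ne_zero hp0 hq', ?_⟩
  push_cast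
  rw [← hp, ← hp', ← h]
  ring

/-- The rational power series form a subring of the ring of formal power series. -/
def rationalSubring : Subring ℚ⟦X⟧ where
  carrier := {F | IsRationalSeries F}
  mul_mem' := IsRationalSeries.mul
  add_mem' := IsRationalSeries.add
  one_mem' := by simpa using isRationalSeries_coe 1
  zero_mem' := by simpa using isRationalSeries_coe 0
  neg_mem' := by
    intro F hF
    simpa using (isRationalSeries_coe (-1)).mul hF

theorem mem_rationalSubring {F : ℚ⟦X⟧} : F ∈ rationalSubring ↔ IsRationalSeries F := Iff.rfl

theorem X_mem_rationalSubring : (X : ℚ⟦X⟧) ∈ rationalSubring := by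
  simpa [mem_rationalSubring] using isRationalSeries_coe Polynomial.X

theorem C_mem_rationalSubring (r : ℚ) : (C r : ℚ⟦X⟧) ∈ rationalSubring := by
  simpa [mem_rationalSubring] using isRationalSeries_coe (Polynomial.C r)

theorem det_mem_subring {A n : Type*} [CommRing A] [Fintype n] [DecidableEq n]
    (S : Subring A) (M : Matrix n n A) (h : ∀ i j, M i j ∈ S) : M.det ∈ S := by
  rw [Matrix.det_apply]
  refine S.sum_mem fun σ _ => ?_
  rcases Int.units_eq_one_or (Equiv.Perm.sign σ) with h1 | h1 <;> rw [h1]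
  · simpa using S.prod_mem fun i _ => h _ _
  · simpa using S.prod_mem fun i _ => h _ _

/-- A sequence is eventually periodic. -/
def EventuallyPeriodic {α : Type*} (e : ℕ → α) : Prop :=
  ∃ M p : ℕ, 0 < p ∧ ∀ m, M ≤ m → e (m + p) = e m

theorem isRationalSeries_of_coeff_eq_zero {F : ℚ⟦X⟧} (M : ℕ)
    (h : ∀ m, M ≤ m → coeff m F = 0) : IsRationalSeries F := by
  have : F = ((trunc M F : Polynomial ℚ) : ℚ⟦X⟧) := by
    ext n
    rw [Polynomial.coeff_coe, coeff_trunc]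
    split_ifs with hn
    · rfl
    · exact h n (not_lt.1 hn)
  rw [this]
  exact isRationalSeries_coe _

/-- Multiplication by `1 - X ^ p` kills every coefficient from `M + p` on. -/
theorem EventuallyPeriodic.isRationalSeries {e : ℕ → ℚ} (he : EventuallyPeriodic e) :
    IsRationalSeries (mk e) := by
  obtain ⟨M, p, hp, h⟩ := he
  have h1 : (1 - X ^ p : ℚ⟦X⟧) ∈ rationalSubring :=
    rationalSubring.sub_mem rationalSubring.one_mem
      (rationalSubring.pow_mem X_mem_rationalSubring p)
  refine IsRationalSeries.of_mul_eq (G := 1 - X ^ p) (H := mk e * (1 - X ^ p)) h1 ?_ ?_ rfl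
  · refine isRationalSeries_of_coeff_eq_zero (M + p) fun m hm => ?_
    rw [mul_sub, mul_one, map_sub, coeff_mk, coeff_mul_X_pow', if_pos (by omega), coeff_mk]
    have := h (m - p) (by omega)
    rw [Nat.sub_add_cancel (by omega)] at this
    rw [this, sub_self]
  · intro h0
    have := congrArg (coeff 0) h0
    simp [hp.ne'] at this

/-- The denominator gives a linear recurrence. With finitely many values two windows coincide by
pigeonhole, and the recurrence propagates the coincidence. -/
theorem EventuallyPeriodic.of_isRationalSeries {e : ℕ → ℚ} (hfin : (Set.range e).Finite)
    (he : IsRationalSeries (mk e)) : EventuallyPeriodic e := by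
  obtain ⟨P, q, hq, h⟩ := he
  -- The constant coefficient of `q` may vanish, so the newest term is isolated by dividing by the
  -- trailing coefficient, of index `r`.
  set r := q.natTrailingDegree with hr
  set d := q.natDegree with hd
  have hrd : r ≤ d := Polynomial.natTrailingDegree_le_natDegree q
  have hqr : q.coeff r ≠ 0 := by
    simpa [hr] using Polynomial.trailingCoeff_nonzero_iff_nonzero.2 hq
  -- the recurrence
  have hrec : ∀ n, P.natDegree < n + d →
      q.coeff r * e (n + d - r) =
        - ∑ i ∈ Finset.Ioc r d, q.coeff i * e (n + d - i) := by
    intro n hn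
    have h1 := congrArg (coeff (n + d)) h
    rw [Polynomial.coeff_coe, Polynomial.coeff_eq_zero_of_natDegree_lt hn, mul_comm, coeff_mul,
      Finset.Nat.sum_antidiagonal_eq_sum_range_succ_mk] at h1
    simp only [Polynomial.coeff_coe, coeff_mk] at h1
    have h2 : ∑ i ∈ Finset.Icc r d, q.coeff i * e (n + d - i) = 0 := by
      rw [← h1]
      refine Finset.sum_subset (fun i hi => ?_) fun i _ hi => ?_
      · simp only [Finset.mem_Icc] at hi
        simp only [Finset.mem_range]
        omega
      · have : q.coeff i = 0 := by
          rw [Finset.mem_Icc, not_and_or, not_le, not_le] at hi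
          rcases hi with hi | hi
          · exact Polynomial.coeff_eq_zero_of_lt_natTrailingDegree hi
          · exact Polynomial.coeff_eq_zero_of_natDegree_lt hi
        rw [this, zero_mul]
    rw [← Finset.Ioc_insert_left hrd, Finset.sum_insert (by simp)] at h2
    linarith
  -- two equal windows
  have hfin' : (Set.range fun n : ℕ => fun i : Fin (d + 1) => e (n + i)).Finite := by
    refine (Set.Finite.pi' (fun _ : Fin (d + 1) => hfin)).subset ?_
    rintro _ ⟨n, rfl⟩ i
    exact ⟨_, rfl⟩
  obtain ⟨n₁, hn₁, n₂, hn₂, hne, hw⟩ : ∃ n₁ ∈ Set.Ioi P.natDegree, ∃ n₂ ∈ Set.Ioi P.natDegree,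
      n₁ < n₂ ∧ (fun i : Fin (d + 1) => e (n₁ + i)) = fun i : Fin (d + 1) => e (n₂ + i) := by
    exact (Set.Ioi_infinite P.natDegree).exists_lt_map_eq_of_mapsTo
      (fun n _ => Set.mem_range_self n) hfin'
  refine ⟨n₁, n₂ - n₁, by omega, ?_⟩
  have key : ∀ k, e (n₁ + k) = e (n₂ + k) := by
    intro k
    induction k using Nat.strong_induction_on with
    | _ k ih =>
      by_cases hk : k ≤ d
      · exact congrFun hw ⟨k, by omega⟩
      · have a1 := hrec (n₁ + k + r - d) (by simp only [Set.mem_Ioi] at hn₁; omega)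
        have a2 := hrec (n₂ + k + r - d) (by simp only [Set.mem_Ioi] at hn₂; omega)
        rw [show n₁ + k + r - d + d - r = n₁ + k by omega] at a1
        rw [show n₂ + k + r - d + d - r = n₂ + k by omega] at a2
        refine mul_left_cancel₀ hqr ?_
        rw [a1, a2]
        congr 1
        refine Finset.sum_congr rfl fun i hi => ?_
        rw [Finset.mem_Ioc] at hi
        rw [show n₁ + k + r - d + d - i = n₁ + (k + r - i) by omega,
          show n₂ + k + r - d + d - i = n₂ + (k + r - i) by omega, ih _ (by omega)]
  intro m hm
  have := key (m - n₁)
  rw [show n₁ + (m - n₁) = m by omega] at this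
  rw [this]
  congr 1
  omega

end RationalSeries

/-! ### Logarithmic derivatives -/

section LogDerivative

open PowerSeries

/-- `D` is the logarithmic derivative of `F`, with respect to the Euler derivation. -/
def HasLogDeriv (F D : ℚ⟦X⟧) : Prop := X * d⁄dX ℚ F = D * F

theorem HasLogDeriv.mul {F G D D' : ℚ⟦X⟧} (hF : HasLogDeriv F D) (hG : HasLogDeriv G D') :
    HasLogDeriv (F * G) (D + D') := by
  unfold HasLogDeriv at *
  rw [Derivation.leibniz, smul_eq_mul, smul_eq_mul]
  linear_combination F * hG + G * hF

/-- The quotient `F * G⁻¹` has zero derivative and constant coefficient 1. -/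
theorem HasLogDeriv.unique {F G D : ℚ⟦X⟧} (hF : HasLogDeriv F D) (hG : HasLogDeriv G D)
    (h : constantCoeff F = constantCoeff G) (h0 : constantCoeff G ≠ 0) : F = G := by
  unfold HasLogDeriv at *
  have h1 : d⁄dX ℚ F * G = F * d⁄dX ℚ G := by
    refine mul_left_cancel₀ (X_ne_zero (R := ℚ)) ?_
    linear_combination G * hF - F * hG
  have hGG : G * G⁻¹ = 1 := PowerSeries.mul_inv_cancel G h0
  have h2 : F * G⁻¹ = 1 := by
    refine derivative.ext ?_ ?_
    · rw [Derivation.leibniz, derivative_inv', derivative_one, smul_eq_mul, smul_eq_mul]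
      linear_combination G⁻¹ ^ 2 * h1 - G⁻¹ * d⁄dX ℚ F * hGG
    · rw [map_mul, constantCoeff_inv, h, map_one, mul_inv_cancel₀ h0]
  linear_combination G * h2 - F * hGG

theorem hasSubst_zeta (N : ℕ → ℚ) :
    HasSubst (mk fun n : ℕ => if n = 0 then 0 else N n / n : ℚ⟦X⟧) :=
  HasSubst.of_constantCoeff_zero' (by simp [← coeff_zero_eq_constantCoeff_apply])

/-- Passing to logarithmic derivatives removes both the exponential and the division by `n`; only
the plain counts remain. -/
theorem hasLogDeriv_zeta (N : ℕ → ℚ) :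
    HasLogDeriv ((PowerSeries.exp ℚ).subst (mk fun n : ℕ => if n = 0 then 0 else N n / n))
      (mk fun n : ℕ => if n = 0 then 0 else N n) := by
  unfold HasLogDeriv
  rw [derivative_subst (hasSubst_zeta N), derivative_exp]
  have : X * d⁄dX ℚ (mk fun n : ℕ => if n = 0 then 0 else N n / n) =
      (mk fun n : ℕ => if n = 0 then 0 else N n : ℚ⟦X⟧) := by
    ext n
    rcases n with _ | n
    · simp
    · rw [coeff_succ_X_mul, coeff_derivative]
      simp
      field_simp
  rw [← this]
  ring

theorem constantCoeff_zeta (N : ℕ → ℚ) :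
    constantCoeff ((PowerSeries.exp ℚ).subst
      (mk fun n : ℕ => if n = 0 then 0 else N n / n)) = 1 := by
  have h0 := constantCoeff_subst_eq_zero (a := (mk fun n : ℕ => if n = 0 then 0 else N n / n : ℚ⟦X⟧))
    (by rw [← PowerSeries.constantCoeff.eq_def, ← coeff_zero_eq_constantCoeff_apply]; simp)
    (PowerSeries.exp ℚ - 1) (by simp)
  have h1 : PowerSeries.exp ℚ = (PowerSeries.exp ℚ - 1) + 1 := by ring
  rw [h1, subst_add (hasSubst_zeta N), map_add, ← coe_substAlgHom (hasSubst_zeta N), map_one,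
    coe_substAlgHom (hasSubst_zeta N), PowerSeries.constantCoeff.eq_def, h0]
  simp

/-- The Jacobi formula for a derivation. -/
theorem derivation_det {R A n : Type*} [CommRing R] [CommRing A] [Algebra R A] [Fintype n]
    [DecidableEq n] (D : Derivation R A A) (M : Matrix n n A) :
    D M.det = (M.adjugate * M.map D).trace := by
  have hprod : ∀ (s : Finset n) (g : n → A),
      D (∏ i ∈ s, g i) = ∑ i ∈ s, ∏ j ∈ s, Function.update g i (D (g i)) j := by
    intro s g
    induction s using Finset.induction_on with
    | empty => simp
    | insert a s ha ih =>
      rw [Finset.prod_insert ha, Derivation.leibniz, ih, Finset.sum_insert ha,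
        Finset.prod_insert ha, Function.update_self, smul_eq_mul, smul_eq_mul, add_comm]
      congr 1
      · rw [mul_comm]
        congr 1
        refine Finset.prod_congr rfl fun j hj => ?_
        rw [Function.update_of_ne (by rintro rfl; exact ha hj)]
      · rw [Finset.mul_sum]
        refine Finset.sum_congr rfl fun i hi => ?_
        rw [Finset.prod_insert ha, Function.update_of_ne (by rintro rfl; exact ha hi)]
  have h1 : D M.det = ∑ i, (M.updateCol i fun k => D (M k i)).det := by
    simp only [Matrix.det_apply]
    rw [map_sum, Finset.sum_comm]
    refine Finset.sum_congr rfl fun σ _ => ?_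
    rw [Units.smul_def, map_zsmul, hprod, Finset.smul_sum]
    refine Finset.sum_congr rfl fun i _ => ?_
    rw [Units.smul_def]
    congr 1
    refine Finset.prod_congr rfl fun j _ => ?_
    by_cases hj : j = i
    · subst hj; simp
    · rw [Function.update_of_ne hj, Matrix.updateCol_ne hj]
  rw [h1, Matrix.trace]
  refine Finset.sum_congr rfl fun i _ => ?_
  rw [← Matrix.cramer_apply, Matrix.cramer_eq_adjugate_mulVec]
  rfl

theorem hasLogDeriv_det {n : Type*} [Fintype n] [DecidableEq n] (K Q : Matrix n n ℚ⟦X⟧)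
    (h : K * Q = 1) :
    HasLogDeriv K.det (X * (Q * K.map (d⁄dX ℚ)).trace) := by
  unfold HasLogDeriv
  rw [derivation_det]
  have : K.adjugate = K.det • Q := by
    calc K.adjugate = K.adjugate * (K * Q) := by rw [h, mul_one]
      _ = K.det • Q := by rw [← mul_assoc, Matrix.adjugate_mul, Matrix.smul_mul, one_mul]
  rw [this, Matrix.smul_mul, Matrix.trace_smul, smul_eq_mul]
  ring

/-- The zeta function of a self-map of a finite set is rational. -/
theorem exists_rational_hasLogDeriv_of_finite {α : Type*} {S : Set α} (hS : S.Finite) {h : α → α}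
    (hh : Set.MapsTo h S S) :
    ∃ F : ℚ⟦X⟧, IsRationalSeries F ∧ constantCoeff F = 1 ∧
      HasLogDeriv F (- mk fun n : ℕ => if n = 0 then 0 else ({x ∈ S | h^[n] x = x}.ncard : ℚ)) := by
  classical
  have : Fintype S := hS.fintype
  set g : S → S := hh.restrict h S S with hg
  have hgn : ∀ (n : ℕ) (x : S), ((g^[n] x : S) : α) = h^[n] x := by
    intro n x
    rw [hg, Set.MapsTo.iterate_restrict, Set.MapsTo.val_restrict_apply]
  -- `K` is `1 - X * A` with `A` the transition matrix of `g`, and `Q` is the geometric series of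
  -- the powers of `A`. The determinant of `K` is the reciprocal of the zeta function of `g`, hence
  -- the minus sign in the logarithmic derivative.
  set K : Matrix S S ℚ⟦X⟧ :=
    Matrix.of fun x y => (if x = y then 1 else 0) - if g x = y then X else 0 with hK
  set Q : Matrix S S ℚ⟦X⟧ := Matrix.of fun x y => mk fun n => if g^[n] x = y then 1 else 0 with hQ
  have hQX : ∀ x y, X * Q (g x) y = Q x y - if x = y then 1 else 0 := by
    intro x y
    ext n
    rcases n with _ | n
    · by_cases hxy : x = y <;> simp [hQ, hxy]
    · rw [coeff_succ_X_mul]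
      by_cases hxy : x = y <;> simp [hQ, hxy, PowerSeries.coeff_one] <;> rfl
  have hKQ : K * Q = 1 := by
    ext1 x y
    rw [Matrix.mul_apply, Matrix.one_apply]
    simp only [hK, Matrix.of_apply, sub_mul, ite_mul, one_mul, zero_mul, Finset.sum_sub_distrib,
      Finset.sum_ite_eq, Finset.mem_univ, if_true]
    rw [hQX]
    ring
  refine ⟨K.det, ?_, ?_, ?_⟩
  · rw [← mem_rationalSubring]
    refine det_mem_subring _ _ fun i j => ?_
    refine Subring.sub_mem _ ?_ ?_
    · split_ifs
      exacts [Subring.one_mem _, Subring.zero_mem _]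
    · split_ifs
      exacts [X_mem_rationalSubring, Subring.zero_mem _]
  · rw [RingHom.map_det]
    have : (constantCoeff (R := ℚ)).mapMatrix K = 1 := by
      ext1 x y
      simp only [hK, RingHom.mapMatrix_apply, Matrix.map_apply, Matrix.one_apply, Matrix.of_apply]
      split_ifs <;> simp
    rw [this, Matrix.det_one]
  · have := hasLogDeriv_det K Q hKQ
    convert this using 1
    rw [Matrix.trace_mul_comm, Matrix.trace, Finset.mul_sum]
    have h1 : ∀ x, X * (K.map (d⁄dX ℚ) * Q).diag x = 1 - Q x x := by
      intro x
      rw [Matrix.diag_apply, Matrix.mul_apply]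
      have h2 : ∀ y, K.map (d⁄dX ℚ) x y = - if g x = y then 1 else 0 := by
        intro y
        simp only [hK, Matrix.map_apply, Matrix.of_apply]
        split_ifs <;> simp
      simp only [h2, neg_mul, ite_mul, one_mul, zero_mul, Finset.sum_neg_distrib,
        Finset.sum_ite_eq, Finset.mem_univ, if_true]
      rw [mul_neg, hQX]
      simp
    rw [Finset.sum_congr rfl fun x _ => h1 x]
    ext n
    rw [map_neg, coeff_mk, map_sum]
    rcases n with _ | n
    · simp [hQ]
    · simp only [hQ, Matrix.of_apply, map_sub, coeff_mk, PowerSeries.coeff_one, Nat.succ_ne_zero, if_false, zero_sub,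
        Finset.sum_neg_distrib, Finset.sum_boole]
      congr 2
      rw [← Set.ncard_coe_finset, ← Set.ncard_image_of_injective _ Subtype.val_injective]
      congr 1
      ext x
      simp only [Set.mem_image, Finset.coe_filter, Finset.mem_univ, true_and, Set.mem_ofPred_eq,
        Subtype.exists, Subtype.ext_iff, hgn]
      constructor
      · rintro ⟨h1, h2⟩; exact ⟨x, h1, h2, rfl⟩
      · rintro ⟨y, h1, h2, rfl⟩; exact ⟨h1, h2⟩

end LogDerivative

/-! ### Germs of one-sided neighbourhoods -/

section Order

variable {α : Type*} [LinearOrder α]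

/-- `y` lies strictly on the side `s` of `x`. -/
def SideLT (s : ℤˣ) (x y : α) : Prop := (s = 1 ∧ x < y) ∨ (s = -1 ∧ y < x)

theorem sideLT_one {x y : α} : SideLT 1 x y ↔ x < y := by
  simp [SideLT, show (1 : ℤˣ) ≠ -1 by decide]

theorem sideLT_neg_one {x y : α} : SideLT (-1) x y ↔ y < x := by
  simp [SideLT, show (-1 : ℤˣ) ≠ 1 by decide]

theorem sideLT_neg {s : ℤˣ} {x y : α} : SideLT (-s) x y ↔ SideLT s y x := by
  rcases Int.units_eq_one_or s with rfl | rfl <;> simp [sideLT_one, sideLT_neg_one]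

theorem SideLT.not_symm {s : ℤˣ} {x y : α} (h : SideLT s x y) : ¬ SideLT s y x := by
  rcases Int.units_eq_one_or s with rfl | rfl <;>
    simp only [sideLT_one, sideLT_neg_one] at * <;> exact h.not_gt

theorem SideLT.ne {s : ℤˣ} {x y : α} (h : SideLT s x y) : x ≠ y := by
  rintro rfl; exact h.not_symm h

theorem SideLT.trans {s : ℤˣ} {x y z : α} (h : SideLT s x y) (h' : SideLT s y z) :
    SideLT s x z := by
  rcases Int.units_eq_one_or s with rfl | rfl <;>
    simp only [sideLT_one, sideLT_neg_one] at *
  exacts [h.trans h', h'.trans h]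

theorem SideLT.eq {s s' : ℤˣ} {x y : α} (h : SideLT s x y) (h' : SideLT s' x y) : s = s' := by
  rcases Int.units_eq_one_or s with rfl | rfl <;> rcases Int.units_eq_one_or s' with rfl | rfl <;>
    simp only [sideLT_one, sideLT_neg_one] at *
  exacts [(h.not_gt h').elim, (h.not_gt h').elim]

theorem sideLT_or_sideLT (s : ℤˣ) {x y : α} (h : x ≠ y) : SideLT s x y ∨ SideLT s y x := by
  rcases Int.units_eq_one_or s with rfl | rfl <;> simp only [sideLT_one, sideLT_neg_one]
  exacts [lt_or_gt_of_ne h, (lt_or_gt_of_ne h).symm]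

/-- `g` is strictly monotone on `S` if `η = 1`, strictly antitone if `η = -1`. -/
def StrictSlopeOn (g : α → α) (η : ℤˣ) (S : Set α) : Prop :=
  ∀ u ∈ S, ∀ v ∈ S, u < v → SideLT η (g u) (g v)

theorem StrictSlopeOn.sideLT {g : α → α} {η s : ℤˣ} {S : Set α} (h : StrictSlopeOn g η S) {u v : α}
    (hu : u ∈ S) (hv : v ∈ S) (huv : SideLT s u v) : SideLT (s * η) (g u) (g v) := by
  rcases Int.units_eq_one_or s with rfl | rfl
  · simpa using h u hu v hv (sideLT_one.1 huv)
  · rw [neg_one_mul, sideLT_neg]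
    exact h v hv u hu (sideLT_neg_one.1 huv)

/-- A germ of a one-sided neighbourhood of a point. -/
abbrev Germ (α : Type*) := α × ℤˣ

open Classical in
/-- The sign of monotonicity of `f` along a germ. -/
noncomputable def slope (f : α → α) (γ : Germ α) : ℤˣ :=
  if ∃ y, SideLT γ.2 γ.1 y ∧ StrictMonoOn f (Set.uIcc γ.1 y) then 1 else -1

/-- The action of `f` on germs. -/
noncomputable def germMap (f : α → α) (γ : Germ α) : Germ α := (f γ.1, γ.2 * slope f γ)

/-- The sign of monotonicity of `f^n` along a germ. -/
noncomputable def slopeIter (f : α → α) (n : ℕ) (γ : Germ α) : ℤˣ :=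
  ∏ i ∈ Finset.range n, slope f ((germMap f)^[i] γ)

theorem slopeIter_zero (f : α → α) (γ : Germ α) : slopeIter f 0 γ = 1 := rfl

theorem slopeIter_succ (f : α → α) (n : ℕ) (γ : Germ α) :
    slopeIter f (n + 1) γ = slope f γ * slopeIter f n (germMap f γ) := by
  rw [slopeIter, Finset.prod_range_succ', mul_comm]
  rfl

theorem slopeIter_add (f : α → α) (m n : ℕ) (γ : Germ α) :
    slopeIter f (m + n) γ = slopeIter f m γ * slopeIter f n ((germMap f)^[m] γ) := by
  rw [slopeIter, Finset.prod_range_add]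
  simp only [slopeIter, ← Function.iterate_add_apply, add_comm]

theorem slopeIter_one (f : α → α) (γ : Germ α) : slopeIter f 1 γ = slope f γ := by
  simp [slopeIter]

theorem germMap_iterate (f : α → α) (n : ℕ) (γ : Germ α) :
    (germMap f)^[n] γ = (f^[n] γ.1, γ.2 * slopeIter f n γ) := by
  induction n generalizing γ with
  | zero => simp [slopeIter_zero]
  | succ n ih =>
    rw [Function.iterate_succ_apply, ih, slopeIter_succ, Function.iterate_succ_apply, ← mul_assoc]
    rfl

theorem slope_right_eq_one {f : α → α} {x y : α} (hxy : x < y) (h : StrictMonoOn f (Set.Icc x y)) :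
    slope f (x, 1) = 1 :=
  if_pos ⟨y, sideLT_one.2 hxy, by rwa [Set.uIcc_of_le hxy.le]⟩

theorem slope_left_eq_one {f : α → α} {x y : α} (hxy : x < y) (h : StrictMonoOn f (Set.Icc x y)) :
    slope f (y, -1) = 1 :=
  if_pos ⟨x, sideLT_neg_one.2 hxy, by rwa [Set.uIcc_of_ge hxy.le]⟩

theorem slope_right_eq_neg_one [DenselyOrdered α] {f : α → α} {x y : α} (hxy : x < y) (h : StrictAntiOn f (Set.Icc x y)) :
    slope f (x, 1) = -1 := by
  refine if_neg ?_
  rintro ⟨z, hz, hm⟩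
  rw [sideLT_one] at hz
  simp only [Set.uIcc_of_le hz.le] at hm
  obtain ⟨w, hw1, hw2⟩ := exists_between (lt_min hxy hz)
  rw [lt_min_iff] at hw2
  exact (h ⟨le_rfl, hxy.le⟩ ⟨hw1.le, hw2.1.le⟩ hw1).not_gt
    (hm ⟨le_rfl, hz.le⟩ ⟨hw1.le, hw2.2.le⟩ hw1)

theorem slope_left_eq_neg_one [DenselyOrdered α] {f : α → α} {x y : α} (hxy : x < y) (h : StrictAntiOn f (Set.Icc x y)) :
    slope f (y, -1) = -1 := by
  refine if_neg ?_
  rintro ⟨z, hz, hm⟩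
  rw [sideLT_neg_one] at hz
  simp only [Set.uIcc_of_ge hz.le] at hm
  obtain ⟨w, hw1, hw2⟩ := exists_between (max_lt hxy hz)
  rw [max_lt_iff] at hw1
  exact (h ⟨hw1.1.le, hw2.le⟩ ⟨hxy.le, le_rfl⟩ hw2).not_gt
    (hm ⟨hw1.2.le, hw2.le⟩ ⟨hz.le, le_rfl⟩ hw2)

open Classical in
/-- The position of a germ with respect to a point: `1 / 2` above, `-1 / 2` below. -/
noncomputable def position (γ : Germ α) (w : α) : ℚ :=
  if w < γ.1 ∨ (w = γ.1 ∧ γ.2 = 1) then 1 / 2 else -1 / 2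

theorem position_of_lt {γ : Germ α} {w : α} (h : w < γ.1) : position γ w = 1 / 2 :=
  if_pos (Or.inl h)

theorem position_of_gt {γ : Germ α} {w : α} (h : γ.1 < w) : position γ w = -1 / 2 :=
  if_neg (by rintro (h' | ⟨h', -⟩); exacts [h.not_gt h', h.ne' h'])

theorem position_self (x : α) (s : ℤˣ) : position (x, s) x = ((s : ℤ) : ℚ) / 2 := by
  rcases Int.units_eq_one_or s with rfl | rfl <;> simp [position]

/-- The germ lies in the interval `[p, q]`. -/
def GermIn (p q : α) (γ : Germ α) : Prop :=
  p ≤ γ.1 ∧ γ.1 ≤ q ∧ (γ.2 = 1 → γ.1 < q) ∧ (γ.2 = -1 → p < γ.1)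

theorem germIn_of_mem_Ioo {p q : α} {γ : Germ α} (h : γ.1 ∈ Set.Ioo p q) : GermIn p q γ :=
  ⟨h.1.le, h.2.le, fun _ => h.2, fun _ => h.1⟩

/-- The germ lies in the whole space. -/
def GermValid [BoundedOrder α] (γ : Germ α) : Prop := GermIn ⊥ ⊤ γ

/-! ### Finite sets and gaps -/

theorem exists_gap_right {V : Set α} (hV : V.Finite) {x q : α} (h : x < q) :
    ∃ y, x < y ∧ y ≤ q ∧ ∀ w ∈ Set.Ioo x y, w ∉ V := by
  induction V, hV using Set.Finite.induction_on with
  | empty => exact ⟨q, h, le_rfl, by simp⟩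
  | @insert a V _ _ ih =>
    obtain ⟨y, hxy, hyq, hy⟩ := ih
    by_cases ha : a ∈ Set.Ioo x y
    · refine ⟨a, ha.1, ha.2.le.trans hyq, fun w hw => ?_⟩
      rw [Set.mem_insert_iff, not_or]
      exact ⟨hw.2.ne, hy w ⟨hw.1, hw.2.trans ha.2⟩⟩
    · refine ⟨y, hxy, hyq, fun w hw => ?_⟩
      rw [Set.mem_insert_iff, not_or]
      exact ⟨by rintro rfl; exact ha hw, hy w hw⟩

theorem exists_gap_left {V : Set α} (hV : V.Finite) {x p : α} (h : p < x) :
    ∃ y, y < x ∧ p ≤ y ∧ ∀ w ∈ Set.Ioo y x, w ∉ V := by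
  obtain ⟨y, h1, h2, h3⟩ := exists_gap_right (α := αᵒᵈ) (V := OrderDual.ofDual ⁻¹' V)
    (hV.preimage OrderDual.ofDual.injective.injOn) (x := OrderDual.toDual x)
    (q := OrderDual.toDual p) h
  exact ⟨OrderDual.ofDual y, h1, h2, fun w hw => h3 (OrderDual.toDual w) ⟨hw.2, hw.1⟩⟩

/-- Off `V`, a point of `S` is determined by the set of points of `V` below it, and `V` has finitely
many subsets. -/
theorem finite_of_gap {V S : Set α} (hV : V.Finite)
    (h : ∀ x ∈ S, ∀ y ∈ S, x < y → (∀ w ∈ Set.Icc x y, w ∉ V) → False) : S.Finite := by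
  suffices (S \ V).Finite from (this.union hV).subset fun x hx => by
    by_cases hxV : x ∈ V
    exacts [Or.inr hxV, Or.inl ⟨hx, hxV⟩]
  refine Set.Finite.of_finite_image (f := fun x => {v ∈ V | v < x})
    (hV.finite_subsets.subset ?_) ?_
  · rintro _ ⟨x, -, rfl⟩
    exact fun v hv => hv.1
  · have key : ∀ x ∈ S \ V, ∀ y ∈ S \ V, x < y →
        {v ∈ V | v < x} = {v ∈ V | v < y} → False := by
      intro x hx y hy hxy he
      refine h x hx.1 y hy.1 hxy fun w hw hwV => ?_
      rcases hw.2.eq_or_lt with rfl | hwy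
      · exact hy.2 hwV
      · have : w ∈ {v ∈ V | v < x} := by rw [he]; exact ⟨hwV, hwy⟩
        exact this.2.not_ge hw.1
    intro x hx y hy he
    by_contra hne
    rcases lt_or_gt_of_ne hne with hlt | hlt
    · exact key x hx y hy hlt he
    · exact key y hy x hx hlt he.symm

/-! ### Telescoping -/

/-- A function of germs is constant over the gaps of `V`. -/
def GapConst (ψ : Germ α → ℚ) (V : Set α) : Prop :=
  ∀ x y, x < y → (∀ w ∈ Set.Ioo x y, w ∉ V) → ψ (x, 1) = ψ (y, -1)

theorem GapConst.sub_eq_sum {ψ : Germ α → ℚ} {V : Finset α} (h : GapConst ψ V) {x y : α}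
    (hxy : x < y) :
    ψ (y, -1) - ψ (x, 1) = ∑ w ∈ V with x < w ∧ w < y, (ψ (w, 1) - ψ (w, -1)) := by
  induction hn : (V.filter fun w => x < w ∧ w < y).card using Nat.strong_induction_on
    generalizing x y with
  | _ n ih =>
    by_cases hem : (V.filter fun w => x < w ∧ w < y) = ∅
    · rw [hem, Finset.sum_empty, h x y hxy, sub_self]
      intro w hw hwV
      have : w ∈ (V.filter fun w => x < w ∧ w < y) := Finset.mem_filter.2 ⟨hwV, hw⟩
      rw [hem] at this
      simp at this
    · obtain ⟨v, hv⟩ := Finset.nonempty_iff_ne_empty.2 hem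
      have hv' := Finset.mem_filter.1 hv
      have hsplit : (V.filter fun w => x < w ∧ w < y) =
          insert v ((V.filter fun w => x < w ∧ w < v) ∪ V.filter fun w => v < w ∧ w < y) := by
        ext w
        simp only [Finset.mem_filter, Finset.mem_insert, Finset.mem_union]
        constructor
        · rintro ⟨h1, h2, h3⟩
          rcases lt_trichotomy w v with h4 | h4 | h4
          · exact Or.inr (Or.inl ⟨h1, h2, h4⟩)
          · exact Or.inl h4
          · exact Or.inr (Or.inr ⟨h1, h4, h3⟩)
        · rintro (rfl | ⟨h1, h2, h3⟩ | ⟨h1, h2, h3⟩)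
          · exact hv'
          · exact ⟨h1, h2, h3.trans hv'.2.2⟩
          · exact ⟨h1, hv'.2.1.trans h2, h3⟩
      have hdis : Disjoint (V.filter fun w => x < w ∧ w < v) (V.filter fun w => v < w ∧ w < y) := by
        rw [Finset.disjoint_left]
        intro w h1 h2
        exact (Finset.mem_filter.1 h1).2.2.not_gt (Finset.mem_filter.1 h2).2.1
      have hvn : v ∉ (V.filter fun w => x < w ∧ w < v) ∪ V.filter fun w => v < w ∧ w < y := by
        simp
      rw [hsplit, Finset.card_insert_of_notMem hvn, Finset.card_union_of_disjoint hdis] at hn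
      rw [hsplit, Finset.sum_insert hvn, Finset.sum_union hdis,
        ← ih _ (by omega) hv'.2.1 rfl, ← ih _ (by omega) hv'.2.2 rfl]
      ring

/-- Averaging the telescoping sums from the two ends makes a jump count with weight `1 / 2` when it
lies below the germ and `-1 / 2` when it lies above, which are the values of `position`. -/
theorem GapConst.eq_add_sum [BoundedOrder α] {ψ : Germ α → ℚ} {V : Finset α} (h : GapConst ψ V)
    (hV : ∀ w ∈ V, ⊥ < w ∧ w < ⊤) (hlt : (⊥ : α) < ⊤) {γ : Germ α} (hγ : GermValid γ) :
    ψ γ = (ψ (⊥, 1) + ψ (⊤, -1)) / 2 + ∑ w ∈ V, (ψ (w, 1) - ψ (w, -1)) * position γ w := by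
  have htot := h.sub_eq_sum hlt
  rw [Finset.filter_true_of_mem hV] at htot
  obtain ⟨y, s⟩ := γ
  rcases Int.units_eq_one_or s with rfl | rfl
  · have h1 := h.sub_eq_sum (hγ.2.2.1 rfl : y < ⊤)
    have h2 : ∑ w ∈ V, (ψ (w, 1) - ψ (w, -1)) * position (y, 1) w =
        (∑ w ∈ V, (ψ (w, 1) - ψ (w, -1))) / 2 -
          ∑ w ∈ V with y < w ∧ w < ⊤, (ψ (w, 1) - ψ (w, -1)) := by
      rw [Finset.sum_filter, Finset.sum_div, ← Finset.sum_sub_distrib]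
      refine Finset.sum_congr rfl fun w hw => ?_
      rcases lt_trichotomy w y with h4 | rfl | h4
      · rw [position_of_lt h4, if_neg (fun h5 => h4.not_gt h5.1)]; ring
      · rw [position_self, if_neg (fun h5 => lt_irrefl _ h5.1)]; simp; ring
      · rw [position_of_gt h4, if_pos ⟨h4, (hV w hw).2⟩]; ring
    rw [h2, ← h1, ← htot]; ring
  · have h1 := h.sub_eq_sum (hγ.2.2.2 rfl : ⊥ < y)
    have h2 : ∑ w ∈ V, (ψ (w, 1) - ψ (w, -1)) * position (y, -1) w =
        (∑ w ∈ V with ⊥ < w ∧ w < y, (ψ (w, 1) - ψ (w, -1))) -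
        (∑ w ∈ V, (ψ (w, 1) - ψ (w, -1))) / 2 := by
      rw [Finset.sum_filter, Finset.sum_div, ← Finset.sum_sub_distrib]
      refine Finset.sum_congr rfl fun w hw => ?_
      rcases lt_trichotomy w y with h4 | rfl | h4
      · rw [position_of_lt h4, if_pos ⟨(hV w hw).1, h4⟩]; ring
      · rw [position_self, if_neg (fun h5 => lt_irrefl _ h5.2)]; simp; ring
      · rw [position_of_gt h4, if_neg (fun h5 => h4.not_gt h5.2)]; ring
    rw [h2, ← h1, ← htot]; ring

end Order

/-! ### Laps -/

section Laps

variable {α : Type*} [ConditionallyCompleteLinearOrder α] [DenselyOrdered α] [TopologicalSpace α]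
  [OrderTopology α] [BoundedOrder α] {f : α → α}

/-- The interior local extrema. -/
def turning (f : α → α) : Set α := {x | ⊥ < x ∧ x < ⊤ ∧ IsLocalExtr f x}

/-- The points whose orbit hits a turning point before time `n`. -/
def turningIter (f : α → α) (n : ℕ) : Set α := {x | ∃ j < n, f^[j] x ∈ turning f}

/-- A failure of injectivity would produce a local extremum strictly inside, and a continuous
injective map on an interval is strictly monotone. -/
theorem strictMonoOn_or_strictAntiOn (hf : Continuous f) {x y : α} (hxy : x < y)
    (h : ∀ w ∈ Set.Ioo x y, w ∉ turning f) :
    StrictMonoOn f (Set.Icc x y) ∨ StrictAntiOn f (Set.Icc x y) := by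
  refine hf.continuousOn.strictMonoOn_of_injOn_Icc' hxy.le ?_
  have key : ∀ u ∈ Set.Icc x y, ∀ v ∈ Set.Icc x y, u < v → f u = f v → False := by
    intro u hu v hv huv he
    obtain ⟨w, hw, hext⟩ := exists_isLocalExtr_Ioo huv hf.continuousOn he
    have hw' : w ∈ Set.Ioo x y := ⟨hu.1.trans_lt hw.1, hw.2.trans_le hv.2⟩
    exact h w hw' ⟨bot_le.trans_lt hw'.1, hw'.2.trans_le le_top, hext⟩
  intro u hu v hv he
  by_contra hne
  rcases lt_or_gt_of_ne hne with hlt | hlt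
  · exact key u hu v hv hlt he
  · exact key v hv u hu hlt he.symm

theorem strictSlopeOn_of_gap (hf : Continuous f) {x y : α} (hxy : x < y)
    (h : ∀ w ∈ Set.Ioo x y, w ∉ turning f) :
    StrictSlopeOn f (slope f (x, 1)) (Set.Icc x y) ∧ slope f (y, -1) = slope f (x, 1) := by
  rcases strictMonoOn_or_strictAntiOn hf hxy h with hm | hm
  · rw [slope_right_eq_one hxy hm, slope_left_eq_one hxy hm]
    exact ⟨fun u hu v hv huv => sideLT_one.2 (hm hu hv huv), rfl⟩
  · rw [slope_right_eq_neg_one hxy hm, slope_left_eq_neg_one hxy hm]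
    exact ⟨fun u hu v hv huv => sideLT_neg_one.2 (hm hu hv huv), rfl⟩

/-- By the intermediate value theorem the open image of the gap under `f` avoids `turningIter f n`,
so the induction hypothesis applies to the image interval, with its ends exchanged when `f`
decreases. -/
theorem strictSlopeOn_iterate_of_gap (hf : Continuous f) (n : ℕ) {x y : α} (hxy : x < y)
    (h : ∀ w ∈ Set.Ioo x y, w ∉ turningIter f n) :
    StrictSlopeOn f^[n] (slopeIter f n (x, 1)) (Set.Icc x y) ∧
      slopeIter f n (y, -1) = slopeIter f n (x, 1) := by
  induction n generalizing x y with
  | zero =>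
    exact ⟨fun u _ v _ huv => by simpa [slopeIter_zero, sideLT_one] using huv, rfl⟩
  | succ n ih =>
    obtain ⟨h1, h2⟩ := strictSlopeOn_of_gap hf hxy
      fun w hw hw' => h w hw ⟨0, Nat.succ_pos n, hw'⟩
    rw [slopeIter_succ, slopeIter_succ, germMap, germMap, h2]
    rcases Int.units_eq_one_or (slope f (x, 1)) with hs | hs
    · rw [hs] at h1 ⊢
      have hlt := sideLT_one.1 (h1 x ⟨le_rfl, hxy.le⟩ y ⟨hxy.le, le_rfl⟩ hxy)
      obtain ⟨h3, h4⟩ := ih hlt fun w hw hw' => by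
        obtain ⟨z, hz, rfl⟩ := intermediate_value_Ioo hxy.le hf.continuousOn hw
        obtain ⟨j, hj, hj'⟩ := hw'
        exact h z hz ⟨j + 1, by omega, hj'⟩
      refine ⟨fun u hu v hv huv => ?_, by simp [h4]⟩
      have hm : ∀ u ∈ Set.Icc x y, f u ∈ Set.Icc (f x) (f y) := by
        intro u hu
        constructor
        · rcases hu.1.eq_or_lt with rfl | hlt
          · exact le_rfl
          · exact (sideLT_one.1 (h1 x ⟨le_rfl, hxy.le⟩ u hu hlt)).le
        · rcases hu.2.eq_or_lt with rfl | hlt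
          · exact le_rfl
          · exact (sideLT_one.1 (h1 u hu y ⟨hxy.le, le_rfl⟩ hlt)).le
      simpa using h3 _ (hm u hu) _ (hm v hv) (sideLT_one.1 (h1 u hu v hv huv))
    · rw [hs] at h1 ⊢
      have hlt := sideLT_neg_one.1 (h1 x ⟨le_rfl, hxy.le⟩ y ⟨hxy.le, le_rfl⟩ hxy)
      obtain ⟨h3, h4⟩ := ih hlt fun w hw hw' => by
        obtain ⟨z, hz, rfl⟩ := intermediate_value_Ioo' hxy.le hf.continuousOn hw
        obtain ⟨j, hj, hj'⟩ := hw'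
        exact h z hz ⟨j + 1, by omega, hj'⟩
      refine ⟨fun u hu v hv huv => ?_, by simp [h4]⟩
      have hm : ∀ u ∈ Set.Icc x y, f u ∈ Set.Icc (f y) (f x) := by
        intro u hu
        constructor
        · rcases hu.2.eq_or_lt with rfl | hlt
          · exact le_rfl
          · exact (sideLT_neg_one.1 (h1 u hu y ⟨hxy.le, le_rfl⟩ hlt)).le
        · rcases hu.1.eq_or_lt with rfl | hlt
          · exact le_rfl
          · exact (sideLT_neg_one.1 (h1 x ⟨le_rfl, hxy.le⟩ u hu hlt)).le
      have := h3 _ (hm v hv) _ (hm u hu) (sideLT_neg_one.1 (h1 u hu v hv huv))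
      simp only [one_mul, neg_one_mul, sideLT_neg, Function.iterate_succ_apply]
      rwa [h4]

/-- Equal slopes on the two sides would make `f` strictly monotone across `x`, against the local
extremum. -/
theorem slope_right_eq_neg_left (hf : Continuous f) (hT : (turning f).Finite) {x : α}
    (hx : x ∈ turning f) : slope f (x, 1) = - slope f (x, -1) := by
  obtain ⟨y, hy, -, hyg⟩ := exists_gap_left hT hx.1
  obtain ⟨z, hz, -, hzg⟩ := exists_gap_right hT hx.2.1
  obtain ⟨h1, h2⟩ := strictSlopeOn_of_gap hf hy hyg
  obtain ⟨h3, -⟩ := strictSlopeOn_of_gap hf hz hzg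
  rw [h2]
  by_contra hne
  have he : slope f (x, 1) = slope f (y, 1) := by
    rcases Int.units_eq_one_or (slope f (x, 1)) with e1 | e1 <;>
    rcases Int.units_eq_one_or (slope f (y, 1)) with e2 | e2 <;> simp_all
  rw [← he] at h1
  have hnear : ∀ᶠ u in 𝓝 x, u ∈ Set.Ioo y z := Ioo_mem_nhds hy hz
  have := nhdsGT_neBot_of_exists_gt ⟨z, hz⟩
  have := nhdsLT_neBot_of_exists_lt ⟨y, hy⟩
  have hnr : ∃ᶠ u in 𝓝 x, x < u :=
    (eventually_mem_nhdsWithin (a := x) (s := Set.Ioi x)).frequently.filter_mono nhdsWithin_le_nhds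
  have hnl : ∃ᶠ u in 𝓝 x, u < x :=
    (eventually_mem_nhdsWithin (a := x) (s := Set.Iio x)).frequently.filter_mono nhdsWithin_le_nhds
  rcases hx.2.2 with hmin | hmax
  · obtain ⟨u, hu1, hu2, hu3⟩ := (hnr.and_eventually (hnear.and hmin)).exists
    obtain ⟨v, hv1, hv2, hv3⟩ := (hnl.and_eventually (hnear.and hmin)).exists
    have a1 := h3 x ⟨le_rfl, hz.le⟩ u ⟨hu1.le, hu2.2.le⟩ hu1
    have a2 := h1 v ⟨hv2.1.le, hv1.le⟩ x ⟨hy.le, le_rfl⟩ hv1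
    rcases a1 with ⟨e1, a1⟩ | ⟨e1, a1⟩
    · rw [e1, sideLT_one] at a2; exact a2.not_ge hv3
    · exact a1.not_ge hu3
  · obtain ⟨u, hu1, hu2, hu3⟩ := (hnr.and_eventually (hnear.and hmax)).exists
    obtain ⟨v, hv1, hv2, hv3⟩ := (hnl.and_eventually (hnear.and hmax)).exists
    have a1 := h3 x ⟨le_rfl, hz.le⟩ u ⟨hu1.le, hu2.2.le⟩ hu1
    have a2 := h1 v ⟨hv2.1.le, hv1.le⟩ x ⟨hy.le, le_rfl⟩ hv1
    rcases a1 with ⟨e1, a1⟩ | ⟨e1, a1⟩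
    · exact a1.not_ge hu3
    · rw [e1, sideLT_neg_one] at a2; exact a2.not_ge hv3

theorem slope_right_eq_left (hf : Continuous f) (hT : (turning f).Finite) {x : α}
    (h1 : ⊥ < x) (h2 : x < ⊤) (hx : x ∉ turning f) : slope f (x, 1) = slope f (x, -1) := by
  obtain ⟨y, hy, -, hyg⟩ := exists_gap_left hT h1
  obtain ⟨z, hz, -, hzg⟩ := exists_gap_right hT h2
  have hg : ∀ w ∈ Set.Ioo y z, w ∉ turning f := by
    intro w hw
    rcases lt_trichotomy w x with h | rfl | h
    exacts [hyg w ⟨hw.1, h⟩, hx, hzg w ⟨h, hw.2⟩]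
  rcases strictMonoOn_or_strictAntiOn hf (hy.trans hz) hg with hm | hm
  · rw [slope_right_eq_one hz (hm.mono (Set.Icc_subset_Icc_left hy.le)),
      slope_left_eq_one hy (hm.mono (Set.Icc_subset_Icc_right hz.le))]
  · rw [slope_right_eq_neg_one hz (hm.mono (Set.Icc_subset_Icc_left hy.le)),
      slope_left_eq_neg_one hy (hm.mono (Set.Icc_subset_Icc_right hz.le))]

theorem finite_preimage_singleton (hf : Continuous f) (hT : (turning f).Finite) (v : α) :
    (f ⁻¹' {v}).Finite := by
  refine finite_of_gap hT fun x hx y hy hxy h => ?_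
  rcases strictMonoOn_or_strictAntiOn hf hxy fun w hw => h w (Set.Ioo_subset_Icc_self hw)
    with hm | hm
  · exact (hm ⟨le_rfl, hxy.le⟩ ⟨hxy.le, le_rfl⟩ hxy).ne (hx.trans hy.symm)
  · exact (hm ⟨le_rfl, hxy.le⟩ ⟨hxy.le, le_rfl⟩ hxy).ne (hy.trans hx.symm)

theorem finite_preimage_iterate (hf : Continuous f) (hT : (turning f).Finite) {V : Set α}
    (hV : V.Finite) (n : ℕ) : (f^[n] ⁻¹' V).Finite := by
  induction n with
  | zero => simpa using hV
  | succ n ih =>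
    rw [Function.iterate_succ, Set.preimage_comp]
    exact ih.preimage' fun b _ => finite_preimage_singleton hf hT b

theorem finite_turningIter (hf : Continuous f) (hT : (turning f).Finite) (n : ℕ) :
    (turningIter f n).Finite := by
  have : turningIter f n = ⋃ j ∈ Set.Iio n, f^[j] ⁻¹' turning f := by
    ext x; simp [turningIter]
  rw [this]
  exact (Set.finite_Iio n).biUnion fun j _ => finite_preimage_iterate hf hT hT j

/-- The image of a nearby point on the side of the germ stays in `[p, q]`, and witnesses that the
image germ does not point out of it. -/
theorem germIn_germMap (hf : Continuous f) (hT : (turning f).Finite) {p q : α}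
    (hJ : Set.MapsTo f (Set.Icc p q) (Set.Icc p q)) {γ : Germ α} (hγ : GermIn p q γ) :
    GermIn p q (germMap f γ) := by
  obtain ⟨x, s⟩ := γ
  have hx := hJ ⟨hγ.1, hγ.2.1⟩
  obtain ⟨y, hy, hlt⟩ : ∃ y ∈ Set.Icc p q, SideLT (s * slope f (x, s)) (f x) (f y) := by
    rcases Int.units_eq_one_or s with rfl | rfl
    · obtain ⟨y, hy, hyq, hyg⟩ := exists_gap_right hT (hγ.2.2.1 rfl)
      refine ⟨y, ⟨hγ.1.trans hy.le, hyq⟩, ?_⟩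
      simpa using (strictSlopeOn_of_gap hf hy hyg).1 x ⟨le_rfl, hy.le⟩ y ⟨hy.le, le_rfl⟩ hy
    · obtain ⟨y, hy, hyq, hyg⟩ := exists_gap_left hT (hγ.2.2.2 rfl)
      refine ⟨y, ⟨hyq, hy.le.trans hγ.2.1⟩, ?_⟩
      have := strictSlopeOn_of_gap hf hy hyg
      rw [this.2, neg_one_mul, sideLT_neg]
      exact this.1 y ⟨le_rfl, hy.le⟩ x ⟨hy.le, le_rfl⟩ hy
  refine ⟨hx.1, hx.2, fun h => ?_, fun h => ?_⟩
  · rw [show s * slope f (x, s) = 1 from h, sideLT_one] at hlt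
    exact hlt.trans_le (hJ hy).2
  · rw [show s * slope f (x, s) = -1 from h, sideLT_neg_one] at hlt
    exact (hJ hy).1.trans_lt hlt

theorem germIn_germMap_iterate (hf : Continuous f) (hT : (turning f).Finite) {p q : α}
    (hJ : Set.MapsTo f (Set.Icc p q) (Set.Icc p q)) {γ : Germ α} (hγ : GermIn p q γ) (n : ℕ) :
    GermIn p q ((germMap f)^[n] γ) := by
  induction n with
  | zero => exact hγ
  | succ n ih =>
    rw [Function.iterate_succ_apply']
    exact germIn_germMap hf hT hJ ih

theorem germValid_germMap_iterate (hf : Continuous f) (hT : (turning f).Finite) {γ : Germ α}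
    (hγ : GermValid γ) (n : ℕ) : GermValid ((germMap f)^[n] γ) :=
  germIn_germMap_iterate hf hT (fun _ _ => ⟨bot_le, le_top⟩) hγ n

end Laps

set_option linter.unusedSectionVars false

/-- A sign as a rational number. -/
def sgn (s : ℤˣ) : ℚ := ((s : ℤ) : ℚ)

@[simp] theorem sgn_one : sgn 1 = 1 := by simp [sgn]

@[simp] theorem sgn_neg (s : ℤˣ) : sgn (-s) = - sgn s := by simp [sgn]

theorem sgn_mul (s t : ℤˣ) : sgn (s * t) = sgn s * sgn t := by simp [sgn]

theorem sgn_mul_self (s : ℤˣ) : sgn s * sgn s = 1 := by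
  rcases Int.units_eq_one_or s with rfl | rfl <;> simp

theorem sgn_injective : Function.Injective sgn := fun s t h => by
  simpa [sgn, Units.ext_iff] using h

/-! ### One-sided neighbourhoods -/

section Sides

variable {α : Type*} [ConditionallyCompleteLinearOrder α] [DenselyOrdered α] [TopologicalSpace α]
  [OrderTopology α] [BoundedOrder α] {f : α → α}

/-- The filter of one-sided neighbourhoods given by a germ. -/
def sideNhds {α : Type*} [LinearOrder α] [TopologicalSpace α] (γ : Germ α) : Filter α :=
  𝓝[{z | SideLT γ.2 γ.1 z}] γ.1

theorem sideNhds_one (x : α) : sideNhds (x, 1) = 𝓝[>] x := by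
  simp only [sideNhds, sideLT_one]; rfl

theorem sideNhds_neg_one (x : α) : sideNhds (x, -1) = 𝓝[<] x := by
  simp only [sideNhds, sideLT_neg_one]; rfl

theorem sideNhds_le_nhds (γ : Germ α) : sideNhds γ ≤ 𝓝 γ.1 := nhdsWithin_le_nhds

theorem eventually_sideLT (γ : Germ α) : ∀ᶠ z in sideNhds γ, SideLT γ.2 γ.1 z :=
  eventually_mem_nhdsWithin

theorem sideNhds_neBot {γ : Germ α} (hγ : GermValid γ) : (sideNhds γ).NeBot := by
  obtain ⟨x, s⟩ := γ
  rcases Int.units_eq_one_or s with rfl | rfl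
  · rw [sideNhds_one]
    exact nhdsGT_neBot_of_exists_gt ⟨⊤, hγ.2.2.1 rfl⟩
  · rw [sideNhds_neg_one]
    exact nhdsLT_neBot_of_exists_lt ⟨⊥, hγ.2.2.2 rfl⟩

theorem eventually_sideLT_of_sideLT {γ : Germ α} {y : α} (h : SideLT γ.2 γ.1 y) :
    ∀ᶠ z in sideNhds γ, SideLT γ.2 z y := by
  obtain ⟨x, s⟩ := γ
  refine sideNhds_le_nhds _ ?_
  rcases Int.units_eq_one_or s with rfl | rfl
  · simp only [sideLT_one] at h ⊢
    exact eventually_lt_nhds h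
  · simp only [sideLT_neg_one] at h ⊢
    exact eventually_gt_nhds h

theorem exists_of_eventually_sideNhds {γ : Germ α} (hγ : GermValid γ) {P : α → Prop}
    (h : ∀ᶠ z in sideNhds γ, P z) :
    ∃ y, SideLT γ.2 γ.1 y ∧ ∀ z, SideLT γ.2 γ.1 z → SideLT γ.2 z y → P z := by
  obtain ⟨x, s⟩ := γ
  rcases Int.units_eq_one_or s with rfl | rfl
  · rw [sideNhds_one] at h
    obtain ⟨y, hy, hy'⟩ := (mem_nhdsGT_iff_exists_Ioo_subset' (hγ.2.2.1 rfl)).1 h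
    exact ⟨y, sideLT_one.2 hy, fun z h1 h2 => hy' ⟨sideLT_one.1 h1, sideLT_one.1 h2⟩⟩
  · rw [sideNhds_neg_one] at h
    obtain ⟨y, hy, hy'⟩ := (mem_nhdsLT_iff_exists_Ioo_subset' (hγ.2.2.2 rfl)).1 h
    exact ⟨y, sideLT_neg_one.2 hy, fun z h1 h2 => hy' ⟨sideLT_neg_one.1 h2, sideLT_neg_one.1 h1⟩⟩

/-- The iterates of `f` have a slope on a one-sided neighbourhood. -/
theorem exists_strictSlopeOn (hf : Continuous f) (hT : (turning f).Finite) {γ : Germ α}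
    (hγ : GermValid γ) (n : ℕ) :
    ∃ y, SideLT γ.2 γ.1 y ∧ StrictSlopeOn f^[n] (slopeIter f n γ) (Set.uIcc γ.1 y) := by
  obtain ⟨x, s⟩ := γ
  have hW := finite_turningIter hf hT n
  rcases Int.units_eq_one_or s with rfl | rfl
  · obtain ⟨y, hy, -, hyg⟩ := exists_gap_right hW (hγ.2.2.1 rfl)
    refine ⟨y, sideLT_one.2 hy, ?_⟩
    simp only [Set.uIcc_of_le hy.le]
    exact (strictSlopeOn_iterate_of_gap hf n hy hyg).1
  · obtain ⟨y, hy, -, hyg⟩ := exists_gap_left hW (hγ.2.2.2 rfl)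
    refine ⟨y, sideLT_neg_one.2 hy, ?_⟩
    simp only [Set.uIcc_of_ge hy.le]
    rw [(strictSlopeOn_iterate_of_gap hf n hy hyg).2]
    exact (strictSlopeOn_iterate_of_gap hf n hy hyg).1

theorem mem_uIcc_of_sideLT {s : ℤˣ} {x y z : α} (h1 : SideLT s x z) (h2 : SideLT s z y) :
    z ∈ Set.uIcc x y := by
  rcases Int.units_eq_one_or s with rfl | rfl
  · rw [sideLT_one] at h1 h2
    exact Set.mem_uIcc_of_le h1.le h2.le
  · rw [sideLT_neg_one] at h1 h2
    exact Set.mem_uIcc_of_ge h2.le h1.le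

theorem eventually_sideLT_iterate (hf : Continuous f) (hT : (turning f).Finite) {γ : Germ α}
    (hγ : GermValid γ) (n : ℕ) :
    ∀ᶠ z in sideNhds γ, SideLT (γ.2 * slopeIter f n γ) (f^[n] γ.1) (f^[n] z) := by
  obtain ⟨y, hy, hs⟩ := exists_strictSlopeOn hf hT hγ n
  filter_upwards [eventually_sideLT γ, eventually_sideLT_of_sideLT hy] with z h1 h2
  exact hs.sideLT Set.left_mem_uIcc (mem_uIcc_of_sideLT h1 h2) h1

theorem tendsto_sideNhds (hf : Continuous f) (hT : (turning f).Finite) {γ : Germ α}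
    (hγ : GermValid γ) (n : ℕ) :
    Tendsto f^[n] (sideNhds γ) (sideNhds ((germMap f)^[n] γ)) := by
  rw [germMap_iterate]
  refine tendsto_nhdsWithin_iff.2 ⟨?_, eventually_sideLT_iterate hf hT hγ n⟩
  exact ((hf.iterate n).tendsto γ.1).mono_left (sideNhds_le_nhds γ)

/-- Every point close to `f γ.1` on the image side is the image of a point close to `γ.1` on the
side of `γ`. This transports attraction from a germ to its image. -/
theorem sideNhds_germMap_le (hf : Continuous f) (hT : (turning f).Finite) {γ : Germ α}
    (hγ : GermValid γ) : sideNhds (germMap f γ) ≤ map f (sideNhds γ) := by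
  intro S hS
  rw [mem_map] at hS
  obtain ⟨y, hy, hs⟩ := exists_strictSlopeOn hf hT hγ 1
  obtain ⟨y', hy', hP⟩ := exists_of_eventually_sideNhds hγ hS
  rw [slopeIter_one, iterate_one] at hs
  obtain ⟨v, hv1, hv2, hv3⟩ : ∃ v, SideLT γ.2 γ.1 v ∧ SideLT γ.2 v y ∧ SideLT γ.2 v y' := by
    have := sideNhds_neBot hγ
    exact ((eventually_sideLT γ).and ((eventually_sideLT_of_sideLT hy).and
      (eventually_sideLT_of_sideLT hy'))).exists
  have hlt := hs.sideLT Set.left_mem_uIcc (mem_uIcc_of_sideLT hv1 hv2) hv1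
  have hv : SideLT (germMap f γ).2 (germMap f γ).1 (f v) := hlt
  filter_upwards [eventually_sideLT (germMap f γ), eventually_sideLT_of_sideLT hv] with z hz1 hz2
  have hz : z ∈ Set.uIcc (f γ.1) (f v) := mem_uIcc_of_sideLT hz1 hz2
  obtain ⟨u, hu, rfl⟩ := intermediate_value_uIcc hf.continuousOn hz
  have hu1 : u ≠ γ.1 := by rintro rfl; exact hz1.ne rfl
  have hu2 : u ≠ v := by rintro rfl; exact hz2.ne rfl
  have key : SideLT γ.2 γ.1 u ∧ SideLT γ.2 u v := by
    rcases Int.units_eq_one_or γ.2 with h | h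
    · rw [h, sideLT_one] at hv1
      rw [Set.uIcc_of_le hv1.le] at hu
      rw [h, sideLT_one, sideLT_one]
      exact ⟨lt_of_le_of_ne hu.1 hu1.symm, lt_of_le_of_ne hu.2 hu2⟩
    · rw [h, sideLT_neg_one] at hv1
      rw [Set.uIcc_of_ge hv1.le] at hu
      rw [h, sideLT_neg_one, sideLT_neg_one]
      exact ⟨lt_of_le_of_ne hu.2 hu1, lt_of_le_of_ne hu.1 hu2.symm⟩
  exact hP u key.1 (key.2.trans hv3)

/-! ### The sign of the displacement -/

open Classical in
/-- The sign of the displacement of `g` along a germ. -/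
noncomputable def displacementSign (g : α → α) (γ : Germ α) : ℤˣ :=
  if ∀ᶠ z in sideNhds γ, z < g z then 1 else -1

theorem displacementSign_eq {g : α → α} {γ : Germ α} (hγ : GermValid γ) {σ : ℤˣ}
    (h : ∀ᶠ z in sideNhds γ, SideLT σ z (g z)) : displacementSign g γ = σ := by
  rcases Int.units_eq_one_or σ with rfl | rfl
  · simp only [sideLT_one] at h
    exact if_pos h
  · simp only [sideLT_neg_one] at h
    refine if_neg fun h' => ?_
    have := sideNhds_neBot hγ
    obtain ⟨z, h1, h2⟩ := (h.and h').exists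
    exact h1.not_gt h2

theorem exists_sign_on_gap {g : α → α} (hg : Continuous g) {x y : α}
    (h : ∀ w ∈ Set.Ioo x y, g w ≠ w) : ∃ σ : ℤˣ, ∀ z ∈ Set.Ioo x y, SideLT σ z (g z) := by
  by_cases h1 : ∀ z ∈ Set.Ioo x y, z < g z
  · exact ⟨1, fun z hz => sideLT_one.2 (h1 z hz)⟩
  · push Not at h1
    obtain ⟨z₀, hz₀, hle⟩ := h1
    refine ⟨-1, fun z hz => ?_⟩
    rw [sideLT_neg_one]
    by_contra hcon
    obtain ⟨w, hw, he⟩ := isPreconnected_Ioo.intermediate_value₂ hz₀ hz hg.continuousOn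
      continuousOn_id hle (not_lt.1 hcon)
    exact h w hw he

theorem eventually_mem_Ioo_right {x y : α} (h : x < y) :
    ∀ᶠ z in sideNhds (x, 1), z ∈ Set.Ioo x y := by
  filter_upwards [eventually_sideLT (x, 1),
    eventually_sideLT_of_sideLT (γ := (x, 1)) (sideLT_one.2 h)] with z h1 h2
  exact ⟨sideLT_one.1 h1, sideLT_one.1 h2⟩

theorem eventually_mem_Ioo_left {x y : α} (h : x < y) :
    ∀ᶠ z in sideNhds (y, -1), z ∈ Set.Ioo x y := by
  filter_upwards [eventually_sideLT (y, -1),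
    eventually_sideLT_of_sideLT (γ := (y, -1)) (sideLT_neg_one.2 h)] with z h1 h2
  exact ⟨sideLT_neg_one.1 h2, sideLT_neg_one.1 h1⟩

theorem germValid_right {x y : α} (h : x < y) : GermValid (x, (1 : ℤˣ)) :=
  ⟨bot_le, le_top, fun _ => h.trans_le le_top, fun h' => absurd h' (show ¬ _ = (_ : ℤˣ) from by simp)⟩

theorem germValid_left {x y : α} (h : x < y) : GermValid (y, (-1 : ℤˣ)) :=
  ⟨bot_le, le_top, fun h' => absurd h' (show ¬ _ = (_ : ℤˣ) from by simp), fun _ => bot_le.trans_lt h⟩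

theorem eventually_displacementSign {g : α → α} (hg : Continuous g)
    (hfix : (Function.fixedPoints g).Finite) {γ : Germ α} (hγ : GermValid γ) :
    ∀ᶠ z in sideNhds γ, SideLT (displacementSign g γ) z (g z) := by
  suffices ∃ σ : ℤˣ, ∀ᶠ z in sideNhds γ, SideLT σ z (g z) by
    obtain ⟨σ, hσ⟩ := this
    rwa [displacementSign_eq hγ hσ]
  obtain ⟨x, s⟩ := γ
  rcases Int.units_eq_one_or s with rfl | rfl
  · obtain ⟨y, hy, -, hyg⟩ := exists_gap_right hfix (hγ.2.2.1 rfl)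
    obtain ⟨σ, hσ⟩ := exists_sign_on_gap hg hyg
    exact ⟨σ, (eventually_mem_Ioo_right hy).mono hσ⟩
  · obtain ⟨y, hy, -, hyg⟩ := exists_gap_left hfix (hγ.2.2.2 rfl)
    obtain ⟨σ, hσ⟩ := exists_sign_on_gap hg hyg
    exact ⟨σ, (eventually_mem_Ioo_left hy).mono hσ⟩

theorem displacementSign_of_sideLT {g : α → α} (hg : Continuous g) {γ : Germ α}
    (hγ : GermValid γ) {σ : ℤˣ} (h : SideLT σ γ.1 (g γ.1)) : displacementSign g γ = σ := by
  refine displacementSign_eq hγ (sideNhds_le_nhds γ ?_)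
  rcases Int.units_eq_one_or σ with rfl | rfl
  · simp only [sideLT_one] at h ⊢
    exact (isOpen_lt continuous_id hg).mem_nhds h
  · simp only [sideLT_neg_one] at h ⊢
    exact (isOpen_lt hg continuous_id).mem_nhds h

/-! ### Attracting germs -/

/-- The germ is attracting under `f^n`. -/
def IsAttracting (f : α → α) (n : ℕ) (γ : Germ α) : Prop :=
  GermValid γ ∧ f^[n] γ.1 = γ.1 ∧
    ∀ᶠ z in sideNhds γ, SideLT γ.2 γ.1 (f^[n] z) ∧ SideLT γ.2 (f^[n] z) z

theorem isAttracting_iff (hf : Continuous f) (hT : (turning f).Finite) {n : ℕ}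
    (hfix : (Function.fixedPoints f^[n]).Finite) {γ : Germ α} (hγ : GermValid γ)
    (hx : f^[n] γ.1 = γ.1) :
    IsAttracting f n γ ↔ slopeIter f n γ = 1 ∧ displacementSign f^[n] γ = -γ.2 := by
  have h1 := eventually_sideLT_iterate hf hT hγ n
  have h2 := eventually_displacementSign (hf.iterate n) hfix hγ
  have := sideNhds_neBot hγ
  rw [hx] at h1
  constructor
  · rintro ⟨-, -, h⟩
    obtain ⟨z, a1, a2, a3, a4⟩ := (h1.and (h2.and h)).exists
    refine ⟨?_, ?_⟩
    · simpa using a1.eq a3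
    · exact a2.eq (sideLT_neg.2 a4)
  · rintro ⟨e1, e2⟩
    refine ⟨hγ, hx, ?_⟩
    filter_upwards [h1, h2] with z a1 a2
    rw [e1, mul_one] at a1
    rw [e2, sideLT_neg] at a2
    exact ⟨a1, a2⟩

/-- Half the product of the slope and the sign of the displacement. -/
noncomputable def displacement (f : α → α) (n : ℕ) (γ : Germ α) : ℚ :=
  sgn (slopeIter f n γ) * sgn (displacementSign f^[n] γ) / 2

-- At a fixed point, a decreasing germ lands on the other side, and the product of its two signs is
-- that of an increasing germ displaced outwards. Only an increasing germ displaced inwards has the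
-- opposite product. An interior fixed point therefore gives a jump of 1 minus the number of its
-- attracting sides.
open Classical in
theorem displacement_of_fixed (hf : Continuous f) (hT : (turning f).Finite) {n : ℕ}
    (hfix : (Function.fixedPoints f^[n]).Finite) {γ : Germ α} (hγ : GermValid γ)
    (hx : f^[n] γ.1 = γ.1) :
    displacement f n γ = sgn γ.2 * (1 / 2 - if IsAttracting f n γ then 1 else 0) := by
  rw [isAttracting_iff hf hT hfix hγ hx, displacement]
  have h1 := eventually_sideLT_iterate hf hT hγ n
  have h2 := eventually_displacementSign (hf.iterate n) hfix hγ
  have := sideNhds_neBot hγ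
  rw [hx] at h1
  rcases Int.units_eq_one_or (slopeIter f n γ) with e1 | e1
  · rcases Int.units_eq_one_or (displacementSign f^[n] γ) with e2 | e2 <;>
    rcases Int.units_eq_one_or γ.2 with e3 | e3 <;> rw [e1, e2, e3] <;> norm_num
  · obtain ⟨z, a1, a2, a3⟩ := (h1.and (h2.and (eventually_sideLT γ))).exists
    have e2 : displacementSign f^[n] γ = -γ.2 := by
      refine a2.eq ?_
      rw [e1, mul_neg_one] at a1
      exact (sideLT_neg.2 a3).trans a1
    rw [e1, e2]
    norm_num
    ring

theorem gapConst_displacement (hf : Continuous f) (n : ℕ) :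
    GapConst (displacement f n) (turningIter f n ∪ Function.fixedPoints f^[n]) := by
  intro x y hxy h
  have h1 := (strictSlopeOn_iterate_of_gap hf n hxy fun w hw hw' => h w hw (Or.inl hw')).2
  obtain ⟨σ, hσ⟩ := exists_sign_on_gap (hf.iterate n) fun w hw hw' => h w hw (Or.inr hw')
  rw [displacement, displacement, h1,
    displacementSign_eq (germValid_right hxy) ((eventually_mem_Ioo_right hxy).mono hσ),
    displacementSign_eq (germValid_left hxy) ((eventually_mem_Ioo_left hxy).mono hσ)]

end Sides

/-! ### First hits of the turning set -/

section FirstHit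

variable {α : Type*} [ConditionallyCompleteLinearOrder α] [DenselyOrdered α] [TopologicalSpace α]
  [OrderTopology α] [BoundedOrder α] {f : α → α}

/-- An interior point sent to an end point attains a global extremum there. -/
theorem map_mem_Ioo_of_notMem_turning {x : α} (hx : x ∈ Set.Ioo ⊥ ⊤) (h : x ∉ turning f) :
    f x ∈ Set.Ioo ⊥ ⊤ := by
  constructor
  · refine bot_lt_iff_ne_bot.2 fun h0 => h ⟨hx.1, hx.2, Or.inl (Eventually.of_forall fun y => ?_)⟩
    rw [h0]; exact bot_le
  · refine lt_top_iff_ne_top.2 fun h0 => h ⟨hx.1, hx.2, Or.inr (Eventually.of_forall fun y => ?_)⟩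
    rw [h0]; exact le_top

theorem iterate_mem_Ioo_and_slopeIter_eq (hf : Continuous f) (hT : (turning f).Finite) {w : α}
    (hw : w ∈ Set.Ioo ⊥ ⊤) {j : ℕ} (h : ∀ i < j, f^[i] w ∉ turning f) :
    f^[j] w ∈ Set.Ioo ⊥ ⊤ ∧ slopeIter f j (w, 1) = slopeIter f j (w, -1) := by
  induction j with
  | zero => exact ⟨hw, rfl⟩
  | succ j ih =>
    obtain ⟨h1, h2⟩ := ih fun i hi => h i (by omega)
    refine ⟨?_, ?_⟩
    · rw [iterate_succ_apply']
      exact map_mem_Ioo_of_notMem_turning h1 (h j (by omega))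
    · rw [slopeIter_add, slopeIter_add, slopeIter_one, slopeIter_one, germMap_iterate,
        germMap_iterate, ← h2]
      have := slope_right_eq_left hf hT h1.1 h1.2 (h j (by omega))
      rcases Int.units_eq_one_or (slopeIter f j (w, 1)) with e | e <;> simp [e, this]

/-- The interior points whose orbit first hits the turning set at time `j`, at the point `l`. -/
def firstHit (f : α → α) (j : ℕ) (l : α) : Set α :=
  {w | w ∈ Set.Ioo ⊥ ⊤ ∧ f^[j] w = l ∧ ∀ i < j, f^[i] w ∉ turning f}

theorem finite_firstHit (hf : Continuous f) (hT : (turning f).Finite) (j : ℕ) (l : α) :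
    (firstHit f j l).Finite :=
  (finite_preimage_iterate hf hT (Set.finite_singleton l) j).subset fun _ hw => hw.2.1

/-- The interior points whose orbit hits the turning set before time `n`. -/
def crit (f : α → α) (n : ℕ) : Set α := turningIter f n ∩ Set.Ioo ⊥ ⊤

theorem finite_crit (hf : Continuous f) (hT : (turning f).Finite) (n : ℕ) : (crit f n).Finite :=
  (finite_turningIter hf hT n).inter_of_left _

theorem mem_crit_iff {n : ℕ} {w : α} :
    w ∈ crit f n ↔ ∃ j < n, ∃ l ∈ turning f, w ∈ firstHit f j l := by
  classical
  constructor
  · rintro ⟨⟨j, hj, hw⟩, hw'⟩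
    have hex : ∃ j, f^[j] w ∈ turning f := ⟨j, hw⟩
    exact ⟨Nat.find hex, (Nat.find_min' hex hw).trans_lt hj, _, Nat.find_spec hex, hw', rfl,
      fun i hi => Nat.find_min hex hi⟩
  · rintro ⟨j, hj, l, hl, hw⟩
    exact ⟨⟨j, hj, hw.2.1 ▸ hl⟩, hw.1⟩

theorem firstHit_unique {j j' : ℕ} {l l' : α} (hl : l ∈ turning f) (hl' : l' ∈ turning f) {w : α}
    (h : w ∈ firstHit f j l) (h' : w ∈ firstHit f j' l') : j = j' ∧ l = l' := by
  have : j = j' := by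
    rcases lt_trichotomy j j' with hlt | he | hlt
    · exact (h'.2.2 j hlt (h.2.1 ▸ hl)).elim
    · exact he
    · exact (h.2.2 j' hlt (h'.2.1 ▸ hl')).elim
  subst this
  exact ⟨rfl, h.2.1.symm.trans h'.2.1⟩

theorem sum_crit (hf : Continuous f) [Fintype (turning f)] (n : ℕ) (F : α → ℚ) :
    ∑ w ∈ (finite_crit hf (Set.toFinite _) n).toFinset, F w =
      ∑ j ∈ Finset.range n, ∑ l : turning f,
        ∑ w ∈ (finite_firstHit hf (Set.toFinite _) j l).toFinset, F w := by
  classical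
  rw [← Finset.sum_product', ← Finset.sum_biUnion]
  · refine Finset.sum_congr ?_ fun _ _ => rfl
    ext w
    simp [mem_crit_iff]
  · intro a _ b _ hab
    rw [Function.onFun, Finset.disjoint_left]
    intro w h1 h2
    rw [Set.Finite.mem_toFinset] at h1 h2
    obtain ⟨e1, e2⟩ := firstHit_unique a.2.2 b.2.2 h1 h2
    exact hab (Prod.ext e1 (Subtype.ext e2))

theorem germMap_turning (hf : Continuous f) (hT : (turning f).Finite) {l : α} (hl : l ∈ turning f)
    (s : ℤˣ) : germMap f (l, s) = germMap f (l, -1) := by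
  rcases Int.units_eq_one_or s with rfl | rfl
  · simp [germMap, slope_right_eq_neg_left hf hT hl]
  · rfl

theorem germMap_iterate_turning (hf : Continuous f) (hT : (turning f).Finite) {l : α}
    (hl : l ∈ turning f) (s : ℤˣ) {m : ℕ} (hm : 0 < m) :
    (germMap f)^[m] (l, s) = (germMap f)^[m] (l, -1) := by
  obtain ⟨m, rfl⟩ := Nat.exists_eq_succ_of_ne_zero hm.ne'
  rw [iterate_succ_apply, iterate_succ_apply, germMap_turning hf hT hl]

theorem slopeIter_turning (hf : Continuous f) (hT : (turning f).Finite) {l : α}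
    (hl : l ∈ turning f) (s : ℤˣ) {m : ℕ} (hm : 0 < m) :
    slopeIter f m (l, s) = - s * slopeIter f m (l, -1) := by
  obtain ⟨m, rfl⟩ := Nat.exists_eq_succ_of_ne_zero hm.ne'
  rw [slopeIter_succ, slopeIter_succ, germMap_turning hf hT hl]
  rcases Int.units_eq_one_or s with rfl | rfl
  · simp [slope_right_eq_neg_left hf hT hl]
  · simp

theorem firstHit_iterate (hf : Continuous f) (hT : (turning f).Finite) {j : ℕ} {l w : α}
    (hw : w ∈ firstHit f j l) (s : ℤˣ) (m : ℕ) :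
    slopeIter f (j + m) (w, s) =
        slopeIter f j (w, 1) * slopeIter f m (l, s * slopeIter f j (w, 1)) ∧
      (germMap f)^[j + m] (w, s) = (germMap f)^[m] (l, s * slopeIter f j (w, 1)) := by
  have h1 : slopeIter f j (w, s) = slopeIter f j (w, 1) := by
    rcases Int.units_eq_one_or s with rfl | rfl
    · rfl
    · exact (iterate_mem_Ioo_and_slopeIter_eq hf hT hw.1 hw.2.2).2.symm
  have h2 : (germMap f)^[j] (w, s) = (l, s * slopeIter f j (w, 1)) := by
    rw [germMap_iterate, h1, hw.2.1]
  rw [slopeIter_add, add_comm j m, iterate_add_apply, h2, h1]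
  exact ⟨rfl, rfl⟩

/-- The orientation `slopeIter f j (w, 1)` enters twice, as a factor of the slope and through the
side of `l` that is reached. The two occurrences cancel. -/
theorem firstHit_iterate_left (hf : Continuous f) (hT : (turning f).Finite) {j : ℕ} {l w : α}
    (hl : l ∈ turning f) (hw : w ∈ firstHit f j l) {m : ℕ} (hm : 0 < m) :
    slopeIter f (j + m) (w, -1) = slopeIter f m (l, -1) ∧
      (germMap f)^[j + m] (w, -1) = (germMap f)^[m] (l, -1) := by
  obtain ⟨h1, h2⟩ := firstHit_iterate hf hT hw (-1) m
  rw [h1, h2, germMap_iterate_turning hf hT hl _ hm, slopeIter_turning hf hT hl _ hm]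
  rcases Int.units_eq_one_or (slopeIter f j (w, 1)) with e | e <;> simp [e]

theorem firstHit_slopeIter_right (hf : Continuous f) (hT : (turning f).Finite) {j : ℕ} {l w : α}
    (hl : l ∈ turning f) (hw : w ∈ firstHit f j l) {m : ℕ} (hm : 0 < m) :
    slopeIter f (j + m) (w, 1) = - slopeIter f (j + m) (w, -1) := by
  rw [(firstHit_iterate_left hf hT hl hw hm).1, (firstHit_iterate hf hT hw 1 m).1,
    slopeIter_turning hf hT hl _ hm]
  rcases Int.units_eq_one_or (slopeIter f j (w, 1)) with e | e <;> simp [e]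

theorem slopeIter_right_of_mem_crit (hf : Continuous f) (hT : (turning f).Finite) {n : ℕ} {w : α}
    (hw : w ∈ crit f n) : slopeIter f n (w, 1) = - slopeIter f n (w, -1) := by
  obtain ⟨j, hj, l, hl, hw⟩ := mem_crit_iff.1 hw
  have := firstHit_slopeIter_right hf hT hl hw (m := n - j) (by omega)
  rwa [show j + (n - j) = n by omega] at this

end FirstHit

/-! ### Counting fixed points -/

section Count

variable {α : Type*} [ConditionallyCompleteLinearOrder α] [DenselyOrdered α] [TopologicalSpace α]
  [OrderTopology α] [BoundedOrder α] {f : α → α}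

/-- Since `w` is moved, both sides are displaced in the same direction, while the slope changes
sign. -/
theorem displacement_jump_of_mem_crit (hf : Continuous f) (hT : (turning f).Finite) {n : ℕ} {w : α}
    (hw : w ∈ crit f n) (hx : f^[n] w ≠ w) :
    displacement f n (w, 1) - displacement f n (w, -1) =
      -2 * (sgn (slopeIter f n (w, -1)) * position ((germMap f)^[n] (w, -1)) w) := by
  rw [displacement, displacement, slopeIter_right_of_mem_crit hf hT hw, germMap_iterate, sgn_neg]
  have hv : ∀ s : ℤˣ, GermValid (w, s) := fun s => germIn_of_mem_Ioo hw.2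
  rcases lt_or_gt_of_ne hx with h | h
  · rw [displacementSign_of_sideLT (hf.iterate n) (hv 1) (sideLT_neg_one.2 h),
      displacementSign_of_sideLT (hf.iterate n) (hv (-1)) (sideLT_neg_one.2 h),
      position_of_gt h]
    simp
    ring
  · rw [displacementSign_of_sideLT (hf.iterate n) (hv 1) (sideLT_one.2 h),
      displacementSign_of_sideLT (hf.iterate n) (hv (-1)) (sideLT_one.2 h),
      position_of_lt h]
    simp
    ring

theorem slope_mul_position_of_fixed {n : ℕ} {w : α} (hx : f^[n] w = w) :
    sgn (slopeIter f n (w, -1)) * position ((germMap f)^[n] (w, -1)) w = - 1 / 2 := by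
  rw [germMap_iterate, hx, position_self]
  rcases Int.units_eq_one_or (slopeIter f n (w, -1)) with e | e <;> rw [e] <;> norm_num

theorem slopeIter_bot (hf : Continuous f) (hT : (turning f).Finite) (hlt : (⊥ : α) < ⊤) {n : ℕ}
    (hx : f^[n] ⊥ = (⊥ : α)) : slopeIter f n (⊥, 1) = 1 := by
  have h := germValid_germMap_iterate hf hT (germValid_right hlt) n
  rw [germMap_iterate, hx, one_mul] at h
  refine (Int.units_eq_one_or _).resolve_right fun h' => ?_
  exact lt_irrefl _ (h.2.2.2 h')

theorem slopeIter_top (hf : Continuous f) (hT : (turning f).Finite) (hlt : (⊥ : α) < ⊤) {n : ℕ}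
    (hx : f^[n] ⊤ = (⊤ : α)) : slopeIter f n (⊤, -1) = 1 := by
  have h := germValid_germMap_iterate hf hT (germValid_left hlt) n
  rw [germMap_iterate, hx, neg_one_mul] at h
  refine (Int.units_eq_one_or _).resolve_right fun h' => ?_
  exact lt_irrefl _ (h.2.2.1 (by simp [h']))

open Classical in
theorem displacement_bot (hf : Continuous f) (hT : (turning f).Finite) (hlt : (⊥ : α) < ⊤) {n : ℕ}
    (hfix : (Function.fixedPoints f^[n]).Finite) :
    displacement f n (⊥, 1) =
      sgn (slopeIter f n (⊥, 1)) / 2 - if IsAttracting f n (⊥, 1) then 1 else 0 := by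
  by_cases hx : f^[n] ⊥ = (⊥ : α)
  · rw [displacement_of_fixed hf hT hfix (germValid_right hlt) hx, slopeIter_bot hf hT hlt hx]
    simp
  · rw [if_neg fun h => hx h.2.1, displacement,
      displacementSign_of_sideLT (hf.iterate n) (germValid_right hlt)
        (sideLT_one.2 (bot_lt_iff_ne_bot.2 hx))]
    simp

open Classical in
theorem displacement_top (hf : Continuous f) (hT : (turning f).Finite) (hlt : (⊥ : α) < ⊤) {n : ℕ}
    (hfix : (Function.fixedPoints f^[n]).Finite) :
    displacement f n (⊤, -1) =
      - sgn (slopeIter f n (⊤, -1)) / 2 + if IsAttracting f n (⊤, -1) then 1 else 0 := by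
  by_cases hx : f^[n] ⊤ = (⊤ : α)
  · rw [displacement_of_fixed hf hT hfix (germValid_left hlt) hx, slopeIter_top hf hT hlt hx]
    simp
    ring
  · rw [if_neg fun h => hx h.2.1, displacement,
      displacementSign_of_sideLT (hf.iterate n) (germValid_left hlt)
        (sideLT_neg_one.2 (lt_top_iff_ne_top.2 hx))]
    simp

/-- The fixed points of `f^n` at the ends of the laps of `f^n`. -/
def lapEndFixedPts (f : α → α) (n : ℕ) : Set α :=
  {x ∈ Function.fixedPoints f^[n] | x ∈ crit f n ∨ x = ⊥ ∨ x = ⊤}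

/-- This is the telescoping of `displacement f n` from the left end to the right end. Fixed points
that are also critical enter the sum over all of `crit f n` with a spurious term; this is absorbed,
together with fixed end points, by the count of `lapEndFixedPts f n`. -/
theorem ncard_fixedPoints (hf : Continuous f) (hT : (turning f).Finite) (hlt : (⊥ : α) < ⊤)
    (n : ℕ) (hfix : (Function.fixedPoints f^[n]).Finite) :
    ((Function.fixedPoints f^[n]).ncard : ℚ) = (lapEndFixedPts f n).ncard +
      {γ | IsAttracting f n γ}.ncard +
      2 * ∑ w ∈ (finite_crit hf hT n).toFinset,
        sgn (slopeIter f n (w, -1)) * position ((germMap f)^[n] (w, -1)) w -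
      (sgn (slopeIter f n (⊤, -1)) + sgn (slopeIter f n (⊥, 1))) / 2 := by
  classical
  set F := hfix.toFinset with hF
  set W := (finite_crit hf hT n).toFinset with hW
  set F₀ := F.filter fun x => ⊥ < x ∧ x < ⊤ with hF₀
  have memF : ∀ x, x ∈ F ↔ f^[n] x = x := fun x => by simp [hF, Function.IsFixedPt]
  have memW : ∀ x, x ∈ W ↔ x ∈ crit f n := fun x => by simp [hW]
  have memF₀ : ∀ x, x ∈ F₀ ↔ f^[n] x = x ∧ ⊥ < x ∧ x < ⊤ := fun x => by simp [hF₀, memF]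
  set q : α → ℚ := fun w => sgn (slopeIter f n (w, -1)) * position ((germMap f)^[n] (w, -1)) w
    with hq
  set a : Germ α → ℚ := fun γ => if IsAttracting f n γ then 1 else 0 with ha
  have hgap : GapConst (displacement f n) (F₀ ∪ (W \ F₀) : Finset α) := by
    intro x y hxy h
    refine gapConst_displacement hf n x y hxy fun w hw hw' => h w hw ?_
    have hwi : ⊥ < w ∧ w < ⊤ := ⟨bot_le.trans_lt hw.1, hw.2.trans_le le_top⟩
    rw [Finset.mem_coe, Finset.union_sdiff_self_eq_union, Finset.mem_union, memF₀, memW]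
    rcases hw' with hw' | hw'
    · exact Or.inr ⟨hw', hwi⟩
    · exact Or.inl ⟨hw', hwi⟩
  have htel := hgap.sub_eq_sum hlt
  rw [Finset.filter_true_of_mem, Finset.sum_union Finset.disjoint_sdiff,
    displacement_bot hf hT hlt hfix, displacement_top hf hT hlt hfix] at htel
  swap
  · intro w hw
    rw [Finset.union_sdiff_self_eq_union, Finset.mem_union, memF₀, memW] at hw
    exact hw.elim (fun h => h.2) fun h => h.2
  have h1 : ∑ x ∈ F₀, (displacement f n (x, 1) - displacement f n (x, -1)) =
      (F₀.card : ℚ) - ∑ x ∈ F₀, (a (x, 1) + a (x, -1)) := by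
    rw [Finset.card_eq_sum_ones, Nat.cast_sum, ← Finset.sum_sub_distrib]
    refine Finset.sum_congr rfl fun x hx => ?_
    obtain ⟨hx1, hx2⟩ := (memF₀ x).1 hx
    rw [displacement_of_fixed hf hT hfix (γ := (x, 1)) (germIn_of_mem_Ioo hx2) hx1,
      displacement_of_fixed hf hT hfix (γ := (x, -1)) (germIn_of_mem_Ioo hx2) hx1]
    simp only [ha, sgn_one, sgn_neg, Nat.cast_one]
    ring
  have h2 : ∑ w ∈ W \ F₀, (displacement f n (w, 1) - displacement f n (w, -1)) =
      -2 * ∑ w ∈ W \ F₀, q w := by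
    rw [Finset.mul_sum]
    refine Finset.sum_congr rfl fun w hw => ?_
    rw [Finset.mem_sdiff, memW, memF₀] at hw
    exact displacement_jump_of_mem_crit hf hT hw.1 fun h => hw.2 ⟨h, hw.1.2⟩
  -- Each critical fixed point adds `-1 / 2` to the full sum, whatever its slope.
  have h3 : ∑ w ∈ W \ F₀, q w = ∑ w ∈ W, q w + ((W ∩ F₀).card : ℚ) / 2 := by
    rw [← Finset.sum_inter_add_sum_sdiff W F₀]
    have : ∑ w ∈ W ∩ F₀, q w = - ((W ∩ F₀).card : ℚ) / 2 := by
      rw [Finset.sum_congr rfl (g := fun _ => (-1 / 2 : ℚ))]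
      · rw [Finset.sum_const, nsmul_eq_mul]; ring
      · intro w hw
        rw [Finset.mem_inter, memF₀] at hw
        exact slope_mul_position_of_fixed hw.2.1
    rw [this]; ring
  have h4 : ((Function.fixedPoints f^[n]).ncard : ℚ) =
      (lapEndFixedPts f n).ncard + F₀.card - (W ∩ F₀).card := by
    have e1 : (Function.fixedPoints f^[n]).ncard = F.card := Set.ncard_eq_toFinset_card _ hfix
    have e2 : (lapEndFixedPts f n).ncard = (F.filter fun x => x ∈ W ∨ x = ⊥ ∨ x = ⊤).card := by
      rw [← Set.ncard_coe_finset]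
      congr 1
      ext x
      simp [lapEndFixedPts, memF, memW, Function.IsFixedPt]
    have e3 := Finset.card_filter_add_card_filter_not (s := F) (fun x => x ∈ W ∨ x = ⊥ ∨ x = ⊤)
    have e4 : (F.filter fun x => ¬ (x ∈ W ∨ x = ⊥ ∨ x = ⊤)) = F₀ \ W := by
      ext x
      simp only [Finset.mem_filter, Finset.mem_sdiff, memF, memF₀, bot_lt_iff_ne_bot,
        lt_top_iff_ne_top]
      tauto
    have e5 := Finset.card_sdiff_add_card_inter F₀ W
    rw [Finset.inter_comm] at e5
    rw [e1, e2, ← e3, e4, ← e5]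
    push_cast
    ring
  have h5 : ({γ | IsAttracting f n γ}.ncard : ℚ) =
      a (⊥, 1) + a (⊤, -1) + ∑ x ∈ F₀, (a (x, 1) + a (x, -1)) := by
    have e1 : {γ | IsAttracting f n γ} =
        ((F ×ˢ (Finset.univ : Finset ℤˣ)).filter fun γ => IsAttracting f n γ : Finset (Germ α)) := by
      ext γ
      simp only [Set.mem_ofPred_eq, Finset.coe_filter, Finset.mem_product, Finset.mem_univ,
        and_true, memF]
      exact ⟨fun h => ⟨h.2.1, h⟩, fun h => h.2⟩
    rw [e1, Set.ncard_coe_finset, ← Finset.sum_boole, Finset.sum_product]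
    have e2 : ∀ x, ∑ s : ℤˣ, (if IsAttracting f n (x, s) then (1 : ℚ) else 0) =
        a (x, 1) + a (x, -1) := by
      intro x
      rw [show (Finset.univ : Finset ℤˣ) = {1, -1} from rfl, Finset.sum_pair (by decide)]
    rw [Finset.sum_congr rfl fun x _ => e2 x]
    have e3 : ∀ x, f^[n] x ≠ x → a (x, 1) + a (x, -1) = 0 := by
      intro x hx
      simp only [ha]
      rw [if_neg fun h => hx h.2.1, if_neg fun h => hx h.2.1, add_zero]
    have e4 : ∑ x ∈ F, (a (x, 1) + a (x, -1)) =
        ∑ x ∈ insert ⊥ (insert ⊤ F₀), (a (x, 1) + a (x, -1)) := by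
      refine Finset.sum_subset (fun x hx => ?_) fun x _ hx => e3 x fun h => hx ((memF x).2 h)
      rw [Finset.mem_insert, Finset.mem_insert, memF₀, bot_lt_iff_ne_bot, lt_top_iff_ne_top]
      have := (memF x).1 hx
      tauto
    rw [e4, Finset.sum_insert, Finset.sum_insert]
    · have b1 : a (⊥, -1) = 0 := if_neg fun h => lt_irrefl _ (h.1.2.2.2 rfl)
      have b2 : a (⊤, 1) = 0 := if_neg fun h => lt_irrefl _ (h.1.2.2.1 rfl)
      rw [b1, b2]; ring
    · simp [memF₀]
    · simp [memF₀, hlt.ne]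
  rw [h1, h2, h3] at htel
  rw [h4, h5]
  simp only [ha]
  simp only [ha] at htel
  linarith

end Count

/-! ### Periodic points -/

section Periodic

variable {α : Type*} [ConditionallyCompleteLinearOrder α] [DenselyOrdered α] [TopologicalSpace α]
  [OrderTopology α] [BoundedOrder α] {f : α → α}

/-- A periodic point towards which one side does not move away is not repelling. -/
theorem not_isRepellingPeriodicPt (hf : Continuous f) {n : ℕ} (hn : 0 < n) {γ : Germ α}
    (hγ : GermValid γ) (hx : f^[n] γ.1 = γ.1)
    (h : ∀ᶠ z in sideNhds γ, SideLT γ.2 γ.1 (f^[n] z) ∧ ¬ SideLT γ.2 z (f^[n] z)) :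
    ¬ IsRepellingPeriodicPt f γ.1 := by
  rintro ⟨-, U, hU, hxU, hrep⟩
  have hper : IsPeriodicPt f n γ.1 := hx
  obtain ⟨r, hr⟩ := hper.minimalPeriod_dvd
  set p := minimalPeriod f γ.1 with hp
  have hr0 : 0 < r := Nat.pos_of_ne_zero (by rintro rfl; omega)
  have hpi : ∀ i, f^[p * i] γ.1 = γ.1 := fun i =>
    ((isPeriodicPt_minimalPeriod f γ.1).mul_const i)
  have hnear : ∀ᶠ z in 𝓝 γ.1, ∀ i < r, f^[p * i] z ∈ U := by
    have : ∀ᶠ z in 𝓝 γ.1, ∀ i ∈ Set.Iio r, f^[p * i] z ∈ U := by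
      rw [eventually_all_finite (Set.finite_Iio r)]
      intro i _
      refine (hf.iterate (p * i)).continuousAt (hU.mem_nhds ?_)
      rwa [hpi]
    exact this
  obtain ⟨y, hy, hP⟩ := exists_of_eventually_sideNhds hγ (h.and (sideNhds_le_nhds γ hnear))
  have := sideNhds_neBot hγ
  obtain ⟨u, hu1, hu2⟩ := ((eventually_sideLT γ).and (eventually_sideLT_of_sideLT hy)).exists
  have hstay : ∀ q, SideLT γ.2 γ.1 (f^[n * q] u) ∧ SideLT γ.2 (f^[n * q] u) y := by
    intro q
    induction q with
    | zero => exact ⟨hu1, hu2⟩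
    | succ q ih =>
      obtain ⟨h1, -⟩ := hP _ ih.1 ih.2
      rw [show n * (q + 1) = n + n * q by ring, iterate_add_apply]
      refine ⟨h1.1, ?_⟩
      by_cases he : f^[n * q] u = f^[n] (f^[n * q] u)
      · rw [← he]; exact ih.2
      · exact ((sideLT_or_sideLT γ.2 he).resolve_left h1.2).trans ih.2
  obtain ⟨k, hk⟩ := hrep u ((hP u hu1 hu2).2 0 hr0) hu1.ne.symm
  refine hk ?_
  have hkk : p * k = p * (k % r) + n * (k / r) := by
    rw [hr, mul_assoc, ← mul_add, Nat.mod_add_div]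
  rw [hkk, iterate_add_apply]
  exact (hP _ (hstay _).1 (hstay _).2).2 _ (Nat.mod_lt _ hr0)

/-- The periodic points that are not repelling. -/
def nonRepelling (f : α → α) : Set α := {x | x ∈ periodicPts f ∧ ¬ IsRepellingPeriodicPt f x}

theorem mem_nonRepelling (hf : Continuous f) {n : ℕ} (hn : 0 < n) {γ : Germ α}
    (hγ : GermValid γ) (hx : f^[n] γ.1 = γ.1)
    (h : ∀ᶠ z in sideNhds γ, SideLT γ.2 γ.1 (f^[n] z) ∧ ¬ SideLT γ.2 z (f^[n] z)) :
    γ.1 ∈ nonRepelling f :=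
  ⟨⟨n, hn, hx⟩, not_isRepellingPeriodicPt hf hn hγ hx h⟩

/-- If the fixed set were infinite, some interval `[x, y]` between two fixed points would contain
neither critical nor non-repelling points. There f^n increases and `x` repels, so some point moves
up; the first later point that does not move up is fixed and attracts from the left, a
contradiction. -/
theorem finite_fixedPoints (hf : Continuous f) (hT : (turning f).Finite)
    (hR : (nonRepelling f).Finite) {n : ℕ} (hn : 0 < n) :
    (Function.fixedPoints f^[n]).Finite := by
  refine finite_of_gap ((finite_turningIter hf hT n).union hR) fun x hx y hy hxy h => ?_
  have hx' : f^[n] x = x := hx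
  have hy' : f^[n] y = y := hy
  obtain ⟨h1, -⟩ := strictSlopeOn_iterate_of_gap hf n hxy
    fun w hw hw' => h w (Set.Ioo_subset_Icc_self hw) (Or.inl hw')
  have hη := h1 x ⟨le_rfl, hxy.le⟩ y ⟨hxy.le, le_rfl⟩ hxy
  rw [hx', hy'] at hη
  rw [hη.eq (sideLT_one.2 hxy)] at h1
  have hmono : ∀ u ∈ Set.Icc x y, ∀ v ∈ Set.Icc x y, u < v → f^[n] u < f^[n] v :=
    fun u hu v hv huv => sideLT_one.1 (h1 u hu v hv huv)
  -- Otherwise no point of the interval moves away from `x`, and `x` is not repelling.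
  obtain ⟨z₁, hz₁, hz₁'⟩ : ∃ z₁ ∈ Set.Ioo x y, z₁ < f^[n] z₁ := by
    by_contra hcon
    push Not at hcon
    refine h x ⟨le_rfl, hxy.le⟩ (Or.inr (mem_nonRepelling hf hn (γ := (x, 1))
      (germValid_right hxy) hx' ?_))
    filter_upwards [eventually_mem_Ioo_right hxy] with z hz
    rw [sideLT_one, sideLT_one]
    refine ⟨?_, (hcon z hz).not_gt⟩
    have := hmono x ⟨le_rfl, hxy.le⟩ z (Set.Ioo_subset_Icc_self hz) hz.1
    rwa [hx'] at this
  have hcomp : IsCompact (Set.Icc z₁ y ∩ {z | f^[n] z ≤ z}) :=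
    isCompact_Icc.inter_right (isClosed_le (hf.iterate n) continuous_id)
  obtain ⟨z, ⟨hz1, hz2⟩, hzmin⟩ := hcomp.exists_isLeast ⟨y, ⟨hz₁.2.le, le_rfl⟩, hy'.le⟩
  have hz2' : f^[n] z ≤ z := hz2
  have hlt : z₁ < z := lt_of_le_of_ne hz1.1 (by rintro rfl; exact hz₁'.not_ge hz2')
  have hbelow : ∀ u, z₁ ≤ u → u < z → u < f^[n] u := by
    intro u hu1 hu2
    by_contra hcon
    exact hu2.not_ge (hzmin ⟨⟨hu1, hu2.le.trans hz1.2⟩, not_lt.1 hcon⟩)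
  have hzI : z ∈ Set.Icc x y := ⟨hz₁.1.le.trans hz1.1, hz1.2⟩
  have hzfix : f^[n] z = z := by
    refine le_antisymm hz2' (not_lt.1 fun hcon => ?_)
    obtain ⟨u, hu1, hu2⟩ := exists_between (max_lt hcon hlt)
    rw [max_lt_iff] at hu1
    have a1 := hbelow u hu1.2.le hu2
    have a2 := hmono u ⟨hz₁.1.le.trans hu1.2.le, hu2.le.trans hz1.2⟩ z hzI hu2
    exact (a1.trans a2).not_gt hu1.1
  refine h z hzI (Or.inr (mem_nonRepelling hf hn (γ := (z, -1)) (germValid_left hlt) hzfix ?_))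
  filter_upwards [eventually_mem_Ioo_left hlt] with u hu
  rw [sideLT_neg_one, sideLT_neg_one]
  refine ⟨?_, (hbelow u hu.1.le hu.2).not_gt⟩
  have := hmono u ⟨hz₁.1.le.trans hu.1.le, hu.2.le.trans hz1.2⟩ z hzI hu.2
  rwa [hzfix] at this

/-! ### Periodic orbits through turning points or end points -/

/-- The periodic points whose orbit passes through a turning point or an end point. -/
def lapEndPeriodicPts (f : α → α) : Set α :=
  {x ∈ periodicPts f | ∃ j, f^[j] x ∈ turning f ∪ {⊥, ⊤}}

theorem finite_lapEndPeriodicPts (hT : (turning f).Finite) : (lapEndPeriodicPts f).Finite := by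
  have hfin : (turning f ∪ {⊥, ⊤}).Finite := hT.union (by simp)
  refine (hfin.biUnion (t := fun v => (fun i => f^[i] v) '' Set.Iio (minimalPeriod f v))
    fun v _ => (Set.finite_Iio _).image _).subset ?_
  rintro x ⟨⟨n, hn, hx⟩, j, hj⟩
  simp only [Set.mem_iUnion]
  refine ⟨_, hj, ?_⟩
  have hv : IsPeriodicPt f n (f^[j] x) := hx.apply_iterate j
  refine ⟨(n * j - j) % minimalPeriod f (f^[j] x),
    Nat.mod_lt _ (hv.minimalPeriod_pos hn), ?_⟩
  dsimp only
  rw [iterate_mod_minimalPeriod_eq, ← iterate_add_apply,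
    Nat.sub_add_cancel (Nat.le_mul_of_pos_left j hn)]
  exact hx.mul_const j

theorem mapsTo_lapEndPeriodicPts : Set.MapsTo f (lapEndPeriodicPts f) (lapEndPeriodicPts f) := by
  rintro x ⟨⟨n, hn, hx⟩, j, hj⟩
  refine ⟨⟨n, hn, hx.apply_iterate 1⟩, j + n - 1, ?_⟩
  rw [← iterate_succ_apply, show (j + n - 1).succ = j + n by omega, iterate_add_apply, hx.eq]
  exact hj

/-- An interior periodic orbit that avoids the turning points never reaches an end point, and any
hit can be moved to a time below `n`. The count thus concerns one finite invariant set that does not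
depend on `n`. -/
theorem lapEndFixedPts_eq (hf : Continuous f) (hT : (turning f).Finite) {n : ℕ} (hn : 0 < n) :
    lapEndFixedPts f n = {x ∈ lapEndPeriodicPts f | f^[n] x = x} := by
  ext x
  constructor
  · rintro ⟨hx, h⟩
    refine ⟨⟨⟨n, hn, hx⟩, ?_⟩, hx⟩
    rcases h with h | h | h
    · obtain ⟨⟨j, -, hj⟩, -⟩ := h
      exact ⟨j, Or.inl hj⟩
    · exact ⟨0, Or.inr (Or.inl h)⟩
    · exact ⟨0, Or.inr (Or.inr h)⟩
  · rintro ⟨⟨-, j, hj⟩, hx⟩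
    refine ⟨hx, ?_⟩
    by_contra hcon
    push Not at hcon
    obtain ⟨h1, h2, h3⟩ := hcon
    have hxi : x ∈ Set.Ioo ⊥ ⊤ := ⟨bot_lt_iff_ne_bot.2 h2, lt_top_iff_ne_top.2 h3⟩
    have hnt : ∀ i, f^[i] x ∉ turning f := by
      intro i hi
      have hper : IsPeriodicPt f n x := hx
      rw [← hper.iterate_mod_apply i] at hi
      exact h1 ⟨⟨i % n, Nat.mod_lt _ hn, hi⟩, hxi⟩
    have hmem := (iterate_mem_Ioo_and_slopeIter_eq hf hT hxi (j := j) fun i _ => hnt i).1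
    rcases hj with hj | hj | hj
    · exact hnt j hj
    · exact hmem.1.ne' hj
    · exact hmem.2.ne hj

/-! ### The set of attracting germs -/

/-- The germs attracting under some iterate. -/
def attractingGerms (f : α → α) : Set (Germ α) := {γ | ∃ n, 0 < n ∧ IsAttracting f n γ}

theorem finite_attractingGerms (hf : Continuous f) (hR : (nonRepelling f).Finite) :
    (attractingGerms f).Finite := by
  refine (hR.prod (Set.finite_univ (α := ℤˣ))).subset ?_
  rintro γ ⟨n, hn, hγ, hx, h⟩
  refine ⟨mem_nonRepelling hf hn hγ hx ?_, Set.mem_univ _⟩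
  filter_upwards [h] with z hz
  exact ⟨hz.1, hz.2.not_symm⟩

theorem mapsTo_attractingGerms (hf : Continuous f) (hT : (turning f).Finite) :
    Set.MapsTo (germMap f) (attractingGerms f) (attractingGerms f) := by
  rintro γ ⟨n, hn, hγ, hx, h⟩
  have hcomm : ∀ z, f^[n] (f z) = f (f^[n] z) := fun z => by
    rw [← iterate_succ_apply, iterate_succ_apply']
  refine ⟨n, hn, germValid_germMap_iterate hf hT hγ 1, ?_, ?_⟩
  · show f^[n] (f γ.1) = f γ.1
    rw [hcomm, hx]
  · refine sideNhds_germMap_le hf hT hγ ?_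
    rw [mem_map]
    obtain ⟨y, hy, hs⟩ := exists_strictSlopeOn hf hT hγ 1
    rw [slopeIter_one, iterate_one] at hs
    filter_upwards [h, eventually_sideLT γ, eventually_sideLT_of_sideLT hy] with z hz h1 h2
    have m1 := mem_uIcc_of_sideLT h1 h2
    have m2 := mem_uIcc_of_sideLT hz.1 (hz.2.trans h2)
    show SideLT (γ.2 * slope f γ) (f γ.1) (f^[n] (f z)) ∧
      SideLT (γ.2 * slope f γ) (f^[n] (f z)) (f z)
    rw [hcomm]
    exact ⟨hs.sideLT Set.left_mem_uIcc m2 hz.1, hs.sideLT m2 m1 hz.2⟩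

theorem isAttracting_germMap_iterate (hf : Continuous f) (hT : (turning f).Finite) {n : ℕ}
    {γ : Germ α} (h : IsAttracting f n γ) : (germMap f)^[n] γ = γ := by
  have h1 := eventually_sideLT_iterate hf hT h.1 n
  have := sideNhds_neBot h.1
  rw [h.2.1] at h1
  obtain ⟨z, a1, a2⟩ := (h1.and h.2.2).exists
  rw [germMap_iterate, h.2.1, a1.eq a2.1]

/-- Attraction does not depend on the exponent: if f^n pushed the germ outwards while f^m pulls it
inwards, f^(nm) would do both. Hence these germs are counted by the iterates of `germMap f` on one
finite set. -/
theorem isAttracting_eq (hf : Continuous f) (hT : (turning f).Finite)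
    (hR : (nonRepelling f).Finite) {n : ℕ} (hn : 0 < n) :
    {γ | IsAttracting f n γ} = {γ ∈ attractingGerms f | (germMap f)^[n] γ = γ} := by
  ext γ
  constructor
  · intro h
    exact ⟨⟨n, hn, h⟩, isAttracting_germMap_iterate hf hT h⟩
  · rintro ⟨⟨m, hm, h⟩, hγn⟩
    have hγm := isAttracting_germMap_iterate hf hT h
    have hγ := h.1
    have hfix := finite_fixedPoints hf hT hR hn
    have htn := tendsto_sideNhds hf hT hγ n
    have htm := tendsto_sideNhds hf hT hγ m
    rw [hγn] at htn
    rw [hγm] at htm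
    rw [germMap_iterate] at hγn
    have hx : f^[n] γ.1 = γ.1 := congrArg Prod.fst hγn
    have hs : γ.2 * slopeIter f n γ = γ.2 := congrArg Prod.snd hγn
    refine (isAttracting_iff hf hT hfix hγ hx).2 ⟨by simpa using hs, ?_⟩
    by_contra hne
    have he : displacementSign f^[n] γ = γ.2 := by
      rcases Int.units_eq_one_or (displacementSign f^[n] γ) with e1 | e1 <;>
      rcases Int.units_eq_one_or γ.2 with e2 | e2 <;> simp_all
    have hd := eventually_displacementSign (hf.iterate n) hfix hγ
    rw [he] at hd
    have up : ∀ k, ∀ᶠ z in sideNhds γ, SideLT γ.2 z (f^[n * (k + 1)] z) := by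
      intro k
      induction k with
      | zero => simpa using hd
      | succ k ih =>
        filter_upwards [hd, htn.eventually ih] with z h1 h2
        rw [show n * (k + 1 + 1) = n * (k + 1) + n by ring, iterate_add_apply]
        exact h1.trans h2
    have down : ∀ k, ∀ᶠ z in sideNhds γ, SideLT γ.2 (f^[m * (k + 1)] z) z := by
      intro k
      induction k with
      | zero => simpa using h.2.2.mono fun z hz => hz.2
      | succ k ih =>
        filter_upwards [h.2.2, htm.eventually ih] with z h1 h2
        rw [show m * (k + 1 + 1) = m * (k + 1) + m by ring, iterate_add_apply]
        exact h2.trans h1.2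
    have := sideNhds_neBot hγ
    obtain ⟨z, a1, a2⟩ := ((up (m - 1)).and (down (n - 1))).exists
    rw [Nat.sub_add_cancel hm] at a1
    rw [Nat.sub_add_cancel hn, mul_comm] at a2
    exact a1.not_symm a2

end Periodic

/-! ### The kneading matrix -/

section Kneading

open PowerSeries

/-- The sum of the series `e m * X ^ m * G m`, for `m ≥ 1`. -/
noncomputable def shiftSum (e : ℕ → ℚ) (G : ℕ → ℚ⟦X⟧) : ℚ⟦X⟧ :=
  mk fun n => ∑ m ∈ Finset.Icc 1 n, e m * coeff (n - m) (G m)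

theorem coeff_shiftSum (e : ℕ → ℚ) (G : ℕ → ℚ⟦X⟧) {n N : ℕ} (h : n ≤ N) :
    coeff n (shiftSum e G) = coeff n (∑ m ∈ Finset.Icc 1 N, C (e m) * (X ^ m * G m)) := by
  rw [shiftSum, coeff_mk, map_sum]
  refine Finset.sum_subset_zero_on_sdiff (Finset.Icc_subset_Icc_right h) (fun m hm => ?_)
    fun m hm => ?_
  · rw [Finset.mem_sdiff, Finset.mem_Icc, Finset.mem_Icc] at hm
    rw [coeff_C_mul, coeff_X_pow_mul', if_neg (by omega), mul_zero]
  · rw [Finset.mem_Icc] at hm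
    rw [coeff_C_mul, coeff_X_pow_mul', if_pos hm.2]

theorem shiftSum_mul (e : ℕ → ℚ) (G : ℕ → ℚ⟦X⟧) (Q : ℚ⟦X⟧) :
    shiftSum e (fun m => G m * Q) = shiftSum e G * Q := by
  ext n
  rw [coeff_shiftSum _ _ le_rfl]
  have : coeff n (shiftSum e G * Q) =
      coeff n ((∑ m ∈ Finset.Icc 1 n, C (e m) * (X ^ m * G m)) * Q) := by
    rw [coeff_mul, coeff_mul]
    refine Finset.sum_congr rfl fun ab hab => ?_
    rw [coeff_shiftSum (N := n) _ _ (by rw [Finset.HasAntidiagonal.mem_antidiagonal] at hab; omega)]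
  rw [this, Finset.sum_mul]
  congr 1
  refine Finset.sum_congr rfl fun m _ => ?_
  ring

theorem shiftSum_sum {ι : Type*} (s : Finset ι) (e : ℕ → ℚ) (G : ι → ℕ → ℚ⟦X⟧) :
    shiftSum e (fun m => ∑ i ∈ s, G i m) = ∑ i ∈ s, shiftSum e (G i) := by
  ext n
  rw [map_sum]
  simp only [shiftSum, coeff_mk, map_sum, Finset.mul_sum]
  exact Finset.sum_comm

theorem shiftSum_sub (e : ℕ → ℚ) (G H : ℕ → ℚ⟦X⟧) :
    shiftSum e (fun m => G m - H m) = shiftSum e G - shiftSum e H := by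
  ext n
  simp [shiftSum, mul_sub, Finset.sum_sub_distrib]

theorem shiftSum_const (e : ℕ → ℚ) (G : ℚ⟦X⟧) :
    shiftSum e (fun _ => G) = (mk fun m => if m = 0 then 0 else e m) * G := by
  have h1 := shiftSum_mul e (fun _ => 1) G
  simp only [one_mul] at h1
  rw [h1]
  congr 1
  ext n
  rw [shiftSum, coeff_mk, coeff_mk]
  rcases Nat.eq_zero_or_pos n with rfl | hn
  · simp
  · rw [if_neg hn.ne', Finset.sum_eq_single n]
    · simp
    · intro m hm hne
      rw [Finset.mem_Icc] at hm
      rw [PowerSeries.coeff_one, if_neg (by omega), mul_zero]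
    · intro h
      exact absurd (Finset.mem_Icc.2 ⟨hn, le_rfl⟩) h

variable {α : Type*} [ConditionallyCompleteLinearOrder α] [DenselyOrdered α] [TopologicalSpace α]
  [OrderTopology α] [BoundedOrder α] {f : α → α}

/-- The signed itinerary of a germ with respect to the point `i`. -/
noncomputable def theta (f : α → α) (i : α) (n : ℕ) (γ : Germ α) : ℚ :=
  sgn (slopeIter f n γ) * position ((germMap f)^[n] γ) i

/-- The generating function of the signed itinerary. -/
noncomputable def thetaSeries (f : α → α) (i : α) (γ : Germ α) : ℚ⟦X⟧ := mk fun n => theta f i n γ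

/-- The generating function of the slopes. -/
noncomputable def slopeSeries (f : α → α) (γ : Germ α) : ℚ⟦X⟧ :=
  mk fun n => sgn (slopeIter f n γ)

/-- The sum of the positions with respect to the points of `firstHit f j l`. -/
noncomputable def hitSum (f : α → α) (l : α) (j : ℕ) (γ : Germ α) : ℚ :=
  ∑ᶠ w ∈ firstHit f j l, position γ w

/-- The kneading matrix: the jumps of the itineraries at the turning points. -/
noncomputable def kneading (f : α → α) : Matrix (turning f) (turning f) ℚ⟦X⟧ :=
  Matrix.of fun l i => thetaSeries f i (l, 1) - thetaSeries f i (l, -1)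

/-- The generating function of the slopes of the iterates of `f` to the left of `l`. -/
noncomputable def critSeries (f : α → α) (l : α) : ℚ⟦X⟧ :=
  mk fun m => if m = 0 then 0 else sgn (slopeIter f m (l, -1))

/-! ### Itineraries: constancy between critical points, jumps, and the counting identity. -/

theorem position_eq_of_not_between {η : ℤˣ} {u v i : α} (h : SideLT η u v)
    (h1 : ¬ (SideLT η u i ∧ SideLT η i v)) : position (u, η) i = position (v, -η) i := by
  rcases Int.units_eq_one_or η with rfl | rfl
  · rw [sideLT_one] at h
    simp only [sideLT_one, not_and, not_lt] at h1
    rcases lt_trichotomy i u with h2 | rfl | h2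
    · rw [position_of_lt h2, position_of_lt (h2.trans h)]
    · rw [position_self, position_of_lt h]; simp
    · rcases (h1 h2).eq_or_lt with rfl | h3
      · rw [position_self, position_of_gt h2]; simp
      · rw [position_of_gt h2, position_of_gt h3]
  · rw [sideLT_neg_one] at h
    simp only [sideLT_neg_one, not_and, not_lt] at h1
    rcases lt_trichotomy i u with h2 | rfl | h2
    · rcases (h1 h2).eq_or_lt with rfl | h3
      · rw [position_self, position_of_lt h2]; simp
      · rw [position_of_lt h2, position_of_lt h3]
    · rw [position_self, position_of_gt h]; simp
    · rw [position_of_gt h2, position_of_gt (h.trans h2)]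

/-- On a gap f^n is strictly monotone, and it could cross `i` only at a point of `turningIter f (n +
1)`. -/
theorem gapConst_theta (hf : Continuous f) {i : α} (hi : i ∈ turning f) (n : ℕ) :
    GapConst (theta f i n) (turningIter f (n + 1)) := by
  intro x y hxy h
  obtain ⟨h1, h2⟩ := strictSlopeOn_iterate_of_gap hf n hxy fun w hw ⟨j, hj, hw'⟩ =>
    h w hw ⟨j, by omega, hw'⟩
  rw [theta, theta, h2, germMap_iterate, germMap_iterate, h2]
  congr 1
  simp only [one_mul, neg_one_mul]
  refine position_eq_of_not_between (h1 x ⟨le_rfl, hxy.le⟩ y ⟨hxy.le, le_rfl⟩ hxy) ?_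
  rintro ⟨h3, h4⟩
  have h5 := intermediate_value_uIcc (hf.iterate n).continuousOn (mem_uIcc_of_sideLT h3 h4)
  rw [Set.uIcc_of_le hxy.le] at h5
  obtain ⟨w, hw, rfl⟩ := h5
  refine h w ⟨lt_of_le_of_ne hw.1 ?_, lt_of_le_of_ne hw.2 ?_⟩ ⟨n, by omega, hi⟩
  · rintro rfl; exact h3.ne rfl
  · rintro rfl; exact h4.ne rfl

/-- From time `j` on, the two sides of `w` follow the two sides of `l`, possibly exchanged with
reversed slope; the two sign changes cancel in the difference. -/
theorem theta_jump (hf : Continuous f) (hT : (turning f).Finite) {j : ℕ} {l w : α}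
    (hw : w ∈ firstHit f j l) (i : α) (m : ℕ) :
    theta f i (j + m) (w, 1) - theta f i (j + m) (w, -1) =
      theta f i m (l, 1) - theta f i m (l, -1) := by
  unfold theta
  rw [(firstHit_iterate hf hT hw 1 m).1, (firstHit_iterate hf hT hw 1 m).2,
    (firstHit_iterate hf hT hw (-1) m).1, (firstHit_iterate hf hT hw (-1) m).2]
  rcases Int.units_eq_one_or (slopeIter f j (w, 1)) with e | e <;> rw [e] <;> simp
  ring

theorem theta_turning (hf : Continuous f) (hT : (turning f).Finite) {l : α} (hl : l ∈ turning f)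
    (i : α) {m : ℕ} (hm : 0 < m) : theta f i m (l, 1) = - theta f i m (l, -1) := by
  unfold theta
  rw [germMap_iterate_turning hf hT hl 1 hm, slopeIter_turning hf hT hl 1 hm]
  simp

theorem hitSum_eq (hf : Continuous f) (hT : (turning f).Finite) (l : α) (j : ℕ) (γ : Germ α) :
    hitSum f l j γ = ∑ w ∈ (finite_firstHit hf hT j l).toFinset, position γ w :=
  finsum_mem_eq_finite_toFinset_sum _ _

theorem crit_interior {n : ℕ} {w : α} (h : w ∈ crit f n) : ⊥ < w ∧ w < ⊤ := h.2

variable [Fintype (turning f)]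

/-- The telescoping expansion over `crit f (n + 1)` is grouped by first hits. The jump at a point of
`firstHit f j l` is the jump at `l` at time `n - j`, so the result is a convolution and becomes a
matrix product of power series. -/
theorem theta_eq (hf : Continuous f) (hlt : (⊥ : α) < ⊤) {i : α} (hi : i ∈ turning f) (n : ℕ)
    {γ : Germ α} (hγ : GermValid γ) :
    theta f i n γ = (theta f i n (⊥, 1) + theta f i n (⊤, -1)) / 2 +
      ∑ j ∈ Finset.range (n + 1), ∑ l : turning f,
        hitSum f l j γ * (theta f i (n - j) (l, 1) - theta f i (n - j) (l, -1)) := by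
  have hT := Set.toFinite (turning f)
  have hgap : GapConst (theta f i n) (finite_crit hf hT (n + 1)).toFinset := by
    intro x y hxy h
    refine gapConst_theta hf hi n x y hxy fun w hw hw' => h w hw ?_
    rw [Set.Finite.coe_toFinset]
    exact ⟨hw', bot_le.trans_lt hw.1, hw.2.trans_le le_top⟩
  rw [hgap.eq_add_sum (fun w hw => crit_interior ((Set.Finite.mem_toFinset _).1 hw)) hlt hγ]
  congr 1
  rw [sum_crit hf (n + 1) fun w => (theta f i n (w, 1) - theta f i n (w, -1)) * position γ w]
  refine Finset.sum_congr rfl fun j hj => Finset.sum_congr rfl fun l _ => ?_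
  rw [hitSum_eq hf hT, Finset.sum_mul]
  refine Finset.sum_congr rfl fun w hw => ?_
  rw [Set.Finite.mem_toFinset] at hw
  have := theta_jump hf hT hw i (n - j)
  rw [show j + (n - j) = n by rw [Finset.mem_range] at hj; omega] at this
  rw [this, mul_comm]

/-- The average of the itineraries of the two end points. -/
noncomputable def endTheta (f : α → α) (i : α) : ℚ⟦X⟧ :=
  C (1 / 2) * (thetaSeries f i (⊥, 1) + thetaSeries f i (⊤, -1))

theorem thetaSeries_eq (hf : Continuous f) (hlt : (⊥ : α) < ⊤) (i : turning f)
    {γ : Germ α} (hγ : GermValid γ) :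
    thetaSeries f i γ - endTheta f i =
      ∑ l : turning f, (mk fun j => hitSum f l j γ) * kneading f l i := by
  rw [sub_eq_iff_eq_add']
  ext n
  rw [thetaSeries, coeff_mk, theta_eq hf hlt i.2 n hγ, endTheta, map_add, coeff_C_mul, map_sum]
  simp only [thetaSeries, coeff_mk, map_add]
  congr 1
  · ring
  · rw [Finset.sum_comm]
    refine Finset.sum_congr rfl fun l _ => ?_
    rw [coeff_mul, Finset.Nat.sum_antidiagonal_eq_sum_range_succ_mk]
    refine Finset.sum_congr rfl fun j _ => ?_
    simp [kneading, thetaSeries]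

/-- The constant term of the kneading matrix is the identity, which makes the matrix invertible over
power series. -/
theorem coeff_zero_kneading [DecidableEq (turning f)] (l i : turning f) :
    coeff 0 (kneading f l i) = if l = i then 1 else 0 := by
  simp only [kneading, Matrix.of_apply, thetaSeries, map_sub, coeff_mk, theta, slopeIter_zero,
    iterate_zero, id, sgn_one, one_mul]
  split_ifs with h
  · subst h
    rw [position_self, position_self]; norm_num
  · have h' : (l : α) ≠ i := fun h' => h (Subtype.ext h')
    rcases lt_or_gt_of_ne h' with h1 | h1
    · rw [position_of_gt h1, position_of_gt h1]; norm_num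
    · rw [position_of_lt h1, position_of_lt h1]; norm_num

theorem coeff_kneading (hf : Continuous f) (l i : turning f) {m : ℕ} (hm : 0 < m) :
    coeff m (kneading f l i) = -2 * theta f i m (l, -1) := by
  simp only [kneading, Matrix.of_apply, thetaSeries, map_sub, coeff_mk]
  rw [theta_turning hf (Set.toFinite _) l.2 _ hm]
  ring

theorem det_kneading_constantCoeff [DecidableEq (turning f)] :
    constantCoeff (kneading f).det = 1 := by
  rw [RingHom.map_det]
  have : (constantCoeff (R := ℚ)).mapMatrix (kneading f) = 1 := by
    ext1 x y
    rw [RingHom.mapMatrix_apply, Matrix.map_apply, Matrix.one_apply,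
      ← coeff_zero_eq_constantCoeff_apply, coeff_zero_kneading]
  rw [this, Matrix.det_one]

/-- The average of the slopes at the two end points. -/
noncomputable def endSlope (f : α → α) : ℚ := (sgn (slope f (⊥, 1)) + sgn (slope f (⊤, -1))) / 2

/-- The jump of the slope at a point. -/
noncomputable def slopeJump (f : α → α) (i : α) : ℚ := sgn (slope f (i, 1)) - sgn (slope f (i, -1))

theorem slopeJump_eq (hf : Continuous f) (l : turning f) :
    slopeJump f l = -2 * sgn (slope f (l, -1)) := by
  rw [slopeJump, slope_right_eq_neg_left hf (Set.toFinite _) l.2, sgn_neg]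
  ring

/-- The slope is itself constant on the laps of `f`, so the telescoping expansion expresses it
through positions. -/
theorem sgn_slope_eq (hf : Continuous f) (hlt : (⊥ : α) < ⊤) {γ : Germ α} (hγ : GermValid γ) :
    sgn (slope f γ) = endSlope f + ∑ i : turning f, slopeJump f i * position γ i := by
  classical
  have hgap : GapConst (fun γ => sgn (slope f γ)) (turning f).toFinset := by
    intro x y hxy h
    rw [Set.coe_toFinset] at h
    exact congrArg sgn (strictSlopeOn_of_gap hf hxy h).2.symm
  rw [hgap.eq_add_sum (fun w hw => ?_) hlt hγ, endSlope]
  · congr 1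
    exact Finset.sum_set_coe (turning f) (f := fun w =>
      (sgn (slope f (w, 1)) - sgn (slope f (w, -1))) * position γ w)|>.symm
  · rw [Set.mem_toFinset] at hw
    exact ⟨hw.1, hw.2.1⟩

theorem germValid_turning {l : α} (hl : l ∈ turning f) (s : ℤˣ) : GermValid (l, s) :=
  germIn_of_mem_Ioo ⟨hl.1, hl.2.1⟩

theorem sum_slopeJump_theta (hf : Continuous f) (hlt : (⊥ : α) < ⊤) {γ : Germ α}
    (hγ : GermValid γ) (n : ℕ) :
    ∑ i : turning f, slopeJump f i * theta f i n γ =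
      sgn (slopeIter f (n + 1) γ) - endSlope f * sgn (slopeIter f n γ) := by
  have h := sgn_slope_eq hf hlt (germValid_germMap_iterate hf (Set.toFinite _) hγ n)
  rw [slopeIter_add, slopeIter_one, sgn_mul, h, mul_add, Finset.mul_sum]
  rw [mul_comm (sgn (slopeIter f n γ)) (endSlope f), add_sub_cancel_left]
  refine Finset.sum_congr rfl fun i _ => ?_
  rw [theta]; ring

/-- The slopes are, up to rational factors, a fixed combination of the columns of the kneading
matrix. This relation serves twice: to eliminate end terms from the fixed point count, and for the
column operations in the unimodal case. -/
theorem critSeries_eq (hf : Continuous f) (hlt : (⊥ : α) < ⊤) (l : turning f) :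
    (1 - C (endSlope f) * X) * critSeries f l =
      - C (1 / 2) * X * ∑ i : turning f, kneading f l i * C (slopeJump f i) := by
  classical
  ext n
  rw [sub_mul, one_mul, map_sub, mul_assoc, coeff_C_mul, mul_assoc, ← map_neg, coeff_C_mul]
  rcases n with _ | n
  · simp [critSeries]
  · rw [coeff_succ_X_mul, coeff_succ_X_mul, map_sum]
    simp only [coeff_mul_C]
    rcases n with _ | n
    · simp only [critSeries, coeff_mk, coeff_zero_kneading, ite_mul, zero_mul, one_mul,
        Finset.sum_ite_eq, Finset.mem_univ, if_true, zero_add, one_ne_zero, if_false,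
        slopeIter_one, slopeJump_eq hf]
      ring
    · simp only [coeff_kneading hf _ _ (Nat.succ_pos n)]
      have h := sum_slopeJump_theta hf hlt (germValid_turning l.2 (-1)) (n + 1)
      simp only [critSeries, coeff_mk, Nat.succ_ne_zero, if_false]
      rw [← h, Finset.mul_sum]
      refine Finset.sum_congr rfl fun i _ => ?_
      ring

theorem sum_slopeJump_thetaSeries (hf : Continuous f) (hlt : (⊥ : α) < ⊤) {γ : Germ α}
    (hγ : GermValid γ) :
    X * ∑ i : turning f, C (slopeJump f i) * thetaSeries f i γ =
      (1 - C (endSlope f) * X) * slopeSeries f γ - 1 := by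
  ext n
  rw [sub_mul, one_mul, map_sub, map_sub, mul_assoc, coeff_C_mul]
  rcases n with _ | n
  · simp [slopeSeries, slopeIter_zero]
  · rw [coeff_succ_X_mul, coeff_succ_X_mul, map_sum]
    simp only [coeff_C_mul, thetaSeries, coeff_mk, slopeSeries]
    rw [sum_slopeJump_theta hf hlt hγ, PowerSeries.coeff_one, if_neg (Nat.succ_ne_zero n)]
    ring

/-- By the cocycle rule for slopes, each of the `n` products contributing to coefficient `n` equals
`theta f i n (l, -1)`. The resulting factor `n` is the source of the derivative. -/
theorem shiftSum_thetaSeries (hf : Continuous f) (l i : turning f) :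
    shiftSum (fun m => sgn (slopeIter f m (l, -1)))
        (fun m => thetaSeries f i ((germMap f)^[m] (l, -1))) =
      - C (1 / 2) * (X * d⁄dX ℚ (kneading f l i)) := by
  ext n
  rw [← map_neg, coeff_C_mul, shiftSum, coeff_mk]
  have h1 : ∀ m ∈ Finset.Icc 1 n, sgn (slopeIter f m (l, -1)) *
      coeff (n - m) (thetaSeries f i ((germMap f)^[m] (l, -1))) = theta f i n (l, -1) := by
    intro m hm
    rw [Finset.mem_Icc] at hm
    rw [thetaSeries, coeff_mk, theta, theta, ← mul_assoc, ← sgn_mul, ← slopeIter_add,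
      ← iterate_add_apply, Nat.sub_add_cancel hm.2, Nat.add_sub_cancel' hm.2]
  rw [Finset.sum_congr rfl h1, Finset.sum_const, Nat.card_Icc, nsmul_eq_mul]
  rcases n with _ | n
  · simp
  · rw [coeff_succ_X_mul, coeff_derivative, coeff_kneading hf _ _ (Nat.succ_pos n)]
    push_cast
    simp
    ring

/-- The generating function of the weighted sums over the turning points of the iterates. -/
noncomputable def critCount (f : α → α) [Fintype (turning f)] : ℚ⟦X⟧ :=
  ∑ l : turning f, shiftSum (fun m => sgn (slopeIter f m (l, -1)))
    (fun m => mk fun j => hitSum f l j ((germMap f)^[m] (l, -1)))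

/-- A point that first hits the turning set at time `j`, at `l`, has a left germ that follows the
left germ of `l` in slope and position for the remaining `n - j` steps. -/
theorem coeff_critCount (hf : Continuous f) (n : ℕ) :
    coeff n (critCount f) = ∑ w ∈ (finite_crit hf (Set.toFinite _) n).toFinset,
      sgn (slopeIter f n (w, -1)) * position ((germMap f)^[n] (w, -1)) w := by
  have hT := Set.toFinite (turning f)
  rw [sum_crit hf n fun w => sgn (slopeIter f n (w, -1)) * position ((germMap f)^[n] (w, -1)) w,
    critCount, map_sum, Finset.sum_comm]
  refine Finset.sum_congr rfl fun l _ => ?_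
  rw [shiftSum, coeff_mk]
  simp only [coeff_mk]
  refine Finset.sum_nbij' (fun m => n - m) (fun j => n - j) ?_ ?_ ?_ ?_ ?_
  · intro m hm; simp only [Finset.mem_Icc, Finset.mem_range] at *; omega
  · intro m hm; simp only [Finset.mem_Icc, Finset.mem_range] at *; omega
  · intro m hm; simp only [Finset.mem_Icc] at *; omega
  · intro m hm; simp only [Finset.mem_range] at *; omega
  · intro m hm
    simp only [Finset.mem_Icc] at hm
    rw [hitSum_eq hf hT, Finset.mul_sum]
    refine Finset.sum_congr rfl fun w hw => ?_
    rw [Set.Finite.mem_toFinset] at hw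
    obtain ⟨h1, h2⟩ := firstHit_iterate_left hf hT l.2 hw (m := m) (by omega)
    rw [show n - m + m = n by omega] at h1 h2
    rw [h1, h2]

/-- The inverse `Q` solves `thetaSeries_eq` for the hit sums; `shiftSum_thetaSeries` then turns the
itineraries into the trace. -/
theorem critCount_eq [DecidableEq (turning f)] (hf : Continuous f) (hlt : (⊥ : α) < ⊤)
    {Q : Matrix (turning f) (turning f) ℚ⟦X⟧} (hQ : kneading f * Q = 1) :
    critCount f = - C (1 / 2) * (X * (Q * (kneading f).map (d⁄dX ℚ)).trace) -
      ∑ i : turning f, endTheta f i * ∑ l : turning f, Q i l * critSeries f l := by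
  have hT := Set.toFinite (turning f)
  have h1 : ∀ (l : turning f) {γ : Germ α}, GermValid γ → (mk fun j => hitSum f l j γ) =
      ∑ i : turning f, (thetaSeries f i γ - endTheta f i) * Q i l := by
    intro l γ hγ
    have : ∀ i : turning f, (thetaSeries f i γ - endTheta f i) * Q i l =
        ∑ k : turning f, (mk fun j => hitSum f k j γ) * (kneading f k i * Q i l) := by
      intro i
      rw [thetaSeries_eq hf hlt i hγ, Finset.sum_mul]
      refine Finset.sum_congr rfl fun k _ => ?_
      ring
    rw [Finset.sum_congr rfl fun i _ => this i, Finset.sum_comm]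
    simp only [← Finset.mul_sum]
    have h2 : ∀ k : turning f, ∑ i, kneading f k i * Q i l = if k = l then 1 else 0 := by
      intro k
      rw [← Matrix.mul_apply, hQ, Matrix.one_apply]
    simp [h2]
  have h2 : ∀ l : turning f, shiftSum (fun m => sgn (slopeIter f m (l, -1)))
      (fun m => mk fun j => hitSum f l j ((germMap f)^[m] (l, -1))) =
      ∑ i : turning f, (- C (1 / 2) * (X * d⁄dX ℚ (kneading f l i)) -
        critSeries f l * endTheta f i) * Q i l := by
    intro l
    have : (fun m => (mk fun j => hitSum f l j ((germMap f)^[m] (l, -1)) : ℚ⟦X⟧)) = fun m =>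
        ∑ i : turning f, (thetaSeries f i ((germMap f)^[m] (l, -1)) - endTheta f i) * Q i l := by
      funext m
      exact h1 l (germValid_germMap_iterate hf hT (germValid_turning l.2 _) m)
    rw [this, shiftSum_sum]
    refine Finset.sum_congr rfl fun i _ => ?_
    rw [shiftSum_mul _ (fun m => thetaSeries f i ((germMap f)^[m] (l, -1)) - endTheta f i),
      shiftSum_sub, shiftSum_thetaSeries hf, shiftSum_const]
    rfl
  rw [critCount, Finset.sum_congr rfl fun l _ => h2 l]
  rw [Matrix.trace]
  simp only [Matrix.diag_apply, Matrix.mul_apply, Matrix.map_apply, sub_mul,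
    Finset.sum_sub_distrib, Finset.mul_sum]
  congr 1
  · rw [Finset.sum_comm]
    refine Finset.sum_congr rfl fun i _ => Finset.sum_congr rfl fun l _ => ?_
    ring
  · rw [Finset.sum_comm]
    refine Finset.sum_congr rfl fun i _ => Finset.sum_congr rfl fun l _ => ?_
    ring

/-- By `critSeries_eq` the matrix `Q` sends the slope series back to the slope jumps, and the
itineraries of the ends weighted by these jumps collapse to the slope series of the ends. -/
theorem mul_critCount_eq [DecidableEq (turning f)] (hf : Continuous f) (hlt : (⊥ : α) < ⊤)
    {Q : Matrix (turning f) (turning f) ℚ⟦X⟧} (hQ : kneading f * Q = 1) :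
    (1 - C (endSlope f) * X) * (C 2 * critCount f) =
      - ((1 - C (endSlope f) * X) * (X * (Q * (kneading f).map (d⁄dX ℚ)).trace)) +
      C (1 / 2) * ((1 - C (endSlope f) * X) * (slopeSeries f (⊥, 1) + slopeSeries f (⊤, -1))) -
      1 := by
  have hQ' : Q * kneading f = 1 := mul_eq_one_comm.1 hQ
  have h1 : ∀ i : turning f, (1 - C (endSlope f) * X) * ∑ l : turning f, Q i l * critSeries f l =
      - C (1 / 2) * X * C (slopeJump f i) := by
    intro i
    have e1 : (1 - C (endSlope f) * X) * ∑ l : turning f, Q i l * critSeries f l =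
        ∑ l : turning f, Q i l * ((1 - C (endSlope f) * X) * critSeries f l) := by
      rw [Finset.mul_sum]
      refine Finset.sum_congr rfl fun l _ => ?_
      ring
    have e2 : ∀ l : turning f, Q i l * ((1 - C (endSlope f) * X) * critSeries f l) =
        ∑ k : turning f, - C (1 / 2) * X * C (slopeJump f k) * (Q i l * kneading f l k) := by
      intro l
      rw [critSeries_eq hf hlt, Finset.mul_sum, Finset.mul_sum]
      refine Finset.sum_congr rfl fun k _ => ?_
      ring
    rw [e1, Finset.sum_congr rfl fun l _ => e2 l, Finset.sum_comm]
    simp only [← Finset.mul_sum]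
    have e3 : ∀ k : turning f, ∑ l, Q i l * kneading f l k = if i = k then 1 else 0 := by
      intro k
      rw [← Matrix.mul_apply, hQ', Matrix.one_apply]
    simp [e3]
  have h2 : (1 - C (endSlope f) * X) *
      ∑ i : turning f, endTheta f i * ∑ l : turning f, Q i l * critSeries f l =
      - C (1 / 2) * (X * ∑ i : turning f, C (slopeJump f i) * endTheta f i) := by
    rw [Finset.mul_sum, Finset.mul_sum, Finset.mul_sum]
    refine Finset.sum_congr rfl fun i _ => ?_
    linear_combination endTheta f i * h1 i
  have h3 : X * ∑ i : turning f, C (slopeJump f i) * endTheta f i =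
      C (1 / 2) * ((1 - C (endSlope f) * X) * (slopeSeries f (⊥, 1) + slopeSeries f (⊤, -1))) -
        1 := by
    have e1 : X * ∑ i : turning f, C (slopeJump f i) * endTheta f i =
        C (1 / 2) * (X * ∑ i : turning f, C (slopeJump f i) * thetaSeries f i (⊥, 1) +
          X * ∑ i : turning f, C (slopeJump f i) * thetaSeries f i (⊤, -1)) := by
      simp only [Finset.mul_sum, ← Finset.sum_add_distrib, endTheta]
      refine Finset.sum_congr rfl fun i _ => ?_
      ring
    rw [e1, sum_slopeJump_thetaSeries hf hlt (germValid_right hlt),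
      sum_slopeJump_thetaSeries hf hlt (germValid_left hlt)]
    have : (C (1 / 2) : ℚ⟦X⟧) * 2 = 1 := by
      rw [← map_ofNat (C (R := ℚ)) 2, ← map_mul]; norm_num
    linear_combination - this
  have h4 : (C 2 : ℚ⟦X⟧) * C (1 / 2) = 1 := by rw [← map_mul]; norm_num
  rw [critCount_eq hf hlt hQ]
  rw [h3] at h2
  linear_combination (- (1 - C (endSlope f) * X) *
    (X * (Q * (kneading f).map (d⁄dX ℚ)).trace) + C (1 / 2) * ((1 - C (endSlope f) * X) *
      (slopeSeries f (⊥, 1) + slopeSeries f (⊤, -1))) - 1) * h4 - C 2 * h2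

end Kneading

/-! ### The zeta function and the kneading determinant -/

section Zeta

open PowerSeries

variable {α : Type*} [ConditionallyCompleteLinearOrder α] [DenselyOrdered α] [TopologicalSpace α]
  [OrderTopology α] [BoundedOrder α] {f : α → α}

theorem isolatedFixedPts_eq {n : ℕ} (h : (Function.fixedPoints f^[n]).Finite) :
    isolatedFixedPts f n = Function.fixedPoints f^[n] := by
  ext x
  refine ⟨fun hx => hx.1, fun hx => ⟨hx, (Function.fixedPoints f^[n] \ {x})ᶜ, ?_, ?_, ?_⟩⟩
  · exact (h.subset Set.sdiff_subset).isClosed.isOpen_compl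
  · simp
  · intro y hy hfy
    by_contra hne
    exact hy ⟨hfy, hne⟩

/-- Both sides have constant coefficient 1 and the same logarithmic derivative. The factor `F` is
the product of the reciprocal zeta functions of `f` on `lapEndPeriodicPts f` and of `germMap f` on
`attractingGerms f`. -/
theorem artinMazurZeta_mul_det (hf : Continuous f) [Fintype (turning f)]
    [DecidableEq (turning f)] (hlt : (⊥ : α) < ⊤) (hR : (nonRepelling f).Finite) :
    ∃ F : ℚ⟦X⟧, IsRationalSeries F ∧ constantCoeff F = 1 ∧
      artinMazurZeta f * (kneading f).det * F = 1 - C (endSlope f) * X := by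
  have hT := Set.toFinite (turning f)
  obtain ⟨F₁, hF₁, hc₁, hd₁⟩ := exists_rational_hasLogDeriv_of_finite
    (finite_lapEndPeriodicPts hT) (mapsTo_lapEndPeriodicPts (f := f))
  obtain ⟨F₂, hF₂, hc₂, hd₂⟩ := exists_rational_hasLogDeriv_of_finite
    (finite_attractingGerms hf hR) (mapsTo_attractingGerms hf hT)
  refine ⟨F₁ * F₂, hF₁.mul hF₂, by rw [map_mul, hc₁, hc₂, one_mul], ?_⟩
  have hunit : IsUnit (kneading f).det := by
    rw [isUnit_iff_constantCoeff, det_kneading_constantCoeff]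
    exact isUnit_one
  have hQ : kneading f * (kneading f)⁻¹ = 1 := Matrix.mul_nonsing_inv _ hunit
  have hdK := hasLogDeriv_det _ _ hQ
  have hdζ := hasLogDeriv_zeta fun n => ((isolatedFixedPts f n).ncard : ℚ)
  have hcζ := constantCoeff_zeta fun n => ((isolatedFixedPts f n).ncard : ℚ)
  have hprod := (hdζ.mul hdK).mul (hd₁.mul hd₂)
  refine hprod.unique (G := 1 - C (endSlope f) * X) ?_ ?_ ?_
  -- The final `+ 1` repairs coefficient 0, where each of the two slope series has coefficient 1.
  · have hcount : (mk fun n : ℕ => if n = 0 then 0 else ((isolatedFixedPts f n).ncard : ℚ)) =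
        (mk fun n : ℕ => if n = 0 then 0 else
          ({x ∈ lapEndPeriodicPts f | f^[n] x = x}.ncard : ℚ)) +
        (mk fun n : ℕ => if n = 0 then 0 else
          ({γ ∈ attractingGerms f | (germMap f)^[n] γ = γ}.ncard : ℚ)) +
        C 2 * critCount f -
        C (1 / 2) * (slopeSeries f (⊥, 1) + slopeSeries f (⊤, -1)) + 1 := by
      ext n
      simp only [map_add, map_sub, coeff_mk, coeff_C_mul, slopeSeries, PowerSeries.coeff_one,
        coeff_critCount hf]
      rcases Nat.eq_zero_or_pos n with rfl | hn
      · have : (finite_crit hf hT 0).toFinset = ∅ := by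
          ext w; simp [crit, turningIter]
        rw [this]
        simp [slopeIter_zero]
        norm_num
      · have hfix := finite_fixedPoints hf hT hR hn
        rw [if_neg hn.ne', if_neg hn.ne', if_neg hn.ne', if_neg hn.ne', isolatedFixedPts_eq hfix,
          ncard_fixedPoints hf hT hlt n hfix, lapEndFixedPts_eq hf hT hn,
          isAttracting_eq hf hT hR hn]
        ring
    unfold HasLogDeriv
    rw [hcount]
    have h1 := mul_critCount_eq hf hlt hQ
    have h2 : d⁄dX ℚ (1 - C (endSlope f) * X) = - C (endSlope f) := by
      rw [map_sub, derivative_one, Derivation.leibniz, derivative_X, derivative_C]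
      simp
    rw [h2]
    linear_combination - h1
  · rw [map_mul, map_mul, map_mul, hc₁, hc₂, det_kneading_constantCoeff, hcζ]
    simp
  · simp

end Zeta

/-! ### The kneading determinant of a virtually unimodal map -/

section Unimodal

open PowerSeries

theorem eventuallyPeriodic_iterate {β : Type*} {g : β → β} {x : β} {S : Set β} (hS : S.Finite)
    {k : ℕ} (h : ∀ m, k ≤ m → g^[m] x ∈ S) : EventuallyPeriodic fun m => g^[m] x := by
  obtain ⟨i, -, j, -, hij, he⟩ := (Set.Ici_infinite k).exists_lt_map_eq_of_mapsTo
    (f := fun m => g^[m] x) (fun m hm => h m hm) hS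
  refine ⟨i, j - i, by omega, fun m hm => ?_⟩
  have e1 : m + (j - i) = (m - i) + j := by omega
  have e2 : m = (m - i) + i := by omega
  dsimp only at he ⊢
  rw [e1, iterate_add_apply, ← he, ← iterate_add_apply, ← e2]

theorem EventuallyPeriodic.comp {β δ : Type*} {e : ℕ → β} (he : EventuallyPeriodic e)
    (φ : β → δ) : EventuallyPeriodic fun m => φ (e m) := by
  obtain ⟨M, p, hp, h⟩ := he
  exact ⟨M, p, hp, fun m hm => congrArg φ (h m hm)⟩

theorem EventuallyPeriodic.congr {β : Type*} {e e' : ℕ → β} (he : EventuallyPeriodic e) (k : ℕ)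
    (h : ∀ m, k ≤ m → e' m = e m) : EventuallyPeriodic e' := by
  obtain ⟨M, p, hp, h'⟩ := he
  refine ⟨max M k, p, hp, fun m hm => ?_⟩
  rw [h m (by omega), h (m + p) (by omega), h' m (by omega)]

variable {α : Type*} [ConditionallyCompleteLinearOrder α] [DenselyOrdered α] [TopologicalSpace α]
  [OrderTopology α] [BoundedOrder α] {f : α → α}

/-- `f` maps `[p, q]` to itself, with `c` as only turning point inside, and the turning points are
eventually mapped to `[p, q]`. -/
structure IsUnimodalCore (f : α → α) (p q c : α) : Prop where
  continuous : Continuous f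
  finite : (turning f).Finite
  mapsTo : Set.MapsTo f (Set.Icc p q) (Set.Icc p q)
  mem_turning : c ∈ turning f
  mem_Ioo : c ∈ Set.Ioo p q
  unique : ∀ x ∈ turning f, x ∈ Set.Ioo p q → x = c
  exists_iterate : ∃ k, ∀ x ∈ turning f, f^[k] x ∈ Set.Icc p q

variable {p q c : α}

theorem IsUnimodalCore.bot_lt_top (h : IsUnimodalCore f p q c) : (⊥ : α) < ⊤ :=
  h.mem_turning.1.trans h.mem_turning.2.1

open Classical in
/-- The position with respect to `i` of all the germs in `[p, q]`. -/
noncomputable def corePosition (p i : α) : ℚ := if i ≤ p then 1 / 2 else - 1 / 2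

/-- The point `i` is not in the open interval, so all germs in `[p, q]` see it on the same side; if
`i` is an end of the interval, a germ based there points inwards. -/
theorem IsUnimodalCore.position_eq (h : IsUnimodalCore f p q c) {i : α} (hi : i ∈ turning f)
    (hic : i ≠ c) {γ : Germ α} (hγ : GermIn p q γ) : position γ i = corePosition p i := by
  obtain ⟨x, s⟩ := γ
  unfold corePosition
  split_ifs with hp
  · rcases (hp.trans hγ.1).eq_or_lt with he | hlt
    · have he' : i = x := he
      subst he'
      have hs : s = 1 := (Int.units_eq_one_or s).resolve_right fun hs =>
        (hγ.2.2.2 hs).not_ge hp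
      rw [hs, position_self]; simp
    · exact position_of_lt hlt
  · have hq : q ≤ i := not_lt.1 fun hq => hic (h.unique i hi ⟨not_le.1 hp, hq⟩)
    rcases (hγ.2.1.trans hq).eq_or_lt with he | hlt
    · have he' : x = i := he
      subst he'
      have hs : s = -1 := (Int.units_eq_one_or s).resolve_left fun hs =>
        (hγ.2.2.1 hs).not_ge hq
      rw [hs, position_self]; simp
    · exact position_of_gt hlt

theorem IsUnimodalCore.germIn (h : IsUnimodalCore f p q c) (s : ℤˣ) (m : ℕ) :
    GermIn p q ((germMap f)^[m] (c, s)) :=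
  germIn_germMap_iterate h.continuous h.finite h.mapsTo (germIn_of_mem_Ioo h.mem_Ioo) m

theorem sgn_slopeIter_left (f : α → α) (l : α) (m : ℕ) :
    sgn (slopeIter f m (l, -1)) = - sgn ((germMap f)^[m] (l, -1)).2 := by
  rw [germMap_iterate]; simp

variable [Fintype (turning f)] [DecidableEq (turning f)]

/-- The entries of the kneading matrix, corrected so as to be rational. -/
noncomputable def reducedKneading (f : α → α) (p : α) (l i : turning f) : ℚ⟦X⟧ :=
  kneading f l i + C (2 * corePosition p i) * critSeries f l

theorem coeff_reducedKneading (hf : Continuous f) (l i : turning f) {m : ℕ} (hm : 0 < m) :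
    coeff m (reducedKneading f p l i) = 2 * sgn ((germMap f)^[m] ((l : α), -1)).2 *
      (position ((germMap f)^[m] ((l : α), -1)) i - corePosition p i) := by
  rw [reducedKneading, map_add, coeff_C_mul, coeff_kneading hf l i hm, critSeries, coeff_mk,
    if_neg hm.ne', theta, sgn_slopeIter_left]
  ring

theorem coeff_zero_reducedKneading (l i : turning f) :
    coeff 0 (reducedKneading f p l i) = if l = i then 1 else 0 := by
  rw [reducedKneading, map_add, coeff_C_mul, coeff_zero_kneading, critSeries, coeff_mk]
  simp

/-- The germ of `c` never leaves `[p, q]`, where the correction cancels the position. This is the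
source of the block triangular form. -/
theorem IsUnimodalCore.reducedKneading_eq_zero (h : IsUnimodalCore f p q c) {l i : turning f}
    (hl : (l : α) = c) (hi : (i : α) ≠ c) : reducedKneading f p l i = 0 := by
  ext m
  rcases Nat.eq_zero_or_pos m with rfl | hm
  · rw [coeff_zero_reducedKneading, if_neg (by rintro rfl; exact hi hl), map_zero]
  · rw [coeff_reducedKneading h.continuous l i hm, hl, h.position_eq i.2 hi (h.germIn _ m)]
    simp

/-- Once the germ of `l` enters `[p, q]` the coefficients vanish. If it never does, its base point
still ends up in `[p, q]`, so the germ eventually points outwards from an end: two values remain and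
the germ orbit is eventually periodic. -/
theorem IsUnimodalCore.isRationalSeries_reducedKneading (h : IsUnimodalCore f p q c)
    (l : turning f) {i : turning f} (hi : (i : α) ≠ c) :
    IsRationalSeries (reducedKneading f p l i) := by
  have hmk : reducedKneading f p l i = PowerSeries.mk fun m => coeff m (reducedKneading f p l i) := by
    ext m; rw [coeff_mk]
  rw [hmk]
  refine EventuallyPeriodic.isRationalSeries ?_
  by_cases hex : ∃ k, GermIn p q ((germMap f)^[k] ((l : α), -1))
  · obtain ⟨k, hk⟩ := hex
    refine ⟨k + 1, 1, one_pos, fun m hm => ?_⟩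
    have key : ∀ m, k + 1 ≤ m → coeff m (reducedKneading f p l i) = 0 := by
      intro m hm
      have := germIn_germMap_iterate h.continuous h.finite h.mapsTo hk (m - k)
      rw [← iterate_add_apply, Nat.sub_add_cancel (by omega)] at this
      rw [coeff_reducedKneading h.continuous l i (by omega), h.position_eq i.2 hi this]
      simp
    exact (key (m + 1) (by omega)).trans (key m hm).symm
  · push Not at hex
    obtain ⟨k, hk⟩ := h.exists_iterate
    have hper : EventuallyPeriodic fun m => (germMap f)^[m] ((l : α), -1) := by
      refine eventuallyPeriodic_iterate (S := {(p, -1), (q, 1)}) (by simp) (k := k) fun m hm => ?_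
      have hJ : f^[m] l ∈ Set.Icc p q := by
        have := h.mapsTo.iterate (m - k) (hk l l.2)
        rwa [← iterate_add_apply, Nat.sub_add_cancel hm] at this
      have hnot := hex m
      rw [germMap_iterate] at hnot ⊢
      simp only [GermIn, not_and_or, Classical.not_imp, not_lt] at hnot
      rcases hnot with h1 | h1 | ⟨h1, h2⟩ | ⟨h1, h2⟩
      · exact absurd hJ.1 h1
      · exact absurd hJ.2 h1
      · right
        exact Prod.ext (le_antisymm hJ.2 h2) h1
      · left
        exact Prod.ext (le_antisymm h2 hJ.1) h1
    refine (hper.comp fun γ => 2 * sgn γ.2 * (position γ i - corePosition p i)).congr 1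
      fun m hm => ?_
    exact coeff_reducedKneading h.continuous l i (by omega)

/-- The column operations that make the kneading matrix block triangular. -/
noncomputable def columnOps (f : α → α) [Fintype (turning f)] [DecidableEq (turning f)] (p c : α) :
    Matrix (turning f) (turning f) ℚ⟦X⟧ := by
  classical
  exact Matrix.of fun k i => if (i : α) = c then X * C (slopeJump f k) else
    (if k = i then 1 - C (endSlope f) * X else 0) - C (corePosition p i) * (X * C (slopeJump f k))

theorem isRationalSeries_one_sub (r : ℚ) : IsRationalSeries (1 - C r * X) :=
  rationalSubring.sub_mem rationalSubring.one_mem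
    (rationalSubring.mul_mem (C_mem_rationalSubring r) X_mem_rationalSubring)

theorem isRationalSeries_det_columnOps : IsRationalSeries (columnOps f p c).det := by
  refine det_mem_subring rationalSubring _ fun k i => ?_
  have h1 : ∀ r, (X * C r : ℚ⟦X⟧) ∈ rationalSubring := fun r =>
    rationalSubring.mul_mem X_mem_rationalSubring (C_mem_rationalSubring r)
  simp only [columnOps, Matrix.of_apply]
  split_ifs
  · exact h1 _
  · exact rationalSubring.sub_mem (isRationalSeries_one_sub _)
      (rationalSubring.mul_mem (C_mem_rationalSubring _) (h1 _))
  · exact rationalSubring.sub_mem rationalSubring.zero_mem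
      (rationalSubring.mul_mem (C_mem_rationalSubring _) (h1 _))

theorem X_mul_sum_kneading (hf : Continuous f) (hlt : (⊥ : α) < ⊤) (l : turning f) :
    ∑ k : turning f, kneading f l k * (X * C (slopeJump f k)) =
      - C 2 * ((1 - C (endSlope f) * X) * critSeries f l) := by
  rw [critSeries_eq hf hlt l]
  have h4 : (C 2 : ℚ⟦X⟧) * C (1 / 2) = 1 := by rw [← map_mul]; norm_num
  have : ∑ k : turning f, kneading f l k * (X * C (slopeJump f k)) =
      X * ∑ k : turning f, kneading f l k * C (slopeJump f k) := by
    rw [Finset.mul_sum]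
    refine Finset.sum_congr rfl fun k _ => ?_
    ring
  rw [this]
  linear_combination - X * (∑ k : turning f, kneading f l k * C (slopeJump f k)) * h4

theorem kneading_mul_columnOps_self (hf : Continuous f) (hlt : (⊥ : α) < ⊤) (l : turning f)
    {i : turning f} (hi : (i : α) = c) :
    (kneading f * columnOps f p c) l i = - C 2 * ((1 - C (endSlope f) * X) * critSeries f l) := by
  rw [Matrix.mul_apply, ← X_mul_sum_kneading hf hlt]
  simp [columnOps, hi]

theorem kneading_mul_columnOps_of_ne (hf : Continuous f) (hlt : (⊥ : α) < ⊤) (l : turning f)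
    {i : turning f} (hi : (i : α) ≠ c) :
    (kneading f * columnOps f p c) l i = (1 - C (endSlope f) * X) * reducedKneading f p l i := by
  rw [Matrix.mul_apply]
  simp only [columnOps, Matrix.of_apply, if_neg hi, mul_sub, mul_ite, mul_zero,
    Finset.sum_sub_distrib, Finset.sum_ite_eq', Finset.mem_univ, if_true]
  have h1 := X_mul_sum_kneading hf hlt l
  have h2 : ∑ k : turning f, kneading f l k * (C (corePosition p i) * (X * C (slopeJump f k))) =
      C (corePosition p i) * ∑ k : turning f, kneading f l k * (X * C (slopeJump f k)) := by
    rw [Finset.mul_sum]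
    refine Finset.sum_congr rfl fun k _ => ?_
    ring
  rw [h2, h1, reducedKneading, map_mul]
  ring

/-- After the column operations the row of `c` vanishes outside its diagonal entry, a nonzero
rational multiple of `critSeries f c`. The complementary block is rational with determinant of
constant coefficient 1. -/
theorem IsUnimodalCore.isRationalSeries_det_iff (h : IsUnimodalCore f p q c) :
    IsRationalSeries (kneading f).det ↔ IsRationalSeries (critSeries f c) := by
  classical
  have hf := h.continuous
  have hlt := h.bot_lt_top
  set M := kneading f * columnOps f p c with hM
  set P : turning f → Prop := fun i => (i : α) ≠ c with hP
  have hblock := Matrix.twoBlockTriangular_det M P (fun l hl i hi => by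
    rw [hM, kneading_mul_columnOps_of_ne hf hlt l hi,
      h.reducedKneading_eq_zero (not_not.1 hl) hi, mul_zero])
  set m := (M.toSquareBlockProp P).det with hm
  have hmrat : IsRationalSeries m := by
    refine det_mem_subring rationalSubring _ fun l i => ?_
    rw [Matrix.toSquareBlockProp_def, Matrix.of_apply, hM,
      kneading_mul_columnOps_of_ne hf hlt _ i.2]
    exact (isRationalSeries_one_sub _).mul (h.isRationalSeries_reducedKneading _ i.2)
  have hmconst : constantCoeff m = 1 := by
    rw [hm, RingHom.map_det]
    have : (constantCoeff (R := ℚ)).mapMatrix (M.toSquareBlockProp P) = 1 := by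
      ext1 l i
      rw [RingHom.mapMatrix_apply, Matrix.map_apply, Matrix.toSquareBlockProp_def,
        Matrix.of_apply, hM, kneading_mul_columnOps_of_ne hf hlt _ i.2, map_mul,
        ← coeff_zero_eq_constantCoeff_apply (φ := reducedKneading f p l i),
        coeff_zero_reducedKneading, Matrix.one_apply]
      simp [Subtype.ext_iff]
    rw [this, Matrix.det_one]
  have hlast : (M.toSquareBlockProp fun i => ¬ P i).det =
      - C 2 * ((1 - C (endSlope f) * X) * critSeries f c) := by
    have hsub : Subsingleton {i // ¬ P i} :=
      ⟨fun x y => Subtype.ext (Subtype.ext ((not_not.1 x.2).trans (not_not.1 y.2).symm))⟩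
    rw [Matrix.det_eq_elem_of_subsingleton _ (⟨⟨c, h.mem_turning⟩, not_not.2 rfl⟩ : {i // ¬ P i}),
      Matrix.toSquareBlockProp_def, Matrix.of_apply, hM]
    exact kneading_mul_columnOps_self hf hlt ⟨c, h.mem_turning⟩ rfl
  rw [hlast, hM, Matrix.det_mul] at hblock
  set E := critSeries f c with hE
  have hfac : IsRationalSeries (m * (- C 2 * (1 - C (endSlope f) * X))) :=
    hmrat.mul (IsRationalSeries.mul
      (rationalSubring.neg_mem (C_mem_rationalSubring 2)) (isRationalSeries_one_sub _))
  constructor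
  · intro hK
    refine IsRationalSeries.of_mul_eq hfac
      (hK.mul (isRationalSeries_det_columnOps (f := f) (p := p) (c := c)))
      ?_ ?_
    · intro h0
      have := congrArg constantCoeff h0
      rw [map_mul, hmconst] at this
      simp at this
    · rw [hblock]; ring
  · intro hErat
    refine IsRationalSeries.of_mul_eq (isRationalSeries_det_columnOps (f := f) (p := p) (c := c))
      (hfac.mul hErat) ?_ ?_
    -- The determinant of `columnOps f p c` is not computed; it cannot vanish because neither
    -- diagonal block of the product has determinant zero. For `critSeries f c` this is seen on
    -- coefficient 1, a sign.
    · intro h0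
      rw [h0, mul_zero] at hblock
      have h1 : (m * (- C 2 * (1 - C (endSlope f) * X))) * E = 0 := by
        rw [hblock]; ring
      rcases mul_eq_zero.1 h1 with h2 | h2
      · have := congrArg constantCoeff h2
        rw [map_mul, hmconst] at this
        simp at this
      · have := congrArg (coeff 1) h2
        simp only [hE, critSeries, coeff_mk, one_ne_zero, if_false, map_zero] at this
        have h3 := sgn_mul_self (slopeIter f 1 (c, -1))
        rw [this] at h3
        simp at h3
    · rw [hblock]; ring

end Unimodal

/-! ### Eventually periodic itineraries -/

section Asymptotic

open PowerSeries

variable {α : Type*} [ConditionallyCompleteLinearOrder α] [DenselyOrdered α] [TopologicalSpace α]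
  [OrderTopology α] [BoundedOrder α] {f : α → α} {p q c : α}

theorem IsUnimodalCore.slope_of_lt (h : IsUnimodalCore f p q c) {γ : Germ α} (hγ : GermIn p q γ)
    (hlt : γ.1 < c) : slope f γ = slope f (c, -1) := by
  obtain ⟨x, s⟩ := γ
  have hlt' : x < c := hlt
  have hno : ∀ w ∈ Set.Ioo p c, w ∉ turning f := fun w hw hw' =>
    hw.2.ne (h.unique w hw' ⟨hw.1, hw.2.trans h.mem_Ioo.2⟩)
  rcases Int.units_eq_one_or s with rfl | rfl
  · exact (strictSlopeOn_of_gap h.continuous hlt' fun w hw =>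
      hno w ⟨lt_of_le_of_lt hγ.1 hw.1, hw.2⟩).2.symm
  · rw [(strictSlopeOn_of_gap h.continuous (hγ.2.2.2 rfl) fun w hw =>
      hno w ⟨hw.1, hw.2.trans hlt'⟩).2, (strictSlopeOn_of_gap h.continuous h.mem_Ioo.1 hno).2]

theorem IsUnimodalCore.slope_of_gt (h : IsUnimodalCore f p q c) {γ : Germ α} (hγ : GermIn p q γ)
    (hlt : c < γ.1) : slope f γ = slope f (c, 1) := by
  obtain ⟨x, s⟩ := γ
  have hlt' : c < x := hlt
  have hno : ∀ w ∈ Set.Ioo c q, w ∉ turning f := fun w hw hw' =>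
    hw.1.ne' (h.unique w hw' ⟨h.mem_Ioo.1.trans hw.1, hw.2⟩)
  rcases Int.units_eq_one_or s with rfl | rfl
  · rw [← (strictSlopeOn_of_gap h.continuous (hγ.2.2.1 rfl) fun w hw =>
      hno w ⟨hlt'.trans hw.1, hw.2⟩).2, (strictSlopeOn_of_gap h.continuous h.mem_Ioo.2 hno).2]
  · exact (strictSlopeOn_of_gap h.continuous hlt' fun w hw =>
      hno w ⟨hw.1, hw.2.trans_le hγ.2.1⟩).2

theorem IsUnimodalCore.strictSlopeOn_left (h : IsUnimodalCore f p q c) :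
    StrictSlopeOn f (slope f (c, -1)) (Set.Icc p c) := by
  have := strictSlopeOn_of_gap h.continuous h.mem_Ioo.1 fun w hw hw' =>
    hw.2.ne (h.unique w hw' ⟨hw.1, hw.2.trans h.mem_Ioo.2⟩)
  rw [this.2]
  exact this.1

theorem IsUnimodalCore.strictSlopeOn_right (h : IsUnimodalCore f p q c) :
    StrictSlopeOn f (slope f (c, 1)) (Set.Icc c q) :=
  (strictSlopeOn_of_gap h.continuous h.mem_Ioo.2 fun w hw hw' =>
    hw.1.ne' (h.unique w hw' ⟨h.mem_Ioo.1.trans hw.1, hw.2⟩)).1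

theorem IsUnimodalCore.iterate_mem (h : IsUnimodalCore f p q c) (m : ℕ) :
    f^[m] c ∈ Set.Icc p q :=
  h.mapsTo.iterate m ⟨h.mem_Ioo.1.le, h.mem_Ioo.2.le⟩

/-- The germ of the orbit of the turning point at time `m`. -/
noncomputable def critGerm (f : α → α) (c : α) (m : ℕ) : Germ α := (germMap f)^[m] (c, -1)

theorem critGerm_fst (m : ℕ) : (critGerm f c m).1 = f^[m] c := by
  rw [critGerm, germMap_iterate]

theorem slopeIter_critGerm (m n : ℕ) :
    slopeIter f (m + n) (c, -1) = slopeIter f m (c, -1) * slopeIter f n (critGerm f c m) :=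
  slopeIter_add f m n _

/-- Inside `[p, q]` the slope takes opposite values on the two sides of `c`, so it is equivalent to
the side. -/
theorem IsUnimodalCore.slope_critGerm_eq_iff (h : IsUnimodalCore f p q c) {m n : ℕ}
    (hm : f^[m] c ≠ c) (hn : f^[n] c ≠ c) :
    slope f (critGerm f c m) = slope f (critGerm f c n) ↔ (f^[m] c < c ↔ f^[n] c < c) := by
  have hcc := slope_right_eq_neg_left h.continuous h.finite h.mem_turning
  have hne : slope f (c, -1) ≠ slope f (c, 1) := by
    rw [hcc]
    rcases Int.units_eq_one_or (slope f (c, -1)) with e | e <;> rw [e] <;> decide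
  have hv : ∀ k, f^[k] c ≠ c → (f^[k] c < c ∧ slope f (critGerm f c k) = slope f (c, -1)) ∨
      (¬ f^[k] c < c ∧ slope f (critGerm f c k) = slope f (c, 1)) := by
    intro k hk
    rcases lt_or_gt_of_ne hk with hlt | hlt
    · exact Or.inl ⟨hlt, h.slope_of_lt (γ := critGerm f c k) (h.germIn _ k) (by rwa [critGerm_fst])⟩
    · exact Or.inr ⟨hlt.not_gt,
        h.slope_of_gt (γ := critGerm f c k) (h.germIn _ k) (by rwa [critGerm_fst])⟩
  rcases hv m hm with ⟨a1, a2⟩ | ⟨a1, a2⟩ <;> rcases hv n hn with ⟨b1, b2⟩ | ⟨b1, b2⟩ <;>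
    simp [a1, a2, b1, b2, hne, hne.symm]

/-! ### Periodic slopes and asymptotic orbits. -/

theorem isAsymptoticToPeriodicOrbit_of_iterate_eq {P M : ℕ} (hP : 0 < P)
    (h : f^[M + P] c = f^[M] c) : IsAsymptoticToPeriodicOrbit f c := by
  have hper : IsPeriodicPt f P (f^[M] c) := by
    rw [add_comm, iterate_add_apply] at h
    exact h
  refine ⟨f^[M] c, ⟨P, hP, hper⟩, M, tendsto_const_nhds.congr fun k => ?_⟩
  rw [iterate_add_apply]
  exact ((isPeriodicPt_minimalPeriod f (f^[M] c)).const_mul k).eq.symm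

/-- The limit has period `P`, but its minimal period may be a proper divisor. Continuity of the
intermediate iterates, which fix the limit, gives convergence along the remaining times. -/
theorem isAsymptoticToPeriodicOrbit_of_tendsto (hf : Continuous f) {P M : ℕ} (hP : 0 < P) {z : α}
    (h : Tendsto (fun k => f^[M + k * P] c) atTop (𝓝 z)) : IsAsymptoticToPeriodicOrbit f c := by
  have hper : IsPeriodicPt f P z := by
    have h1 := (tendsto_add_atTop_iff_nat 1).2 h
    have h2 := ((hf.iterate P).tendsto z).comp h
    refine tendsto_nhds_unique h2 (h1.congr fun k => ?_)
    rw [Function.comp_apply, ← iterate_add_apply, show P + (M + k * P) = M + (k + 1) * P by ring]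
  refine ⟨z, ⟨P, hP, hper⟩, M, ?_⟩
  obtain ⟨r, hr⟩ := hper.minimalPeriod_dvd
  set Q := minimalPeriod f z with hQ
  have hr0 : 0 < r := Nat.pos_of_ne_zero (by rintro rfl; omega)
  intro U hU
  have hev : ∀ᶠ k in atTop, ∀ i ∈ Set.Iio r, f^[i * Q] (f^[M + k * P] c) ∈ U := by
    rw [eventually_all_finite (Set.finite_Iio r)]
    intro i _
    have h3 := ((hf.iterate (i * Q)).tendsto z).comp h
    rw [((isPeriodicPt_minimalPeriod f z).const_mul i).eq] at h3
    exact h3 hU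
  obtain ⟨K, hK⟩ := eventually_atTop.1 hev
  rw [mem_map, mem_atTop_sets]
  refine ⟨r * K, fun k hk => ?_⟩
  have h4 := hK (k / r) ((Nat.le_div_iff_mul_le hr0).2 (by linarith)) (k % r) (Nat.mod_lt _ hr0)
  rw [← iterate_add_apply] at h4
  have h5 : k * Q + M = k % r * Q + (M + k / r * P) := by
    rw [hr]
    conv_lhs => rw [← Nat.mod_add_div k r]
    ring
  rw [Set.mem_preimage, h5]
  exact h4

theorem IsUnimodalCore.isAsymptotic_of_eventuallyPeriodic (h : IsUnimodalCore f p q c)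
    (he : EventuallyPeriodic fun m => slopeIter f m (c, -1)) :
    IsAsymptoticToPeriodicOrbit f c := by
  obtain ⟨M', P, hP, hM'⟩ := he
  by_cases hc : ∃ m, 0 < m ∧ f^[m] c = c
  · obtain ⟨m, hm, hmc⟩ := hc
    exact isAsymptoticToPeriodicOrbit_of_iterate_eq hm (M := 0) (by simpa using hmc)
  push Not at hc
  -- The shift by one keeps all times positive, so that the orbit differs from `c` at each of them.
  set M := M' + 1 with hMdef
  have hM : ∀ m, M ≤ m → slopeIter f (m + P) (c, -1) = slopeIter f m (c, -1) :=
    fun m hm => hM' m (by omega)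
  by_cases heq : f^[M + P] c = f^[M] c
  · exact isAsymptoticToPeriodicOrbit_of_iterate_eq hP heq
  have hslope : ∀ m, M ≤ m → slope f (critGerm f c (m + P)) = slope f (critGerm f c m) := by
    intro m hm
    have h1 := hM m hm
    have h2 := hM (m + 1) (by omega)
    rw [add_right_comm, slopeIter_critGerm, slopeIter_critGerm m 1, h1, slopeIter_one,
      slopeIter_one] at h2
    exact mul_left_cancel h2
  obtain ⟨s, hs⟩ : ∃ s : ℤˣ, SideLT s (f^[M] c) (f^[M + P] c) := by
    rcases lt_or_gt_of_ne heq with hlt | hlt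
    exacts [⟨-1, sideLT_neg_one.2 hlt⟩, ⟨1, sideLT_one.2 hlt⟩]
  -- Points `P` steps apart lie on the same side of `c`, hence on one monotone branch, so their
  -- order evolves by the slopes alone.
  have hstep : ∀ i, SideLT (s * slopeIter f i (critGerm f c M)) (f^[M + i] c)
      (f^[M + i + P] c) := by
    intro i
    induction i with
    | zero => simpa [slopeIter_zero] using hs
    | succ i ih =>
      have h1 := hslope (M + i) (by omega)
      have n1 := hc (M + i) (by omega)
      have n2 := hc (M + i + P) (by omega)
      have h2 := (h.slope_critGerm_eq_iff n2 n1).1 h1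
      have e1 : slopeIter f (i + 1) (critGerm f c M) =
          slopeIter f i (critGerm f c M) * slope f (critGerm f c (M + i)) := by
        rw [slopeIter_add, slopeIter_one, critGerm, critGerm, ← iterate_add_apply, add_comm i M]
      rw [e1, ← mul_assoc, show M + (i + 1) + P = (M + i + P) + 1 by ring,
        show M + (i + 1) = (M + i) + 1 by ring, iterate_succ_apply', iterate_succ_apply']
      have m1 := h.iterate_mem (M + i)
      have m2 := h.iterate_mem (M + i + P)
      rcases lt_or_gt_of_ne n1 with hlt | hlt
      · rw [h.slope_of_lt (γ := critGerm f c (M + i)) (h.germIn _ _) (by rwa [critGerm_fst])]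
        exact h.strictSlopeOn_left.sideLT ⟨m1.1, hlt.le⟩ ⟨m2.1, (h2.2 hlt).le⟩ ih
      · rw [h.slope_of_gt (γ := critGerm f c (M + i)) (h.germIn _ _) (by rwa [critGerm_fst])]
        exact h.strictSlopeOn_right.sideLT ⟨hlt.le, m1.2⟩
          ⟨not_lt.1 fun h3 => hlt.not_gt (h2.1 h3), m2.2⟩ ih
  -- Over whole periods the slope is 1, so the initial order of the two points recurs and the
  -- subsequence is strictly monotone.
  have hone : ∀ k, slopeIter f (k * P) (critGerm f c M) = 1 := by
    intro k
    have h1 : slopeIter f (M + k * P) (c, -1) = slopeIter f M (c, -1) := by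
      induction k with
      | zero => simp
      | succ k ih => rw [← ih, ← hM (M + k * P) (by omega)]; congr 1; ring
    rw [slopeIter_critGerm] at h1
    simpa using h1
  have hz : ∀ k, SideLT s (f^[M + k * P] c) (f^[M + (k + 1) * P] c) := by
    intro k
    have h1 := hstep (k * P)
    rwa [hone, mul_one, show M + k * P + P = M + (k + 1) * P by ring] at h1
  rcases Int.units_eq_one_or s with rfl | rfl
  · simp only [sideLT_one] at hz
    exact isAsymptoticToPeriodicOrbit_of_tendsto h.continuous hP
      (tendsto_atTop_ciSup (strictMono_nat_of_lt_succ hz).monotone (OrderTop.bddAbove _))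
  · simp only [sideLT_neg_one] at hz
    exact isAsymptoticToPeriodicOrbit_of_tendsto h.continuous hP
      (tendsto_atTop_ciInf (strictAnti_nat_of_succ_lt hz).antitone (OrderBot.bddBelow _))

theorem IsUnimodalCore.eventuallyPeriodic_of_isAsymptotic (h : IsUnimodalCore f p q c)
    (ha : IsAsymptoticToPeriodicOrbit f c) :
    EventuallyPeriodic fun m => slopeIter f m (c, -1) := by
  by_cases hfin : ∃ i j, i < j ∧ f^[i] c = f^[j] c
  · obtain ⟨i, j, hij, he⟩ := hfin
    have horb : ∀ n, ∃ k < j, f^[n] c = f^[k] c := by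
      intro n
      induction n using Nat.strong_induction_on with
      | _ n ih =>
        by_cases hn : n < j
        · exact ⟨n, hn, rfl⟩
        · obtain ⟨k, hk, hk'⟩ := ih (n - j + i) (by omega)
          refine ⟨k, hk, ?_⟩
          rw [← hk', iterate_add_apply, he, ← iterate_add_apply]
          congr 2
          omega
    have hper : EventuallyPeriodic fun m => (germMap f)^[m] (c, -1) := by
      refine eventuallyPeriodic_iterate (k := 0)
        (((Set.finite_Iio j).image fun k => f^[k] c).prod (Set.finite_univ (α := ℤˣ)))
        fun m _ => ?_
      obtain ⟨k, hk, hk'⟩ := horb m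
      exact ⟨⟨k, hk, by rw [germMap_iterate, hk']⟩, Set.mem_univ _⟩
    refine (hper.comp fun γ => - γ.2).congr 0 fun m _ => ?_
    rw [germMap_iterate]
    simp
  · push Not at hfin
    obtain ⟨x, hx, m, hlim⟩ := ha
    set Q := minimalPeriod f x with hQ
    have hQ0 : 0 < Q := minimalPeriod_pos_of_mem_periodicPts hx
    have hne : ∀ n, 0 < n → f^[n] c ≠ c := fun n hn he => hfin 0 n hn he.symm
    -- A limiting orbit through `c` would make `c` periodic, against the infinite orbit.
    have hxc : ∀ r, f^[r] x ≠ c := by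
      intro r hr
      have : IsPeriodicPt f Q c := hr ▸ (isPeriodicPt_minimalPeriod f x).apply_iterate r
      exact hne Q hQ0 this
    have hev : ∀ᶠ k in atTop, ∀ r ∈ Set.Iio Q,
        (f^[r] (f^[k * Q + m] c) < c ↔ f^[r] x < c) := by
      rw [eventually_all_finite (Set.finite_Iio Q)]
      intro r _
      have h1 := ((h.continuous.iterate r).tendsto x).comp hlim
      rcases lt_or_gt_of_ne (hxc r) with hlt | hlt
      · filter_upwards [h1.eventually_lt_const hlt] with k hk
        exact ⟨fun _ => hlt, fun _ => hk⟩
      · filter_upwards [h1.eventually_const_lt hlt] with k hk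
        exact ⟨fun h' => absurd h' hk.not_gt, fun h' => absurd h' hlt.not_gt⟩
    obtain ⟨K, hK⟩ := eventually_atTop.1 hev
    have hside : ∀ n, K * Q + m ≤ n → (f^[n] c < c ↔ f^[(n - m) % Q] x < c) := by
      intro n hn
      have h1 := hK ((n - m) / Q) ((Nat.le_div_iff_mul_le hQ0).2 (by omega)) ((n - m) % Q)
        (Nat.mod_lt _ hQ0)
      rw [← iterate_add_apply] at h1
      have h2 : (n - m) % Q + ((n - m) / Q * Q + m) = n := by
        have := Nat.mod_add_div (n - m) Q
        rw [mul_comm] at this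
        omega
      rwa [h2] at h1
    set N := K * Q + m + 1 with hN
    have hslope : ∀ n, N ≤ n → slope f (critGerm f c (n + Q)) = slope f (critGerm f c n) := by
      intro n hn
      refine (h.slope_critGerm_eq_iff (hne _ (by omega)) (hne _ (by omega))).2 ?_
      rw [hside n (by omega), hside (n + Q) (by omega), show n + Q - m = n - m + Q by omega,
        Nat.add_mod_right]
    have hw1 : ∀ n, N ≤ n →
        slopeIter f Q (critGerm f c (n + 1)) = slopeIter f Q (critGerm f c n) := by
      intro n hn
      have e1 : slopeIter f (1 + Q) (critGerm f c n) =
          slope f (critGerm f c n) * slopeIter f Q (critGerm f c (n + 1)) := by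
        rw [slopeIter_add, slopeIter_one, critGerm, critGerm, ← iterate_add_apply, add_comm 1 n]
      have e2 : slopeIter f (1 + Q) (critGerm f c n) =
          slope f (critGerm f c n) * slopeIter f Q (critGerm f c n) := by
        rw [add_comm, slopeIter_add, slopeIter_one, ← hslope n hn, mul_comm]
        simp only [critGerm, ← iterate_add_apply, add_comm]
      exact mul_left_cancel (e1.symm.trans e2)
    have hw : ∀ n, N ≤ n → ∀ k,
        slopeIter f Q (critGerm f c (n + k)) = slopeIter f Q (critGerm f c n) := by
      intro n hn k
      induction k with
      | zero => rfl
      | succ k ih => rw [← ih, ← add_assoc, hw1 (n + k) (by omega)]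
    -- The slope of f^Q along the orbit is eventually a constant sign; doubling the period makes it
    -- 1.
    refine ⟨N, Q + Q, by omega, fun n hn => ?_⟩
    dsimp only
    rw [← add_assoc, slopeIter_critGerm, slopeIter_critGerm, hw n hn, mul_assoc,
      Int.units_mul_self, mul_one]

theorem eventuallyPeriodic_iff_isRationalSeries_critSeries :
    (EventuallyPeriodic fun m => slopeIter f m (c, -1)) ↔ IsRationalSeries (critSeries f c) := by
  constructor
  · intro h
    exact ((h.comp sgn).congr 1 fun m hm => if_neg (by omega)).isRationalSeries
  · intro h
    have h1 : EventuallyPeriodic fun m : ℕ => if m = 0 then 0 else sgn (slopeIter f m (c, -1)) := by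
      refine EventuallyPeriodic.of_isRationalSeries ?_ h
      refine (Set.toFinite ({0, 1, -1} : Set ℚ)).subset ?_
      rintro _ ⟨m, rfl⟩
      dsimp only
      split_ifs
      · simp
      · rcases Int.units_eq_one_or (slopeIter f m (c, -1)) with e | e <;> rw [e] <;> simp
    obtain ⟨M, P, hP, hM⟩ := h1
    -- Starting at `M + 1` avoids coefficient 0 of `critSeries`, which is 0 instead of a sign.
    refine ⟨M + 1, P, hP, fun m hm => sgn_injective ?_⟩
    have := hM m (by omega)
    dsimp only at this ⊢
    rwa [if_neg (by omega), if_neg (by omega)] at this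

theorem IsUnimodalCore.isRationalSeries_artinMazurZeta_iff (h : IsUnimodalCore f p q c)
    (hR : (nonRepelling f).Finite) :
    IsRationalSeries (artinMazurZeta f) ↔ IsAsymptoticToPeriodicOrbit f c := by
  classical
  have := h.finite.fintype
  have key : IsRationalSeries (artinMazurZeta f) ↔ IsRationalSeries (kneading f).det := by
    obtain ⟨F, hF, hF1, hprod⟩ := artinMazurZeta_mul_det h.continuous h.bot_lt_top hR
    have hζ : constantCoeff (artinMazurZeta f) = 1 :=
      constantCoeff_zeta fun n => ((isolatedFixedPts f n).ncard : ℚ)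
    have hne : ∀ {G : ℚ⟦X⟧}, constantCoeff G = 1 → G ≠ 0 := by
      rintro G hG rfl
      simp at hG
    constructor
    · intro h1
      refine IsRationalSeries.of_mul_eq (h1.mul hF) (isRationalSeries_one_sub (endSlope f))
        (hne (by rw [map_mul, hζ, hF1, one_mul])) ?_
      rw [← hprod]; ring
    · intro h1
      refine IsRationalSeries.of_mul_eq (h1.mul hF) (isRationalSeries_one_sub (endSlope f))
        (hne (by rw [map_mul, det_kneading_constantCoeff, hF1, one_mul])) ?_
      rw [← hprod]; ring
  rw [key, h.isRationalSeries_det_iff, ← eventuallyPeriodic_iff_isRationalSeries_critSeries]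
  exact ⟨h.isAsymptotic_of_eventuallyPeriodic, h.eventuallyPeriodic_of_isAsymptotic⟩

end Asymptotic

/-! ### Virtually unimodal maps -/

section Interval

variable {a b : ℝ} {f : Set.Icc a b → Set.Icc a b} {c : Set.Icc a b}

/-- A turning point other than a subdivision point would lie inside a piece where `f` is strictly
monotone. -/
theorem IsPiecewiseMonotone.finite_turningPoints (hf : IsPiecewiseMonotone f) :
    (turningPoints f).Finite := by
  obtain ⟨m, p, hp, hp0, hp1, hmono⟩ := hf.exists_subdivision
  refine (Set.finite_range p).subset fun x hx => ?_
  by_contra hnot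
  obtain ⟨i, hi1, hi2⟩ : ∃ i : Fin (m + 1), p i.castSucc < x ∧ x < p i.succ := by
    by_contra hcon
    push Not at hcon
    have hall : ∀ j : Fin (m + 2), p j < x := by
      intro j
      induction j using Fin.induction with
      | zero =>
        rw [← Subtype.coe_lt_coe, hp0]
        exact hx.1
      | succ i ih => exact lt_of_le_of_ne (hcon i ih) fun he => hnot ⟨_, he⟩
    have := hall (Fin.last (m + 1))
    rw [← Subtype.coe_lt_coe, hp1] at this
    exact this.not_ge x.2.2
  have hnear : ∀ᶠ y in 𝓝 x, y ∈ Set.Ioo (p i.castSucc) (p i.succ) := Ioo_mem_nhds hi1 hi2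
  have hnr : ∃ᶠ u in 𝓝 x, x < u :=
    have := nhdsGT_neBot_of_exists_gt ⟨_, hi2⟩
    (eventually_mem_nhdsWithin (a := x) (s := Set.Ioi x)).frequently.filter_mono nhdsWithin_le_nhds
  have hnl : ∃ᶠ u in 𝓝 x, u < x :=
    have := nhdsLT_neBot_of_exists_lt ⟨_, hi1⟩
    (eventually_mem_nhdsWithin (a := x) (s := Set.Iio x)).frequently.filter_mono nhdsWithin_le_nhds
  have hxm : x ∈ Set.Icc (p i.castSucc) (p i.succ) := ⟨hi1.le, hi2.le⟩
  rcases hx.2.2 with hext | hext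
  · obtain ⟨u, hu1, hu2, hu3⟩ := (hnr.and_eventually (hnear.and hext)).exists
    obtain ⟨v, hv1, hv2, hv3⟩ := (hnl.and_eventually (hnear.and hext)).exists
    rcases hmono i with hm | hm
    · exact (hm (Set.Ioo_subset_Icc_self hv2) hxm hv1).not_ge hv3
    · exact (hm hxm (Set.Ioo_subset_Icc_self hu2) hu1).not_ge hu3
  · obtain ⟨u, hu1, hu2, hu3⟩ := (hnr.and_eventually (hnear.and hext)).exists
    obtain ⟨v, hv1, hv2, hv3⟩ := (hnl.and_eventually (hnear.and hext)).exists
    rcases hmono i with hm | hm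
    · exact (hm hxm (Set.Ioo_subset_Icc_self hu2) hu1).not_ge hu3
    · exact (hm (Set.Ioo_subset_Icc_self hv2) hxm hv1).not_ge hv3

theorem IsVirtuallyUnimodal.mem_Ioo (hf : IsVirtuallyUnimodal f c) :
    c ∈ Set.Ioo (min (f (f c)) (f c)) (max (f (f c)) (f c)) := by
  have h : (c : ℝ) ∈ (Subtype.val '' turningPoints f) ∩
      interior (Set.uIcc (f (f c) : ℝ) (f c : ℝ)) := by
    rw [hf.turningPoints_inter]; rfl
  have h2 := h.2
  rw [Set.uIcc, interior_Icc] at h2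
  rw [Set.mem_Ioo, min_lt_iff, lt_max_iff]
  rw [Set.mem_Ioo, inf_lt_iff, lt_sup_iff] at h2
  exact h2

theorem IsVirtuallyUnimodal.unique (hf : IsVirtuallyUnimodal f c) {x : Set.Icc a b}
    (hx : x ∈ turningPoints f)
    (hx' : x ∈ Set.Ioo (min (f (f c)) (f c)) (max (f (f c)) (f c))) : x = c := by
  have h : (x : ℝ) ∈ (Subtype.val '' turningPoints f) ∩
      interior (Set.uIcc (f (f c) : ℝ) (f c : ℝ)) := by
    refine ⟨⟨x, hx, rfl⟩, ?_⟩
    rw [Set.uIcc, interior_Icc, Set.mem_Ioo, inf_lt_iff, lt_sup_iff]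
    rw [Set.mem_Ioo, min_lt_iff, lt_max_iff] at hx'
    exact hx'
  rw [hf.turningPoints_inter] at h
  exact Subtype.ext h

end Interval

end IntervalDynamics

theorem mainTheorem4 {a b : ℝ} (hab : a < b)
    (f : Set.Icc a b → Set.Icc a b) (c : Set.Icc a b)
    (hf : IntervalDynamics.IsVirtuallyUnimodal f c)
    (hrep : {x | x ∈ Function.periodicPts f ∧
      ¬ IntervalDynamics.IsRepellingPeriodicPt f x}.Finite) :
    IntervalDynamics.IsRationalSeries (IntervalDynamics.artinMazurZeta f) ↔
      IntervalDynamics.IsAsymptoticToPeriodicOrbit f c := by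
  have : Fact (a ≤ b) := ⟨hab.le⟩
  let _ : Inhabited (Set.Icc a b) := ⟨c⟩
  let _ : ConditionallyCompleteLinearOrder (Set.Icc a b) :=
    ordConnectedSubsetConditionallyCompleteLinearOrder (Set.Icc a b)
  have hturn : IntervalDynamics.turning f = IntervalDynamics.turningPoints f := rfl
  have hcont := hf.piecewiseMonotone.continuous
  have huIcc : ∀ x, x ∈ Set.uIcc (f (f c)) (f c) ↔
      x ∈ Set.Icc (min (f (f c)) (f c)) (max (f (f c)) (f c)) := fun x => Iff.rfl
  -- The ends of the hull are f²(c) and f(c), so their images are f³(c) and f²(c), which (VU2)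
  -- controls.
  have hend : ∀ x, x = min (f (f c)) (f c) ∨ x = max (f (f c)) (f c) →
      f x ∈ Set.Icc (min (f (f c)) (f c)) (max (f (f c)) (f c)) := by
    intro x hx
    have hx' : x = f (f c) ∨ x = f c := by
      rcases hx with rfl | rfl
      · exact min_choice _ _
      · exact max_choice _ _
    rcases hx' with rfl | rfl
    · exact (huIcc _).1 (hf.orbit_subset 3)
    · exact (huIcc _).1 (hf.orbit_subset 2)
  have hcI := hf.mem_Ioo
  have hfc := (huIcc _).1 (hf.orbit_subset 1)
  refine IntervalDynamics.IsUnimodalCore.isRationalSeries_artinMazurZeta_iff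
    (p := min (f (f c)) (f c)) (q := max (f (f c)) (f c)) ?_ hrep
  refine ⟨hcont, hf.piecewiseMonotone.finite_turningPoints, ?_, hf.mem_turningPoints, hcI,
    fun x hx hx' => hf.unique hx hx', ?_⟩
  -- On each side of `c` the map is monotone, so its values on the hull are bounded by those at the
  -- two ends and at `c`, all of which lie in the hull.
  · intro x hx
    rcases le_total x c with hxc | hxc
    · rcases IntervalDynamics.strictMonoOn_or_strictAntiOn hcont hcI.1 fun w hw hw' =>
        hw.2.ne (hf.unique hw' ⟨hw.1, hw.2.trans hcI.2⟩) with hm | hm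
      · exact ⟨(hend _ (Or.inl rfl)).1.trans (hm.monotoneOn ⟨le_rfl, hcI.1.le⟩ ⟨hx.1, hxc⟩ hx.1),
          (hm.monotoneOn ⟨hx.1, hxc⟩ ⟨hcI.1.le, le_rfl⟩ hxc).trans hfc.2⟩
      · exact ⟨hfc.1.trans (hm.antitoneOn ⟨hx.1, hxc⟩ ⟨hcI.1.le, le_rfl⟩ hxc),
          (hm.antitoneOn ⟨le_rfl, hcI.1.le⟩ ⟨hx.1, hxc⟩ hx.1).trans (hend _ (Or.inl rfl)).2⟩
    · rcases IntervalDynamics.strictMonoOn_or_strictAntiOn hcont hcI.2 fun w hw hw' =>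
        hw.1.ne' (hf.unique hw' ⟨hcI.1.trans hw.1, hw.2⟩) with hm | hm
      · exact ⟨hfc.1.trans (hm.monotoneOn ⟨le_rfl, hcI.2.le⟩ ⟨hxc, hx.2⟩ hxc),
          (hm.monotoneOn ⟨hxc, hx.2⟩ ⟨hcI.2.le, le_rfl⟩ hx.2).trans (hend _ (Or.inr rfl)).2⟩
      · exact ⟨(hend _ (Or.inr rfl)).1.trans
          (hm.antitoneOn ⟨hxc, hx.2⟩ ⟨hcI.2.le, le_rfl⟩ hx.2),
          (hm.antitoneOn ⟨le_rfl, hcI.2.le⟩ ⟨hxc, hx.2⟩ hxc).trans hfc.2⟩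
  · obtain ⟨k, hk⟩ := hf.turningPoints_image
    exact ⟨k, fun x hx => (huIcc _).1 (hk ⟨x, hx, rfl⟩)⟩
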